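/- Let $p>1$, $p'=p/(p-1)$, $S=\mathbb R^d$ with $d\ge1$, and $\mathbb X=S\times S$ with its Euclidean norm and points $x=(x_1,x_2)$. Let $\mathcal P_p(\mathbb X)$ be the set of Borel probability measures on $\mathbb X$ with finite $p$-th moment. Let $\mathbb W_p$ be the $p$-Wasserstein distance, and $\mathbb W_p^{\rm ad}$ the adapted one, i.e. the infimum of $\mathbb E^\pi[|X-X'|^p]^{1/p}$ over bi-causal couplings $\pi$ only. Here a law of $(X,X')$ on $\mathbb X\times\mathbb X$ is causal if $(X_1,X_2)$ and $X_1'$ are conditionally independent given $X_1$, and bi-causal if it and its image under swapping $X$ and $X'$ are causal. Fix $\mathbf d\in\{\mathbb W_p,\mathbb W_p^{\rm ad}\}$ and $\mu\in\mathcal P_p(\mathbb X)$ with first marginal $\mu_1$, and write $\mathbb E=\mathbb E^\mu$, $\mathbb E_1[\cdot]=\mathbb E^\mu[\,\cdot\,|X_1]$. Set $\partial_x^{\mathbf d}u=\partial_xu$ if $\mathbf d=\mathbb W_p$ and $\partial^{\mathbf d}_xu=\partial_x^{\rm ad}u=(\mathbb E_1[\partial_{x_1}u],\partial_{x_2}u)$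 if $\mathbf d=\mathbb W_p^{\rm ad}$. For a matrix $A$ with Euclidean norm $|A|$ let $\mathbf N(A)=A/|A|^{2-p'}$ (with $\mathbf N(0)=0$), and for a matrix with two column blocks $A=(A_1,A_2)$ let $\mathbf N_{\rm ad}(A)=(\mathbf N(A_1),\mathbf N(A_2))$. Let $\varphi:\mathcal P_p(\mathbb X)\to\mathbb R^k$ satisfy $\varphi(\mu)=0$ and have a linear functional derivative: a map $\delta_m\varphi:\mathcal P_p(\mathbb X)\times\mathbb X\to\mathbb R^k$ that is jointly continuous, with growth $O(1+|x|^p)$ locally uniformly in $m$, such that $\frac1t\big(\varphi(m+t(m'-m))-\varphi(m)\big)\to\int\delta_m\varphi(m,\cdot)\,d(m'-m)$ as $t\searrow0$ for all $m,m'\in\mathcal P_p(\mathbb X)$. Assume also that $\delta_m\varphi$ is $C^1$ in $x$ and that $\partial_x\delta_m\varphi$ is jointly continuous with growth $O(1+|x|^{p-1})$ locally uniformly in $m$. (The topology on $\mathcal P_p(\mathbb X)$ is that of $\mathbb W_p$.) Below, $\delta_m\varphi$ without a measure argument is $\delta_m\varphi(\mu,\cdot)$. Let $\psi:\mathbb X\to\mathbb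 R^l$, and let $\mathcal E_\psi^\perp$ be the set of $\nu\in\mathcal P_p(\mathbb X)$ with $\int h(x_1)\cdot\psi(x)\,\nu(dx)=0$ for all $C^1$ functions $h:S\to\mathbb R^l$ that are bounded with bounded derivative. If $\mathbf d=\mathbb W_p$, assume that $\psi=0$ and $\mathbb E\big[(\partial_x\delta_m\varphi)(\partial_x\delta_m\varphi)^\top/|\partial_x\delta_m\varphi|^{2-p'}\big]\ge c\,\mathrm{Id}$ for some $c>0$. If $\mathbf d=\mathbb W_p^{\rm ad}$, put $\Lambda=\partial_x^{\rm ad}\delta_m\varphi$ and assume that (i) $\mathbb E_1[|X_2|]\in\mathbb L^\infty_{\rm loc}(\mu_1)$; (ii) $\psi$ is $C^2$ with bounded first and second derivatives, and $\mathbb E_1[\psi]=0$; (iii) for some $c>0$, $M:=\mathbb E_1[(\partial_{x_2}\psi)(\partial_{x_2}\psi)^\top]\ge c\,\mathrm{Id}$ almost surely; (iv) for some $c>0$ and all $\lambda\in\mathbb R^k$, $h\in\mathbb L^{p'}(\mu_1;\mathbb R^l)$, $\|\Lambda^\top\lambda+(\partial_x^{\rm ad}\psi)^\top h\|_{\mathbb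 L^{p'}(\mu)}\ge c(|\lambda|+\|h\|_{\mathbb L^{p'}(\mu)})$; (v) the $k\times k$ matrix $\mathbb E\big[\Lambda\mathbf N_{\rm ad}(\Lambda)^\top-(\partial_{x_2}\delta_m\varphi)(\partial_{x_2}\psi)^\top M^{-1}\,\mathbb E_1[\partial_x\psi\,\mathbf N_{\rm ad}(\Lambda)^\top]\big]$ is invertible. Then there is a constant $C>0$ such that $$\limsup_{r\searrow0}\frac1r\,\mathbf d\big(\mu^{r\Theta},\varphi^{-1}(\{0\})\cap\mathcal E_\psi^\perp\big)\le C\,\Big(\big|\mathbb E[(\partial_x^{\mathbf d}\delta_m\varphi)\Theta]\big|+\big\|\mathbb E_1[(\partial_x^{\mathbf d}\psi)\Theta]\big\|_{\mathbb L^p(\mu_1)}\Big)$$ for every compactly supported $C^1$ map $\Theta:\mathbb X\to\mathbb X$ if $\mathbf d=\mathbb W_p$, and for every $\Theta(x)=(\Theta_1(x_1),\Theta_2(x_1,x_2))$ with $\Theta_1:S\to S$ and $\Theta_2:\mathbb X\to S$ of class $C^1$ and compactly supported if $\mathbf d=\mathbb W^{\rm ad}_p$. Here $\mu^{T}=\mu\circ(X+T)^{-1}$,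 and $\mathbf d(m,U)=\inf_{\nu\in U}\mathbf d(m,\nu)$, which is $\infty$ if $U=\emptyset$. -/

import Mathlib

open MeasureTheory Filter Topology
open scoped NNReal ENNReal

noncomputable section

namespace ConstrainedDRO

/-- The state space `S = ℝ^d` with its Euclidean norm. -/
abbrev S (d : ℕ) : Type := EuclideanSpace ℝ (Fin d)

/-- The path space `𝕏 = S × S` with its Euclidean norm `|x|² = |x₁|² + |x₂|²`. -/
abbrev X (d : ℕ) : Type := WithLp 2 (S d × S d)

/-- The choice of a distance: the `p`-Wasserstein distance or its adapted version. -/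
inductive Kind : Type
  | classical : Kind
  | adapted : Kind

/-- The conjugate exponent `p' = p / (p - 1)`. -/
def conj (p : ℝ) : ℝ := p / (p - 1)

/-- Probability measures on `𝕏` with finite `p`-th moment. -/
def Pp (d : ℕ) (p : ℝ) : Type :=
  {m : Measure (X d) // IsProbabilityMeasure m ∧ ∫⁻ x, ‖x‖ₑ ^ p ∂m < ∞}

/-- The convex combination `m + t (m' - m)`. -/
def Pp.mix {d : ℕ} {p : ℝ} (m m' : Pp d p) (t : unitInterval) : Pp d p :=
  ⟨ENNReal.ofReal (1 - t) • m.1 + ENNReal.ofReal t • m'.1, by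
    obtain ⟨m, hm, hm2⟩ := m
    obtain ⟨m', hm', hm2'⟩ := m'
    refine ⟨⟨?_⟩, ?_⟩
    · simp only [Measure.coe_add, Measure.coe_smul, Pi.add_apply, Pi.smul_apply,
        measure_univ, smul_eq_mul, mul_one]
      rw [← ENNReal.ofReal_add (by linarith [t.2.2]) t.2.1]
      simp
    · rw [lintegral_add_measure, lintegral_smul_measure, lintegral_smul_measure]
      exact ENNReal.add_lt_top.2 ⟨ENNReal.mul_lt_top ENNReal.ofReal_lt_top hm2,
        ENNReal.mul_lt_top ENNReal.ofReal_lt_top hm2'⟩⟩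

/-! ### Transport distances -/

/-- `π` is a coupling of `μ` and `ν`. -/
def IsCoupling {d : ℕ} (π : Measure (X d × X d)) (μ ν : Measure (X d)) : Prop :=
  π.map Prod.fst = μ ∧ π.map Prod.snd = ν

/-- Causality of a measure on `𝕏 × 𝕏`: given `X₁`, the pair `(X₁, X₂)` and `X'₁` are
conditionally independent. -/
def IsCausal {d : ℕ} (π : Measure (X d × X d)) : Prop :=
  ∀ (f : X d → ℝ) (g : S d → ℝ), Measurable f → Measurable g →
    (∃ K, ∀ x, |f x| ≤ K) → (∃ K, ∀ y, |g y| ≤ K) →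
    π[fun z => f z.1 * g z.2.fst | MeasurableSpace.comap (fun z => z.1.fst) inferInstance]
      =ᵐ[π]
    π[fun z => f z.1 | MeasurableSpace.comap (fun z => z.1.fst) inferInstance] *
    π[fun z => g z.2.fst | MeasurableSpace.comap (fun z => z.1.fst) inferInstance]

/-- Couplings that are admissible for the chosen distance: all couplings, respectively the
bi-causal ones. -/
def IsAdmissible {d : ℕ} (kd : Kind) (π : Measure (X d × X d)) (μ ν : Measure (X d)) : Prop :=
  match kd with
  | .classical => IsCoupling π μ ν
  | .adapted => IsCoupling π μ ν ∧ IsCausal π ∧ IsCausal (π.map Prod.swap)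

/-- The distance `𝕎_p` (for `classical`) or `𝕎_p^ad` (for `adapted`), with values in `[0, ∞]`. -/
def transportDist {d : ℕ} (kd : Kind) (p : ℝ) (μ ν : Measure (X d)) : ℝ≥0∞ :=
  ⨅ (π : Measure (X d × X d)) (_ : IsAdmissible kd π μ ν),
    (∫⁻ z, ‖z.1 - z.2‖ₑ ^ p ∂π) ^ (1 / p)

/-- The distance from `μ` to a set of measures (`∞` if the set is empty). -/
def distToSet {d : ℕ} {p : ℝ} (kd : Kind) (μ : Measure (X d)) (U : Set (Pp d p)) : ℝ≥0∞ :=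
  ⨅ ν ∈ U, transportDist kd p μ ν.1

/-! ### Functionals on measures -/

/-- Joint continuity on `𝒫_p(𝕏) × 𝕏`, where `𝒫_p(𝕏)` carries the distance `𝕎_p`. -/
def JointlyContinuous {d : ℕ} {p : ℝ} {F : Type*} [NormedAddCommGroup F]
    (f : Pp d p → X d → F) : Prop :=
  ∀ (m : Pp d p) (x : X d), ∀ ε > (0 : ℝ), ∃ δ > (0 : ℝ), ∀ (m' : Pp d p) (x' : X d),
    transportDist .classical p m.1 m'.1 < ENNReal.ofReal δ → ‖x' - x‖ < δ →
      ‖f m' x' - f m x‖ < ε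

/-- Growth of order `q` in `x`, locally uniformly in `m` for the distance `𝕎_p`. -/
def LocallyGrowth {d : ℕ} {p : ℝ} {F : Type*} [NormedAddCommGroup F] (q : ℝ)
    (f : Pp d p → X d → F) : Prop :=
  ∀ m : Pp d p, ∃ δ > (0 : ℝ), ∃ K : ℝ, ∀ (m' : Pp d p) (x : X d),
    transportDist .classical p m.1 m'.1 < ENNReal.ofReal δ → ‖f m' x‖ ≤ K * (1 + ‖x‖ ^ q)

/-- `D` is a linear functional derivative `δ_m φ` of `φ : 𝒫_p(𝕏) → ℝ^k`. -/
structure IsLinearFunctionalDeriv {d k : ℕ} {p : ℝ} (φ : Pp d p → EuclideanSpace ℝ (Fin k))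
    (D : Pp d p → X d → EuclideanSpace ℝ (Fin k)) : Prop where
  continuous : JointlyContinuous D
  growth : LocallyGrowth p D
  deriv : ∀ m m' : Pp d p,
    Tendsto (fun t : unitInterval => (t : ℝ)⁻¹ • (φ (m.mix m' t) - φ m)) (𝓝[>] 0)
      (𝓝 (∫ x, D m x ∂m'.1 - ∫ x, D m x ∂m.1))

/-- The smoothness assumption on `φ`, with linear functional derivative `D`: `D` is `C¹` in `x`,
and `∂_x D` is jointly continuous with growth of order `p - 1` in `x`, locally in `m`. -/
structure RegularFunctional {d k : ℕ} {p : ℝ} (φ : Pp d p → EuclideanSpace ℝ (Fin k))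
    (D : Pp d p → X d → EuclideanSpace ℝ (Fin k)) : Prop where
  isDeriv : IsLinearFunctionalDeriv φ D
  contDiff : ∀ m, ContDiff ℝ 1 (D m)
  grad_continuous : JointlyContinuous fun m x => fderiv ℝ (D m) x
  grad_growth : LocallyGrowth (p - 1) fun m x => fderiv ℝ (D m) x

/-! ### Gradients and conditional expectations

A matrix with `n` rows in a Euclidean space `E` is written as a family `Fin n → E` of its rows. -/

/-- `𝔼^μ_1[f] = 𝔼^μ[f(X) | X₁]`, as a function on `𝕏` that depends on `x₁` only. -/
def condE1 {d : ℕ} {F : Type*} [NormedAddCommGroup F] [NormedSpace ℝ F] [CompleteSpace F]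
    (μ : Measure (X d)) (f : X d → F) : X d → F :=
  μ[f | MeasurableSpace.comap (fun x : X d => x.fst) inferInstance]

/-- The Jacobian `∂_x u` of `u : 𝕏 → ℝ^n`; its rows are the gradients of the components. -/
def jac {d n : ℕ} (u : X d → EuclideanSpace ℝ (Fin n)) (x : X d) : Fin n → X d :=
  fun i => gradient (fun y => u y i) x

/-- The gradient `∂_x^kd`: the Jacobian, respectively `(𝔼^μ_1[∂_{x₁} u], ∂_{x₂} u)`. -/
def grad {d n : ℕ} (kd : Kind) (μ : Measure (X d)) (u : X d → EuclideanSpace ℝ (Fin n)) :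
    X d → Fin n → X d :=
  match kd with
  | .classical => jac u
  | .adapted => fun x i =>
      WithLp.toLp 2 (condE1 μ (fun y => (jac u y i).fst) x, (jac u x i).snd)

/-- The product `A Bᵀ` of two matrices given by their rows. -/
def mulT {n m : ℕ} {E : Type*} [NormedAddCommGroup E] [InnerProductSpace ℝ E]
    (A : Fin n → E) (B : Fin m → E) : Matrix (Fin n) (Fin m) ℝ :=
  Matrix.of fun i j => inner ℝ (A i) (B j)

/-- The matrix-vector product `A v`. -/
def mulV {n : ℕ} {E : Type*} [NormedAddCommGroup E] [InnerProductSpace ℝ E]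
    (A : Fin n → E) (v : E) : EuclideanSpace ℝ (Fin n) :=
  WithLp.toLp 2 fun i => inner ℝ (A i) v

/-- The product `Aᵀ c = ∑ i, c_i A_i`. -/
def tmulV {n : ℕ} {E : Type*} [NormedAddCommGroup E] [InnerProductSpace ℝ E]
    (A : Fin n → E) (c : EuclideanSpace ℝ (Fin n)) : E :=
  ∑ i, c i • A i

/-- The Euclidean norm of a matrix. -/
def frob {n : ℕ} {E : Type*} [NormedAddCommGroup E] (A : Fin n → E) : ℝ :=
  Real.sqrt (∑ i, ‖A i‖ ^ 2)

/-- `𝐍(A) = A / |A|^(2 - p')`, which is `0` at `A = 0`. -/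
def bigN {n : ℕ} {E : Type*} [NormedAddCommGroup E] [InnerProductSpace ℝ E] (p : ℝ)
    (A : Fin n → E) : Fin n → E :=
  fun i => (frob A ^ (2 - conj p))⁻¹ • A i

/-- `𝐍_ad(A)`: the map `𝐍` applied to the two blocks of `A = (A₁, A₂)` separately. -/
def bigNad {d n : ℕ} (p : ℝ) (A : Fin n → X d) : Fin n → X d :=
  fun i => WithLp.toLp 2
    (bigN p (fun j => (A j).fst) i, bigN p (fun j => (A j).snd) i)

/-- The block `∂_{x₂} u` of the Jacobian. -/
def jac2 {d n : ℕ} (u : X d → EuclideanSpace ℝ (Fin n)) (x : X d) : Fin n → S d :=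
  fun i => (jac u x i).snd

/-! ### Constraints -/

/-- `C¹_b(S, ℝ^l)`. -/
def IsC1b {d l : ℕ} (h : S d → EuclideanSpace ℝ (Fin l)) : Prop :=
  ContDiff ℝ 1 h ∧ ∃ K, ∀ y, ‖h y‖ ≤ K ∧ ‖fderiv ℝ h y‖ ≤ K

/-- `𝓔_ψ`, the set of the functions `x ↦ h(x₁) · ψ(x)` with `h ∈ C¹_b`. -/
def calE {d l : ℕ} (ψ : X d → EuclideanSpace ℝ (Fin l)) : Set (X d → ℝ) :=
  {f | ∃ h : S d → EuclideanSpace ℝ (Fin l), IsC1b h ∧ f = fun x => inner ℝ (h x.fst) (ψ x)}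

/-- `𝓔^⊥` inside `𝒫_p(𝕏)`. -/
def perp {d : ℕ} (p : ℝ) (E : Set (X d → ℝ)) : Set (Pp d p) :=
  {m | ∀ f ∈ E, ∫ x, f x ∂m.1 = 0}

/-- The assumption for `𝕎_p`. Here `Dμ = δ_m φ(μ, ·)`. -/
structure AssumptionW {d k l : ℕ} (p : ℝ) (μ : Measure (X d))
    (Dμ : X d → EuclideanSpace ℝ (Fin k)) (ψ : X d → EuclideanSpace ℝ (Fin l)) : Prop where
  psi_zero : ψ = 0
  nondegenerate : ∃ c > (0 : ℝ),
    (Matrix.of (fun i j => ∫ x, mulT (jac Dμ x) (jac Dμ x) i j / frob (jac Dμ x) ^ (2 - conj p) ∂μ)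
      - c • (1 : Matrix (Fin k) (Fin k) ℝ)).PosSemidef

/-- The conditional Gram matrix `𝔼^μ_1[(∂_{x₂} ψ)(∂_{x₂} ψ)ᵀ]`. -/
def condGram {d l : ℕ} (μ : Measure (X d)) (ψ : X d → EuclideanSpace ℝ (Fin l)) (x : X d) :
    Matrix (Fin l) (Fin l) ℝ :=
  Matrix.of fun i j => condE1 μ (fun y => mulT (jac2 ψ y) (jac2 ψ y) i j) x

/-- The matrix `𝔼^μ_1[∂_x ψ 𝐍_ad(Λ)ᵀ]` with `Λ = ∂_x^ad δ_m φ`. -/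
def condCross {d k l : ℕ} (p : ℝ) (μ : Measure (X d)) (Dμ : X d → EuclideanSpace ℝ (Fin k))
    (ψ : X d → EuclideanSpace ℝ (Fin l)) (x : X d) : Matrix (Fin l) (Fin k) ℝ :=
  Matrix.of fun i j =>
    condE1 μ (fun y => mulT (jac ψ y) (bigNad p (grad .adapted μ Dμ y)) i j) x

/-- The matrix `H = 𝔼[Λ 𝐍_ad(Λ)ᵀ
  - (∂_{x₂} δ_m φ)(∂_{x₂} ψ)ᵀ 𝔼_1[(∂_{x₂} ψ)(∂_{x₂} ψ)ᵀ]⁻¹ 𝔼_1[∂_x ψ 𝐍_ad(Λ)ᵀ]]`. -/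
def matH {d k l : ℕ} (p : ℝ) (μ : Measure (X d)) (Dμ : X d → EuclideanSpace ℝ (Fin k))
    (ψ : X d → EuclideanSpace ℝ (Fin l)) : Matrix (Fin k) (Fin k) ℝ :=
  Matrix.of fun i j => ∫ x,
    (mulT (grad .adapted μ Dμ x) (bigNad p (grad .adapted μ Dμ x))
      - mulT (jac2 Dμ x) (jac2 ψ x) * (condGram μ ψ x)⁻¹ * condCross p μ Dμ ψ x) i j ∂μ

/-- The assumption for `𝕎_p^ad`. Here `Dμ = δ_m φ(μ, ·)`. -/
structure AssumptionWad {d k l : ℕ} (p : ℝ) (μ : Measure (X d))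
    (Dμ : X d → EuclideanSpace ℝ (Fin k)) (ψ : X d → EuclideanSpace ℝ (Fin l)) : Prop where
  locally_bounded : ∀ K : Set (S d), IsCompact K →
    MemLp (Set.indicator {x : X d | x.fst ∈ K} (condE1 μ fun y => ‖y.snd‖)) ∞ μ
  psi_contDiff : ContDiff ℝ 2 ψ
  psi_bounded : ∃ K, ∀ x, ‖fderiv ℝ ψ x‖ ≤ K ∧ ‖fderiv ℝ (fderiv ℝ ψ) x‖ ≤ K
  psi_cond : condE1 μ ψ =ᵐ[μ] 0
  gram : ∃ c > (0 : ℝ), ∀ᵐ x ∂μ,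
    (condGram μ ψ x - c • (1 : Matrix (Fin l) (Fin l) ℝ)).PosSemidef
  nonredundant : ∃ c > (0 : ℝ), ∀ (lam : EuclideanSpace ℝ (Fin k))
    (h : S d → EuclideanSpace ℝ (Fin l)),
    MemLp h (ENNReal.ofReal (conj p)) (μ.map fun x => x.fst) →
    ENNReal.ofReal c * (‖lam‖ₑ + eLpNorm (fun x => h x.fst) (ENNReal.ofReal (conj p)) μ) ≤
      eLpNorm (fun x => tmulV (grad .adapted μ Dμ x) lam + tmulV (grad .adapted μ ψ x) (h x.fst))
        (ENNReal.ofReal (conj p)) μ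
  invertible : IsUnit (matH p μ Dμ ψ)

/-- The assumption that belongs to the distance `kd`. -/
def AssumptionA {d k l : ℕ} (kd : Kind) (p : ℝ) (μ : Measure (X d))
    (Dμ : X d → EuclideanSpace ℝ (Fin k)) (ψ : X d → EuclideanSpace ℝ (Fin l)) : Prop :=
  match kd with
  | .classical => AssumptionW p μ Dμ ψ
  | .adapted => AssumptionWad p μ Dμ ψ

/-- Compactly supported `C¹` vector fields in `𝕃^p_kd`. In the adapted case
`Θ(x) = (Θ₁(x₁), Θ₂(x₁, x₂))`, and the support condition is on `Θ₁` as a function on `S` and on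
`Θ₂` as a function on `𝕏`. -/
def IsTestField {d : ℕ} (kd : Kind) (Θ : X d → X d) : Prop :=
  match kd with
  | .classical => ContDiff ℝ 1 Θ ∧ HasCompactSupport Θ
  | .adapted => ∃ (Θ₁ : S d → S d) (Θ₂ : X d → S d),
      ContDiff ℝ 1 Θ₁ ∧ HasCompactSupport Θ₁ ∧ ContDiff ℝ 1 Θ₂ ∧ HasCompactSupport Θ₂ ∧
      ∀ x, Θ x = WithLp.toLp 2 (Θ₁ x.fst, Θ₂ x)

/-- The pushforward `μ^T = μ ∘ (X + T)⁻¹`. -/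
def shift {d : ℕ} (μ : Measure (X d)) (T : X d → X d) : Measure (X d) :=
  μ.map fun x => x + T x

/-- First component `𝔼^μ[(∂_x^kd δ_m φ) Θ]` of the linearised constraint operator. -/
def opL1 {d k : ℕ} (kd : Kind) (μ : Measure (X d)) (Dμ : X d → EuclideanSpace ℝ (Fin k))
    (Θ : X d → X d) : EuclideanSpace ℝ (Fin k) :=
  ∫ x, mulV (grad kd μ Dμ x) (Θ x) ∂μ

/-- Second component `𝔼^μ_1[(∂_x^kd ψ) Θ]` of the linearised constraint operator. -/
def opL2 {d l : ℕ} (kd : Kind) (μ : Measure (X d)) (ψ : X d → EuclideanSpace ℝ (Fin l))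
    (Θ : X d → X d) : X d → EuclideanSpace ℝ (Fin l) :=
  condE1 μ fun x => mulV (grad kd μ ψ x) (Θ x)

/-- The norm of the linearised constraint operator at `Θ`. The second component depends on `x₁`
only, so its norm in `𝕃^p(μ₁)` is its norm in `𝕃^p(μ)`. -/
def opNorm {d k l : ℕ} (kd : Kind) (p : ℝ) (μ : Measure (X d))
    (Dμ : X d → EuclideanSpace ℝ (Fin k)) (ψ : X d → EuclideanSpace ℝ (Fin l))
    (Θ : X d → X d) : ℝ≥0∞ :=
  ‖opL1 kd μ Dμ Θ‖ₑ + eLpNorm (opL2 kd μ ψ Θ) (ENNReal.ofReal p) μ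

end ConstrainedDRO

end

open ConstrainedDRO

/-!
Along displacements `x ↦ x + r U(x)` with `U` bounded and measurable, `φ` has a strict derivative
at `r = 0`, namely `U ↦ 𝔼[(∂_x δ_m φ) U]`, and the constraint `𝔼_1[ψ] = 0` linearises to
`U ↦ 𝔼_1[(∂_x ψ) U]`. The assumptions say, by duality, that these linear maps have no common
multiplier, so together they have a bounded linear right inverse `T`; for the second map it is
given by a vertical field `(0, (∂_{x₂} ψ)ᵀ M⁻¹ g)`. Newton's method on the range of `T`, at scale
`r`, then corrects `Θ` to a field `Θ + T z` whose displacement satisfies both constraints exactly,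
and `z` tends to minus the linearised defect of `Θ` as `r → 0`. In the adapted case the first
components of the fields are Lipschitz functions of `x₁` alone, so that `x₁ ↦ x₁ + r Θ₁(x₁)` is
invertible for small `r` and the coupling of the two displaced laws is bi-causal.
-/

namespace ConstrainedDRO

section BoundedMeasurable

variable (α E : Type*) [MeasurableSpace α] [NormedAddCommGroup E] [NormedSpace ℝ E]
  [MeasurableSpace E] [BorelSpace E] [SecondCountableTopology E]

/-- The bounded measurable functions, as a subspace of the bounded functions. -/
def boundedMeasurableSubmodule : Submodule ℝ (lp (fun _ : α => E) ∞) where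
  carrier := {f | Measurable (f : α → E)}
  add_mem' hf hg := Measurable.add hf hg
  zero_mem' := measurable_const
  smul_mem' c _ hf := Measurable.const_smul hf c

/-- The space of bounded measurable functions with the supremum norm: the space of the displacement
fields and of the correction parameters, where the Newton iteration takes place. -/
abbrev BoundedMeasurable : Type _ := boundedMeasurableSubmodule α E

instance : CoeFun (BoundedMeasurable α E) fun _ => α → E := ⟨fun f => f.1⟩

theorem isClosed_boundedMeasurableSubmodule :
    IsClosed (boundedMeasurableSubmodule α E : Set (lp (fun _ : α => E) ∞)) := by
  refine IsSeqClosed.isClosed fun f g hf hfg => ?_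
  refine measurable_of_tendsto_metrizable (f := fun n => (f n : α → E)) hf ?_
  refine tendsto_pi_nhds.2 fun a => ?_
  rw [tendsto_iff_norm_sub_tendsto_zero] at hfg ⊢
  exact squeeze_zero (fun _ => norm_nonneg _)
    (fun n => lp.norm_apply_le_norm ENNReal.top_ne_zero (f n - g) a) hfg

instance [CompleteSpace E] : CompleteSpace (BoundedMeasurable α E) :=
  (isClosed_boundedMeasurableSubmodule α E).completeSpace_coe

namespace BoundedMeasurable

variable {α E}

theorem measurable (f : BoundedMeasurable α E) : Measurable f := f.2

theorem norm_apply_le (f : BoundedMeasurable α E) (a : α) : ‖f a‖ ≤ ‖f‖ :=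
  lp.norm_apply_le_norm ENNReal.top_ne_zero f.1 a

theorem norm_le {f : BoundedMeasurable α E} {C : ℝ} (hC : 0 ≤ C) (h : ∀ a, ‖f a‖ ≤ C) : ‖f‖ ≤ C :=
  lp.norm_le_of_forall_le hC h

theorem eLpNorm_le (f : BoundedMeasurable α E) (q : ℝ≥0∞) (μ : Measure α)
    [IsProbabilityMeasure μ] : eLpNorm f q μ ≤ ENNReal.ofReal ‖f‖ :=
  (eLpNorm_le_of_ae_bound (.of_forall f.norm_apply_le)).trans_eq (by
    rw [measure_univ, ENNReal.one_rpow, one_mul])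

/-- A measurable function with an explicit bound, as an element of `BoundedMeasurable`. -/
def ofBound (f : α → E) (hf : Measurable f) (C : ℝ) (hC : ∀ a, ‖f a‖ ≤ C) :
    BoundedMeasurable α E :=
  ⟨⟨f, memℓp_infty ⟨C, Set.forall_mem_range.2 hC⟩⟩, hf⟩

end BoundedMeasurable

end BoundedMeasurable

section Transport

variable {d : ℕ} {p : ℝ} {μ ν : Measure (X d)}

theorem eLpNorm_ofReal_eq_lintegral_rpow {α E : Type*} [MeasurableSpace α] [NormedAddCommGroup E]
    (hp : 0 < p) (μ : Measure α) (f : α → E) :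
    eLpNorm f (ENNReal.ofReal p) μ = (∫⁻ x, ‖f x‖ₑ ^ p ∂μ) ^ (1 / p) := by
  rw [eLpNorm_eq_lintegral_rpow_enorm_toReal (by simpa using hp) ENNReal.ofReal_ne_top,
    ENNReal.toReal_ofReal hp.le]

theorem transportDist_map_map_le {kd : Kind} (hp : 0 < p) {f g : X d → X d} (hf : Measurable f)
    (hg : Measurable g) (h : IsAdmissible kd (μ.map fun x => (f x, g x)) (μ.map f) (μ.map g)) :
    transportDist kd p (μ.map f) (μ.map g) ≤
      eLpNorm (fun x => f x - g x) (ENNReal.ofReal p) μ := by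
  rw [eLpNorm_ofReal_eq_lintegral_rpow hp]
  refine (iInf₂_le (f := fun π (_ : IsAdmissible kd π (μ.map f) (μ.map g)) =>
    (∫⁻ z, ‖z.1 - z.2‖ₑ ^ p ∂π) ^ (1 / p)) _ h).trans_eq ?_
  rw [lintegral_map (by fun_prop) (by fun_prop)]

theorem isCoupling_map_prodMk (μ : Measure (X d)) {f g : X d → X d} (hf : Measurable f)
    (hg : Measurable g) : IsCoupling (μ.map fun x => (f x, g x)) (μ.map f) (μ.map g) :=
  ⟨Measure.map_map measurable_fst (hf.prodMk hg), Measure.map_map measurable_snd (hf.prodMk hg)⟩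

theorem transportDist_classical_map_map_le (hp : 0 < p) (μ : Measure (X d)) {f g : X d → X d}
    (hf : Measurable f) (hg : Measurable g) :
    transportDist .classical p (μ.map f) (μ.map g) ≤
      eLpNorm (fun x => f x - g x) (ENNReal.ofReal p) μ :=
  transportDist_map_map_le hp hf hg (isCoupling_map_prodMk μ hf hg)

theorem transportDist_classical_self (hp : 0 < p) (μ : Measure (X d)) :
    transportDist .classical p μ μ = 0 := by
  simpa using transportDist_classical_map_map_le hp μ measurable_id measurable_id

theorem transportDist_classical_shift_le [IsProbabilityMeasure μ] (hp : 0 < p) {T : X d → X d}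
    (hT : Measurable T) {δ : ℝ} (hδ : ∀ x, ‖T x‖ ≤ δ) :
    transportDist .classical p μ (shift μ T) ≤ ENNReal.ofReal δ := by
  have hle := transportDist_classical_map_map_le hp μ measurable_id (measurable_id.add hT)
  rw [Measure.map_id] at hle
  refine hle.trans ((eLpNorm_le_of_ae_bound (C := δ) (.of_forall fun x => ?_)).trans_eq (by simp))
  simpa using hδ x

theorem exists_isCoupling_of_transportDist_lt (hp : 0 < p) {c : ℝ≥0∞}
    (h : transportDist .classical p μ ν < c) :
    ∃ π, IsCoupling π μ ν ∧ ∫⁻ z, ‖z.1 - z.2‖ₑ ^ p ∂π < c ^ p := by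
  obtain ⟨π, hlt⟩ := iInf_lt_iff.1 h
  obtain ⟨hπ, hlt⟩ := iInf_lt_iff.1 hlt
  rw [one_div, ENNReal.rpow_inv_lt_iff hp] at hlt
  exact ⟨π, hπ, hlt⟩

theorem ofReal_one_sub_add_ofReal (t : unitInterval) :
    ENNReal.ofReal (1 - t) + ENNReal.ofReal t = 1 := by
  rw [← ENNReal.ofReal_add (sub_nonneg.2 t.2.2) t.2.1, sub_add_cancel, ENNReal.ofReal_one]

theorem isCoupling_mix {m m' : Pp d p} {π π' : Measure (X d × X d)} (hπ : IsCoupling π μ m.1)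
    (hπ' : IsCoupling π' μ m'.1) (t : unitInterval) :
    IsCoupling (ENNReal.ofReal (1 - t) • π + ENNReal.ofReal t • π') μ (m.mix m' t).1 := by
  constructor
  · rw [Measure.map_add _ _ measurable_fst, Measure.map_smul, Measure.map_smul, hπ.1, hπ'.1,
      ← add_smul, ofReal_one_sub_add_ofReal, one_smul]
  · rw [Measure.map_add _ _ measurable_snd, Measure.map_smul, Measure.map_smul, hπ.2, hπ'.2]
    rfl

theorem transportDist_classical_mix_le (hp : 0 < p) {m m' : Pp d p} {δ : ℝ≥0∞}
    (h : transportDist .classical p μ m.1 ≤ δ) (h' : transportDist .classical p μ m'.1 ≤ δ)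
    (t : unitInterval) : transportDist .classical p μ (m.mix m' t).1 ≤ δ := by
  refine le_of_forall_gt_imp_ge_of_dense fun c hc => ?_
  obtain ⟨π, hπ, hcost⟩ := exists_isCoupling_of_transportDist_lt hp (h.trans_lt hc)
  obtain ⟨π', hπ', hcost'⟩ := exists_isCoupling_of_transportDist_lt hp (h'.trans_lt hc)
  refine iInf₂_le_of_le _ (isCoupling_mix hπ hπ' t) ?_
  rw [one_div, ENNReal.rpow_inv_le_iff hp, lintegral_add_measure, lintegral_smul_measure,
    lintegral_smul_measure]
  calc ENNReal.ofReal (1 - t) • ∫⁻ z, ‖z.1 - z.2‖ₑ ^ p ∂π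
        + ENNReal.ofReal t • ∫⁻ z, ‖z.1 - z.2‖ₑ ^ p ∂π'
      ≤ ENNReal.ofReal (1 - t) • c ^ p + ENNReal.ofReal t • c ^ p := by gcongr
    _ = c ^ p := by rw [← add_smul, ofReal_one_sub_add_ofReal, one_smul]

theorem isCausal_of_fst_eq {π : Measure (X d × X d)} [IsFiniteMeasure π] {q : S d → S d}
    (hq : Measurable q) (h : ∀ᵐ z ∂π, z.2.fst = q z.1.fst) : IsCausal π := by
  intro f g hf hg ⟨K, hK⟩ ⟨K', hK'⟩
  have hle : MeasurableSpace.comap (fun z : X d × X d => z.1.fst) inferInstance ≤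
      (inferInstance : MeasurableSpace (X d × X d)) := Measurable.comap_le (by fun_prop)
  set 𝓖 := MeasurableSpace.comap (fun z : X d × X d => z.1.fst) inferInstance
  have hgq : StronglyMeasurable[𝓖] fun z : X d × X d => g (q z.1.fst) :=
    ((hg.comp hq).comp (comap_measurable _)).stronglyMeasurable
  have hfi : Integrable (fun z : X d × X d => f z.1) π :=
    .of_bound (Measurable.aestronglyMeasurable (by fun_prop)) K (.of_forall fun z => hK z.1)
  have hgi : Integrable (fun z : X d × X d => g (q z.1.fst)) π :=
    .of_bound (Measurable.aestronglyMeasurable (by fun_prop)) K' (.of_forall fun z => hK' _)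
  have hg_ae : (fun z : X d × X d => g z.2.fst) =ᵐ[π] fun z => g (q z.1.fst) :=
    h.mono fun z hz => by simp only [hz]
  calc _ =ᵐ[π] π[(fun z => f z.1) * fun z => g (q z.1.fst) | 𝓖] :=
        condExp_congr_ae (EventuallyEq.rfl.mul hg_ae)
    _ =ᵐ[π] π[fun z => f z.1 | 𝓖] * fun z => g (q z.1.fst) :=
        condExp_mul_of_stronglyMeasurable_right hgq
          (hfi.mul_bdd (c := K') hgi.1 (.of_forall fun z => hK' _)) hfi
    _ = π[fun z => f z.1 | 𝓖] * π[fun z => g (q z.1.fst) | 𝓖] := by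
        rw [condExp_of_stronglyMeasurable hle hgq hgi]
    _ =ᵐ[π] _ := EventuallyEq.rfl.mul (condExp_congr_ae hg_ae.symm)

theorem transportDist_adapted_map_map_le [IsFiniteMeasure μ] (hp : 0 < p) {f g : X d → X d}
    (hf : Measurable f) (hg : Measurable g) {q q' : S d → S d} (hq : Measurable q)
    (hq' : Measurable q') (h : ∀ x, (g x).fst = q (f x).fst)
    (h' : ∀ x, (f x).fst = q' (g x).fst) :
    transportDist .adapted p (μ.map f) (μ.map g) ≤
      eLpNorm (fun x => f x - g x) (ENNReal.ofReal p) μ := by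
  refine transportDist_map_map_le hp hf hg ⟨isCoupling_map_prodMk μ hf hg, ?_, ?_⟩
  · refine isCausal_of_fst_eq hq ?_
    rw [ae_map_iff (by fun_prop) (measurableSet_eq_fun (by fun_prop) (by fun_prop))]
    exact .of_forall h
  · rw [Measure.map_map (by fun_prop) (by fun_prop)]
    refine isCausal_of_fst_eq hq' ?_
    rw [ae_map_iff (by fun_prop) (measurableSet_eq_fun (by fun_prop) (by fun_prop))]
    exact .of_forall h'

end Transport

section Moments

variable {d : ℕ} {p : ℝ}

instance (m : Pp d p) : IsProbabilityMeasure m.1 :=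
  m.2.1

theorem Pp.memLp_id (hp : 0 < p) (m : Pp d p) : MemLp id (ENNReal.ofReal p) m.1 := by
  refine ⟨measurable_id.aestronglyMeasurable, ?_⟩
  rw [eLpNorm_ofReal_eq_lintegral_rpow hp]
  exact ENNReal.rpow_lt_top_of_nonneg (by positivity) m.2.2.ne

/-- The law of `X + U` under `m`, as an element of `𝒫_p`. -/
noncomputable def push (hp : 1 ≤ p) (m : Pp d p) (U : BoundedMeasurable (X d) (X d)) : Pp d p :=
  ⟨shift m.1 U, by
    have hp0 : 0 < p := by linarith
    have hU : Measurable fun x => x + U x := measurable_id.add U.2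
    have hLp : MemLp (fun x => x + U x) (ENNReal.ofReal p) m.1 :=
      (m.memLp_id hp0).add <|
        .of_bound U.2.aestronglyMeasurable ‖U‖ (.of_forall U.norm_apply_le)
    refine ⟨Measure.isProbabilityMeasure_map hU.aemeasurable, ?_⟩
    rw [shift, lintegral_map (by fun_prop) hU]
    simpa [ENNReal.toReal_ofReal hp0.le] using lintegral_rpow_enorm_lt_top_of_eLpNorm_lt_top
      (by simpa using hp0) ENNReal.ofReal_ne_top hLp.2⟩

theorem push_zero (hp : 1 ≤ p) (m : Pp d p) : push hp m 0 = m := by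
  apply Subtype.ext
  simp [push, shift]

theorem Pp.integrable_norm_add_rpow (hp : 1 ≤ p) (m : Pp d p) {q : ℝ} (hq : 0 ≤ q) (hqp : q ≤ p)
    {c : ℝ} (hc : 0 ≤ c) : Integrable (fun x => (‖x‖ + c) ^ q) m.1 := by
  have hLp : MemLp (fun x => ‖x‖ + c) (ENNReal.ofReal q) m.1 :=
    ((m.memLp_id (by linarith)).norm.add (memLp_const c)).mono_exponent
      (ENNReal.ofReal_le_ofReal hqp)
  refine hLp.integrable_norm_rpow'.congr (.of_forall fun x => ?_)
  simp only [ENNReal.toReal_ofReal hq]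
  rw [Real.norm_of_nonneg (by positivity)]

theorem Pp.integrable_one_add_norm_rpow (hp : 1 ≤ p) (m : Pp d p) {q : ℝ} (hq : 0 ≤ q)
    (hqp : q ≤ p) : Integrable (fun x => 1 + ‖x‖ ^ q) m.1 := by
  simpa using (integrable_const (1 : ℝ)).add (m.integrable_norm_add_rpow hp hq hqp le_rfl)

theorem Pp.integral_mix {F : Type*} [NormedAddCommGroup F] [NormedSpace ℝ F] (m m' : Pp d p)
    (t : unitInterval) {f : X d → F} (hf : Integrable f m.1) (hf' : Integrable f m'.1) :
    ∫ x, f x ∂(m.mix m' t).1 = (1 - t : ℝ) • ∫ x, f x ∂m.1 + (t : ℝ) • ∫ x, f x ∂m'.1 := by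
  simp only [Pp.mix]
  rw [integral_add_measure (hf.smul_measure ENNReal.ofReal_ne_top)
    (hf'.smul_measure ENNReal.ofReal_ne_top), integral_smul_measure, integral_smul_measure,
    ENNReal.toReal_ofReal (sub_nonneg.2 t.2.2), ENNReal.toReal_ofReal t.2.1]

theorem transportDist_classical_push_le (hp : 1 ≤ p) (m : Pp d p)
    (U : BoundedMeasurable (X d) (X d)) :
    transportDist .classical p m.1 (push hp m U).1 ≤ ENNReal.ofReal ‖U‖ := by
  exact transportDist_classical_shift_le (by linarith) U.measurable U.norm_apply_le

theorem integral_push (hp : 1 ≤ p) (m : Pp d p) (U : BoundedMeasurable (X d) (X d)) {F : Type*}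
    [NormedAddCommGroup F] [NormedSpace ℝ F] {f : X d → F} (hf : Integrable f (push hp m U).1) :
    Integrable (fun x => f (x + U x)) m.1 ∧
      ∫ x, f x ∂(push hp m U).1 = ∫ x, f (x + U x) ∂m.1 := by
  have hshift : AEMeasurable (fun x => x + U x) m.1 := (measurable_id.add U.measurable).aemeasurable
  exact ⟨(integrable_map_measure hf.1 hshift).1 hf, integral_map hshift hf.1⟩

end Moments

section Growth

variable {d : ℕ} {p q : ℝ} {F : Type*} [NormedAddCommGroup F] {f : Pp d p → X d → F}

theorem transportDist_classical_self_lt (hp : 0 < p) (μ : Measure (X d)) {δ : ℝ} (hδ : 0 < δ) :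
    transportDist .classical p μ μ < ENNReal.ofReal δ := by
  simpa [transportDist_classical_self hp] using hδ

theorem JointlyContinuous.continuous (hp : 0 < p) (hf : JointlyContinuous f) (m : Pp d p) :
    Continuous (f m) := by
  refine Metric.continuous_iff.2 fun x ε hε => ?_
  obtain ⟨δ, hδ, H⟩ := hf m x ε hε
  refine ⟨δ, hδ, fun x' hx' => ?_⟩
  rw [dist_eq_norm] at hx' ⊢
  exact H m x' (transportDist_classical_self_lt hp m.1 hδ) hx'

theorem LocallyGrowth.exists_bound (hp : 0 < p) (hf : LocallyGrowth q f) (m : Pp d p) :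
    ∃ K, ∀ x, ‖f m x‖ ≤ K * (1 + ‖x‖ ^ q) := by
  obtain ⟨δ, hδ, K, hK⟩ := hf m
  exact ⟨K, fun x => hK m x (transportDist_classical_self_lt hp m.1 hδ)⟩

theorem JointlyContinuous.integrable (hp : 1 ≤ p) (hf : JointlyContinuous f)
    (hg : LocallyGrowth q f) (hq : 0 ≤ q) (hqp : q ≤ p) (m m' : Pp d p) :
    Integrable (f m) m'.1 := by
  obtain ⟨K, hK⟩ := hg.exists_bound (by linarith) m
  exact ((m'.integrable_one_add_norm_rpow hp hq hqp).const_mul K).mono'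
    (hf.continuous (by linarith) m).aestronglyMeasurable (.of_forall hK)

end Growth

section Operators

variable {α β E F : Type*} [MeasurableSpace α] [MeasurableSpace β]
  [NormedAddCommGroup E] [NormedSpace ℝ E] [MeasurableSpace E] [BorelSpace E]
  [SecondCountableTopology E]
  [NormedAddCommGroup F] [NormedSpace ℝ F]

namespace BoundedMeasurable

theorem integrable_apply {μ : Measure α} {A : α → E →L[ℝ] F} (hA : Integrable A μ)
    (f : BoundedMeasurable α E) : Integrable (fun a => A a (f a)) μ :=
  (hA.norm.mul_const ‖f‖).mono'
    (isBoundedBilinearMap_apply.continuous.comp_aestronglyMeasurable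
      (hA.1.prodMk f.measurable.aestronglyMeasurable))
    (.of_forall fun a => (A a).le_opNorm_of_le (f.norm_apply_le a))

theorem integrable_inner {E : Type*} [NormedAddCommGroup E] [InnerProductSpace ℝ E]
    [MeasurableSpace E] [BorelSpace E] [SecondCountableTopology E] {μ : Measure α} {v : α → E}
    (hv : Integrable v μ) (f : BoundedMeasurable α E) :
    Integrable (fun a => inner ℝ (v a) (f a)) μ :=
  (hv.norm.mul_const ‖f‖).mono' (hv.1.inner f.measurable.aestronglyMeasurable)
    (.of_forall fun a => (norm_inner_le_norm _ _).trans
      (mul_le_mul_of_nonneg_left (f.norm_apply_le a) (norm_nonneg _)))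

/-- The operator `f ↦ ∫ A f dμ` of an integrable field `A` of operators. -/
noncomputable def integralL {μ : Measure α} {A : α → E →L[ℝ] F} (hA : Integrable A μ) :
    BoundedMeasurable α E →L[ℝ] F :=
  LinearMap.mkContinuous
    { toFun f := ∫ a, A a (f a) ∂μ
      map_add' f g := by
        rw [← integral_add (integrable_apply hA f) (integrable_apply hA g)]
        exact integral_congr_ae (.of_forall fun a => map_add (A a) (f a) (g a))
      map_smul' c f := by
        rw [RingHom.id_apply, ← integral_smul]
        exact integral_congr_ae (.of_forall fun a => map_smul (A a) c (f a)) } (∫ a, ‖A a‖ ∂μ)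
    fun f => by
      rw [← integral_mul_const]
      exact norm_integral_le_of_norm_le (hA.norm.mul_const _)
        (.of_forall fun a => (A a).le_opNorm_of_le (f.norm_apply_le a))

/-- Precomposition with a measurable map, as an operator on bounded measurable functions. -/
noncomputable def compL (q : α → β) (hq : Measurable q) :
    BoundedMeasurable β E →L[ℝ] BoundedMeasurable α E :=
  LinearMap.mkContinuous
    { toFun f := ofBound (fun a => f (q a)) (f.measurable.comp hq) ‖f‖ fun a => f.norm_apply_le _
      map_add' _ _ := rfl
      map_smul' _ _ := rfl } 1 fun f => by
    rw [one_mul]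
    exact norm_le (norm_nonneg f) fun a => f.norm_apply_le _

variable [MeasurableSpace F] [BorelSpace F]

theorem measurable_apply {A : α → E →L[ℝ] F} (hA : Measurable A)
    {f : α → E} (hf : Measurable f) : Measurable fun a => A a (f a) :=
  isBoundedBilinearMap_apply.continuous.measurable.comp (hA.prodMk hf)

variable [SecondCountableTopology F]

/-- Pointwise application of a bounded measurable field of operators. -/
noncomputable def applyL [FiniteDimensional ℝ E] (A : BoundedMeasurable α (E →L[ℝ] F)) :
    BoundedMeasurable α E →L[ℝ] BoundedMeasurable α F :=
  LinearMap.mkContinuous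
    { toFun f := ofBound (fun a => A a (f a)) (measurable_apply A.measurable f.measurable)
        (‖A‖ * ‖f‖) fun a => (A a).le_of_opNorm_le_of_le (A.norm_apply_le a) (f.norm_apply_le a)
      map_add' f g := Subtype.ext <| lp.ext <| funext fun a => map_add (A a) (f a) (g a)
      map_smul' c f := Subtype.ext <| lp.ext <| funext fun a => map_smul (A a) c (f a) } ‖A‖
    fun f => norm_le (mul_nonneg (norm_nonneg A) (norm_nonneg f)) fun a =>
      (A a).le_of_opNorm_le_of_le (A.norm_apply_le a) (f.norm_apply_le a)

end BoundedMeasurable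

end Operators

section Mixtures

variable {d k : ℕ} {p : ℝ}

theorem Pp.mix_zero (m m' : Pp d p) : m.mix m' 0 = m := by
  apply Subtype.ext
  simp [Pp.mix]

theorem Pp.mix_symm (m m' : Pp d p) (t : unitInterval) :
    m.mix m' (unitInterval.symm t) = m'.mix m t := by
  apply Subtype.ext
  simp [Pp.mix, add_comm]

theorem Pp.mix_mix (m m' : Pp d p) {s t u : unitInterval} (h : (u : ℝ) = t + s * (1 - t)) :
    (m.mix m' t).mix m' s = m.mix m' u := by
  apply Subtype.ext
  have hs : 0 ≤ 1 - (s : ℝ) := sub_nonneg.2 s.2.2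
  simp only [Pp.mix, smul_add, smul_smul, add_assoc, ← add_smul]
  rw [← ENNReal.ofReal_mul hs, ← ENNReal.ofReal_mul hs,
    ← ENNReal.ofReal_add (mul_nonneg hs t.2.1) s.2.1, h]
  congr 3 <;> ring_nf

/-- The segment `s ↦ m + s (m' - m)` as a path with a real parameter, constant outside `[0, 1]`. -/
noncomputable def mixPath (m m' : Pp d p) (s : ℝ) : Pp d p :=
  m.mix m' (Set.projIcc 0 1 zero_le_one s)

theorem mixPath_zero (m m' : Pp d p) : mixPath m m' 0 = m := by
  have : Set.projIcc (0 : ℝ) 1 zero_le_one 0 = 0 := Set.projIcc_left _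
  rw [mixPath, this, Pp.mix_zero]

theorem mixPath_one_sub (m m' : Pp d p) (s : ℝ) : mixPath m m' (1 - s) = mixPath m' m s := by
  rw [mixPath, mixPath, ← Pp.mix_symm, unitInterval.symm_projIcc, sub_sub_cancel]

theorem mixPath_one (m m' : Pp d p) : mixPath m m' 1 = m' := by
  simpa [mixPath_zero] using mixPath_one_sub m m' 0

theorem mixPath_mixPath (m m' : Pp d p) {t u : ℝ} (ht : t ∈ Set.Ico 0 1) (hu : t ≤ u) :
    mixPath (mixPath m m' t) m' ((u - t) / (1 - t)) = mixPath m m' u := by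
  have ht1 : 0 < 1 - t := sub_pos.2 ht.2
  refine Pp.mix_mix m m' ?_
  simp only [Set.coe_projIcc, min_eq_right ht.2.le, max_eq_right ht.1]
  rcases le_total u 1 with hu1 | hu1
  · rw [min_eq_right hu1, max_eq_right (ht.1.trans hu),
      min_eq_right ((div_le_one ht1).2 (by linarith)),
      max_eq_right (div_nonneg (sub_nonneg.2 hu) ht1.le), div_mul_cancel₀ _ ht1.ne']
    ring
  · rw [min_eq_left hu1, min_eq_left ((one_le_div ht1).2 (by linarith))]
    norm_num

variable {φ : Pp d p → EuclideanSpace ℝ (Fin k)} {D : Pp d p → X d → EuclideanSpace ℝ (Fin k)}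

theorem IsLinearFunctionalDeriv.integrable (hp : 1 ≤ p) (h : IsLinearFunctionalDeriv φ D)
    (m m' : Pp d p) : Integrable (D m) m'.1 :=
  h.continuous.integrable hp h.growth (by linarith) le_rfl m m'

theorem IsLinearFunctionalDeriv.hasDerivWithinAt_mixPath_zero (h : IsLinearFunctionalDeriv φ D)
    (m m' : Pp d p) :
    HasDerivWithinAt (fun s => φ (mixPath m m' s)) (∫ x, D m x ∂m'.1 - ∫ x, D m x ∂m.1)
      (Set.Ici 0) 0 := by
  have hproj : Tendsto (Set.projIcc (0 : ℝ) 1 zero_le_one) (𝓝[>] 0) (𝓝[>] 0) := by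
    refine tendsto_nhdsWithin_iff.2
      ⟨tendsto_nhdsWithin_of_tendsto_nhds (continuous_projIcc.tendsto' _ _ (Set.projIcc_left _)),
        ?_⟩
    filter_upwards [self_mem_nhdsWithin] with s hs
    exact pos_of_ne_zero fun h0 => (Set.mem_Ioi.1 hs).not_ge (projIcc_eq_zero.1 h0)
  rw [← hasDerivWithinAt_Ioi_iff_Ici, hasDerivWithinAt_iff_tendsto_slope' (by simp)]
  refine ((h.deriv m m').comp hproj).congr' ?_
  filter_upwards [Ioo_mem_nhdsGT (zero_lt_one' ℝ)] with s hs
  simp only [Function.comp_apply, slope, vsub_eq_sub, sub_zero, mixPath_zero]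
  rw [mixPath, Set.projIcc_of_mem _ ⟨hs.1.le, hs.2.le⟩]

theorem IsLinearFunctionalDeriv.hasDerivWithinAt_mixPath (hp : 1 ≤ p)
    (h : IsLinearFunctionalDeriv φ D) (m m' : Pp d p) {t : ℝ} (ht : t ∈ Set.Ico 0 1) :
    HasDerivWithinAt (fun s => φ (mixPath m m' s))
      (∫ x, D (mixPath m m' t) x ∂m'.1 - ∫ x, D (mixPath m m' t) x ∂m.1) (Set.Ici t) t := by
  have ht1 : 0 < 1 - t := sub_pos.2 ht.2
  have hparam : HasDerivWithinAt (fun u => (u - t) / (1 - t)) (1 - t)⁻¹ (Set.Ici t) t := by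
    simpa using (((hasDerivAt_id t).sub_const t).div_const (1 - t)).hasDerivWithinAt
  have hmaps : Set.MapsTo (fun u => (u - t) / (1 - t)) (Set.Ici t) (Set.Ici 0) := fun u hu =>
    div_nonneg (sub_nonneg.2 hu) ht1.le
  have hzero := h.hasDerivWithinAt_mixPath_zero (mixPath m m' t) m'
  have hchain := HasDerivWithinAt.scomp_of_eq t hzero hparam hmaps (by simp)
  refine (hchain.congr (fun u hu => ?_) ?_).congr_deriv ?_
  · simp only [Function.comp_apply, mixPath_mixPath m m' ht hu]
  · simp only [Function.comp_apply, mixPath_mixPath m m' ht le_rfl]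
  · have hint := m.integral_mix m' (Set.projIcc 0 1 zero_le_one t)
      (h.integrable hp (mixPath m m' t) m) (h.integrable hp (mixPath m m' t) m')
    rw [Set.projIcc_of_mem _ ⟨ht.1, ht.2.le⟩] at hint
    rw [mixPath, Set.projIcc_of_mem _ ⟨ht.1, ht.2.le⟩] at hint ⊢
    rw [hint, inv_smul_eq_iff₀ ht1.ne']
    module

theorem IsLinearFunctionalDeriv.continuousOn_mixPath (hp : 1 ≤ p)
    (h : IsLinearFunctionalDeriv φ D) (m m' : Pp d p) :
    ContinuousOn (fun s => φ (mixPath m m' s)) (Set.Icc 0 1) := by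
  have hright : ∀ (m m' : Pp d p), ∀ t ∈ Set.Icc (0 : ℝ) 1,
      ContinuousWithinAt (fun s => φ (mixPath m m' s)) (Set.Icc t 1) t := by
    intro m m' t ht
    rcases ht.2.eq_or_lt with rfl | ht1
    · simp
    · exact (h.hasDerivWithinAt_mixPath hp m m' ⟨ht.1, ht1⟩).continuousWithinAt.mono
        Set.Icc_subset_Ici_self
  intro t ht
  have hleft : ContinuousWithinAt (fun s => φ (mixPath m m' s)) (Set.Icc 0 t) t := by
    have hrev := (hright m' m (1 - t) (by constructor <;> linarith [ht.1, ht.2])).comp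
      (f := fun s => 1 - s) (s := Set.Icc 0 t) (by fun_prop)
      fun s hs => by constructor <;> linarith [hs.1, hs.2]
    simpa only [Function.comp_def, mixPath_one_sub] using hrev
  rw [← Set.Icc_union_Icc_eq_Icc ht.1 ht.2]
  exact hleft.union (hright m m' t ht)

theorem IsLinearFunctionalDeriv.norm_sub_sub_le (hp : 1 ≤ p) (h : IsLinearFunctionalDeriv φ D)
    (m m' : Pp d p) (c : EuclideanSpace ℝ (Fin k)) {C : ℝ}
    (hC : ∀ t : unitInterval,
      ‖∫ x, D (m.mix m' t) x ∂m'.1 - ∫ x, D (m.mix m' t) x ∂m.1 - c‖ ≤ C) :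
    ‖φ m' - φ m - c‖ ≤ C := by
  have hmean := norm_image_sub_le_of_norm_deriv_right_le_segment
    (f := fun s => φ (mixPath m m' s) - s • c)
    (f' := fun t => ∫ x, D (mixPath m m' t) x ∂m'.1 - ∫ x, D (mixPath m m' t) x ∂m.1 - c)
    ((h.continuousOn_mixPath hp m m').sub (by fun_prop))
    (fun t ht => (h.hasDerivWithinAt_mixPath hp m m' ht).sub
      (by simpa using ((hasDerivAt_id t).smul_const c).hasDerivWithinAt))
    (fun t _ => hC _) 1 (by simp)
  simpa [mixPath_zero, mixPath_one, sub_right_comm] using hmean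

end Mixtures

section Modulus

variable {d : ℕ} {p q : ℝ} {F : Type*} [NormedAddCommGroup F] {f : Pp d p → X d → F}

theorem JointlyContinuous.exists_uniform_on_isCompact (hp : 0 < p) (hf : JointlyContinuous f)
    (μ : Pp d p) {s : Set (X d)} (hs : IsCompact s) {ε : ℝ} (hε : 0 < ε) :
    ∃ δ > (0 : ℝ), ∀ m : Pp d p, transportDist .classical p μ.1 m.1 < ENNReal.ofReal δ →
      ∀ x ∈ s, ∀ x', ‖x' - x‖ ≤ δ → ‖f m x' - f μ x‖ ≤ ε := by
  refine hs.induction_on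
    (p := fun s => ∃ δ > (0 : ℝ), ∀ m : Pp d p,
      transportDist .classical p μ.1 m.1 < ENNReal.ofReal δ →
        ∀ x ∈ s, ∀ x', ‖x' - x‖ ≤ δ → ‖f m x' - f μ x‖ ≤ ε) ?_ ?_ ?_ ?_
  · exact ⟨1, one_pos, by simp⟩
  · rintro s t hst ⟨δ, hδ, H⟩
    exact ⟨δ, hδ, fun m hm x hx => H m hm x (hst hx)⟩
  · rintro s t ⟨δ, hδ, H⟩ ⟨δ', hδ', H'⟩
    refine ⟨min δ δ', lt_min hδ hδ', fun m hm x hx x' hx' => ?_⟩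
    rw [ENNReal.ofReal_min, lt_min_iff] at hm
    rw [le_min_iff] at hx'
    exact hx.elim (fun hx => H m hm.1 x hx x' hx'.1) fun hx => H' m hm.2 x hx x' hx'.2
  · intro x _
    obtain ⟨δ, hδ, H⟩ := hf μ x (ε / 2) (half_pos hε)
    refine ⟨Metric.ball x (δ / 2), mem_nhdsWithin_of_mem_nhds
      (Metric.ball_mem_nhds _ (half_pos hδ)), δ / 3, by positivity, fun m hm y hy x' hx' => ?_⟩
    rw [mem_ball_iff_norm] at hy
    have hx'x : ‖x' - x‖ < δ := by linarith [norm_sub_le_norm_sub_add_norm_sub x' y x]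
    have hnear := H m x' (hm.trans_le (ENNReal.ofReal_le_ofReal (by linarith))) hx'x
    have hcenter := H μ y (transportDist_classical_self_lt hp μ.1 hδ) (by linarith)
    rw [norm_sub_rev] at hcenter
    linarith [norm_sub_le_norm_sub_add_norm_sub (f m x') (f μ x) (f μ y)]

theorem LocallyGrowth.exists_integrable_dominator (hp : 1 ≤ p) (hg : LocallyGrowth q f)
    (hq : 0 ≤ q) (hqp : q ≤ p) (μ : Pp d p) :
    ∃ δ > (0 : ℝ), ∃ b : X d → ℝ, Integrable b μ.1 ∧ 0 ≤ b ∧ ∀ m : Pp d p,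
      transportDist .classical p μ.1 m.1 < ENNReal.ofReal δ →
        ∀ x x', ‖x' - x‖ ≤ 1 → ‖f m x' - f μ x‖ ≤ b x := by
  obtain ⟨δ, hδ, K, hK⟩ := hg μ
  refine ⟨δ, hδ, fun x => 2 * |K| * (1 + (‖x‖ + 1) ^ q), ?_, fun x => by positivity,
    fun m hm x x' hx => ?_⟩
  · exact ((integrable_const 1).add
      (μ.integrable_norm_add_rpow hp hq hqp zero_le_one)).const_mul (2 * |K|)
  have hmono : ∀ y : X d, ‖y‖ ≤ ‖x‖ + 1 → K * (1 + ‖y‖ ^ q) ≤ |K| * (1 + (‖x‖ + 1) ^ q) := by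
    intro y hy
    gcongr
    exact le_abs_self K
  calc ‖f m x' - f μ x‖ ≤ ‖f m x'‖ + ‖f μ x‖ := norm_sub_le _ _
    _ ≤ |K| * (1 + (‖x‖ + 1) ^ q) + |K| * (1 + (‖x‖ + 1) ^ q) := by
        gcongr
        · exact (hK m x' hm).trans (hmono x' (by linarith [norm_sub_norm_le x' x]))
        · exact (hK μ x (transportDist_classical_self_lt (by linarith) μ.1 hδ)).trans
            (hmono x (by linarith))
    _ = 2 * |K| * (1 + (‖x‖ + 1) ^ q) := by ring

theorem exists_setIntegral_norm_gt_lt {E : Type*} [NormedAddCommGroup E] [MeasurableSpace E]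
    [OpensMeasurableSpace E] {m : Measure E} {b : E → ℝ} (hb : Integrable b m) {ε : ℝ}
    (hε : 0 < ε) : ∃ R : ℕ, ∫ x in {x | (R : ℝ) < ‖x‖}, b x ∂m < ε := by
  have hempty : ⋂ n : ℕ, {x : E | (n : ℝ) < ‖x‖} = ∅ := by
    refine Set.eq_empty_of_forall_notMem fun x hx => ?_
    obtain ⟨n, hn⟩ := exists_nat_ge ‖x‖
    exact hn.not_gt (Set.mem_iInter.1 hx n)
  have htail := tendsto_setIntegral_of_antitone (μ := m) (f := b)
    (s := fun n : ℕ => {x : E | (n : ℝ) < ‖x‖})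
    (fun n => measurableSet_lt measurable_const measurable_norm)
    (fun n n' hn x (hx : (n' : ℝ) < ‖x‖) => lt_of_le_of_lt (Nat.cast_le.2 hn) hx)
    ⟨0, hb.integrableOn⟩
  rw [hempty, setIntegral_empty] at htail
  exact (htail.eventually (gt_mem_nhds hε)).exists

theorem exists_integrable_modulus (hp : 1 ≤ p) (hf : JointlyContinuous f)
    (hg : LocallyGrowth q f) (hq : 0 ≤ q) (hqp : q ≤ p) (μ : Pp d p) {ε : ℝ} (hε : 0 < ε) :
    ∃ δ > (0 : ℝ), ∃ a : X d → ℝ, Integrable a μ.1 ∧ ∫ x, a x ∂μ.1 ≤ ε ∧ 0 ≤ a ∧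
      ∀ m : Pp d p, transportDist .classical p μ.1 m.1 < ENNReal.ofReal δ →
        ∀ x x', ‖x' - x‖ ≤ δ → ‖f m x' - f μ x‖ ≤ a x := by
  obtain ⟨δ₁, hδ₁, b, hbi, hb0, hb⟩ := hg.exists_integrable_dominator hp hq hqp μ
  obtain ⟨R, hR⟩ := exists_setIntegral_norm_gt_lt hbi (half_pos hε)
  obtain ⟨δ₂, hδ₂, hcpt⟩ := hf.exists_uniform_on_isCompact (by linarith) μ
    (isCompact_closedBall (0 : X d) R) (half_pos hε)
  set far : Set (X d) := {x | (R : ℝ) < ‖x‖}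
  have hfar : MeasurableSet far := measurableSet_lt measurable_const measurable_norm
  have hfar0 : 0 ≤ far.indicator b := Set.indicator_nonneg fun x _ => hb0 x
  refine ⟨min (min δ₁ δ₂) 1, by positivity, fun x => ε / 2 + far.indicator b x,
    (integrable_const _).add (hbi.indicator hfar), ?_, ?_, ?_⟩
  · rw [integral_add (integrable_const _) (hbi.indicator hfar), integral_indicator hfar]
    simp only [integral_const, probReal_univ, one_smul]
    linarith
  · exact fun x => add_nonneg (half_pos hε).le (hfar0 x)
  · intro m hm x x' hx
    simp only [ENNReal.ofReal_min, lt_min_iff] at hm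
    simp only [le_min_iff] at hx
    by_cases hxR : x ∈ far
    · simp only [Set.indicator_of_mem hxR]
      linarith [hb m hm.1.1 x x' hx.2]
    · simp only [Set.indicator_of_notMem hxR, add_zero]
      exact hcpt m hm.1.2 x (by simpa [far] using hxR) x' hx.1.2

end Modulus

section StrictDifferentiability

variable {d k : ℕ} {p : ℝ} {φ : Pp d p → EuclideanSpace ℝ (Fin k)}
  {D : Pp d p → X d → EuclideanSpace ℝ (Fin k)}

theorem aestronglyMeasurable_fderiv_apply {E F : Type*} [NormedAddCommGroup E] [NormedSpace ℝ E]
    [MeasurableSpace E] [BorelSpace E] [SecondCountableTopology E] [NormedAddCommGroup F]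
    [NormedSpace ℝ F] {u : E → F} (hu : ContDiff ℝ 1 u) {m : Measure E} {U : E → E}
    (hU : Measurable U) : AEStronglyMeasurable (fun x => fderiv ℝ u x (U x)) m :=
  isBoundedBilinearMap_apply.continuous.comp_aestronglyMeasurable
    ((hu.continuous_fderiv one_ne_zero).aestronglyMeasurable.prodMk hU.aestronglyMeasurable)

theorem RegularFunctional.integrable_fderiv (hp : 1 ≤ p) (h : RegularFunctional φ D)
    (m m' : Pp d p) : Integrable (fderiv ℝ (D m)) m'.1 :=
  h.grad_continuous.integrable hp h.grad_growth (by linarith) (by linarith) m m'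

theorem RegularFunctional.integrable_fderiv_apply (hp : 1 ≤ p) (h : RegularFunctional φ D)
    (m m' : Pp d p) (U : BoundedMeasurable (X d) (X d)) :
    Integrable (fun x => fderiv ℝ (D m) x (U x)) m'.1 :=
  ((h.integrable_fderiv hp m m').norm.mul_const ‖U‖).mono'
    (aestronglyMeasurable_fderiv_apply (h.contDiff m) U.measurable)
    (.of_forall fun x => ContinuousLinearMap.le_opNorm_of_le _ (U.norm_apply_le x))

theorem RegularFunctional.memLp_fderiv (hp : 1 < p) (h : RegularFunctional φ D) (m : Pp d p) :
    MemLp (fderiv ℝ (D m)) (ENNReal.ofReal (conj p)) m.1 := by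
  obtain ⟨K, hK⟩ := h.grad_growth.exists_bound (by linarith) m
  have hpow := (m.memLp_id (by linarith)).norm_rpow_div (ENNReal.ofReal (p - 1))
  rw [ENNReal.toReal_ofReal (by linarith), ← ENNReal.ofReal_div_of_pos (by linarith)] at hpow
  have hdom : MemLp (fun x : X d => K * (1 + ‖x‖ ^ (p - 1))) (ENNReal.ofReal (conj p)) m.1 :=
    ((memLp_const (1 : ℝ)).add hpow).const_mul K
  exact hdom.mono ((h.contDiff m).continuous_fderiv one_ne_zero).aestronglyMeasurable
    (.of_forall fun x => (hK x).trans (le_abs_self _))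

theorem RegularFunctional.exists_strict_deriv (hp : 1 ≤ p) (h : RegularFunctional φ D)
    (μ : Pp d p) {ε : ℝ} (hε : 0 < ε) :
    ∃ δ > (0 : ℝ), ∀ U U' : BoundedMeasurable (X d) (X d), ‖U‖ ≤ δ → ‖U'‖ ≤ δ →
      ‖φ (push hp μ U') - φ (push hp μ U)
        - ∫ x, fderiv ℝ (D μ) x ((U' - U) x) ∂μ.1‖
          ≤ ε * ‖U' - U‖ := by
  obtain ⟨δ, hδ, a, hai, haε, ha0, ha⟩ := exists_integrable_modulus hp h.grad_continuous
    h.grad_growth (by linarith) (by linarith) μ hε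
  refine ⟨δ / 2, half_pos hδ, fun U U' hU hU' => ?_⟩
  have hp0 : 0 < p := by linarith
  refine h.isDeriv.norm_sub_sub_le hp (push hp μ U) (push hp μ U') _ fun t => ?_
  set m := (push hp μ U).mix (push hp μ U') t
  have hm : transportDist .classical p μ.1 m.1 < ENNReal.ofReal δ :=
    (transportDist_classical_mix_le hp0
      ((transportDist_classical_push_le hp μ U).trans (ENNReal.ofReal_le_ofReal hU))
      ((transportDist_classical_push_le hp μ U').trans (ENNReal.ofReal_le_ofReal hU')) t).trans_lt
      (ENNReal.ofReal_lt_ofReal_iff hδ |>.2 (half_lt_self hδ))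
  have hball : ∀ (V : BoundedMeasurable (X d) (X d)), ‖V‖ ≤ δ / 2 → ∀ x,
      x + V x ∈ Metric.closedBall x δ := fun V hV x => by
    rw [mem_closedBall_iff_norm, add_sub_cancel_left]
    linarith [V.norm_apply_le x]
  have hpointwise : ∀ x, ‖D m (x + U' x) - D m (x + U x)
      - fderiv ℝ (D μ) x ((U' - U) x)‖ ≤ a x * ‖U' - U‖ := by
    intro x
    have hmean := (convex_closedBall x δ).norm_image_sub_le_of_norm_fderiv_le'
      (f := D m) (φ := fderiv ℝ (D μ) x) (C := a x)
      (fun y _ => (h.contDiff m).differentiable one_ne_zero y)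
      (fun y hy => ha m hm x y (mem_closedBall_iff_norm.1 hy)) (hball U hU x) (hball U' hU' x)
    rw [add_sub_add_left_eq_sub] at hmean
    exact hmean.trans (mul_le_mul_of_nonneg_left ((U' - U).norm_apply_le x) (ha0 x))
  obtain ⟨hi, hint⟩ := integral_push hp μ U (h.isDeriv.integrable hp m (push hp μ U))
  obtain ⟨hi', hint'⟩ := integral_push hp μ U' (h.isDeriv.integrable hp m (push hp μ U'))
  have hsub := integral_sub (hi'.sub hi) (h.integrable_fderiv_apply hp μ μ (U' - U))
  simp only [Pi.sub_apply] at hsub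
  rw [hint, hint', ← integral_sub hi' hi, ← hsub]
  calc _ ≤ ∫ x, a x * ‖U' - U‖ ∂μ.1 :=
        norm_integral_le_of_norm_le (hai.mul_const _) (.of_forall hpointwise)
    _ = (∫ x, a x ∂μ.1) * ‖U' - U‖ := integral_mul_const _ _
    _ ≤ ε * ‖U' - U‖ := by gcongr

end StrictDifferentiability

section Newton

theorem exists_zero_of_approx_id {Z : Type*} [NormedAddCommGroup Z] [NormedSpace ℝ Z]
    [CompleteSpace Z] {F : Z → Z} {z₀ : Z} {ρ : ℝ} (hρ : 0 ≤ ρ)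
    (h : ∀ z ∈ Metric.closedBall z₀ ρ, ∀ z' ∈ Metric.closedBall z₀ ρ,
      ‖F z - F z' - (z - z')‖ ≤ 1 / 2 * ‖z - z'‖) (h0 : ‖F z₀‖ ≤ ρ / 2) :
    ∃ z ∈ Metric.closedBall z₀ ρ, F z = 0 := by
  have hF : ApproximatesLinearOn F (ContinuousLinearMap.id ℝ Z) (Metric.closedBall z₀ ρ)
      (1 / 2 : ℝ≥0) := fun z hz z' hz' => by simpa using h z hz z' hz'
  let inv : (ContinuousLinearMap.id ℝ Z).NonlinearRightInverse :=
    { toFun := id, nnnorm := 1, bound' := fun y => by simp, right_inv' := fun y => by simp }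
  refine hF.surjOn_closedBall_of_nonlinearRightInverse inv hρ subset_rfl (a := 0) ?_
  rw [Metric.mem_closedBall, dist_zero_left]
  norm_num [inv]
  linarith

theorem limsup_div_le_of_approx_id {Z : Type*} [NormedAddCommGroup Z] [NormedSpace ℝ Z]
    [CompleteSpace Z] {F : ℝ → Z → Z} {z₀ : Z} {D : ℝ → ℝ≥0∞} {N : ℝ≥0∞} {K : ℝ} (hK : 0 ≤ K)
    (hF : ∀ ε > (0 : ℝ), ∀ᶠ r in 𝓝[>] (0 : ℝ), ∀ z ∈ Metric.closedBall z₀ 1,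
      ∀ z' ∈ Metric.closedBall z₀ 1, ‖F r z - F r z' - (z - z')‖ ≤ ε * ‖z - z'‖)
    (hF0 : Tendsto (fun r => F r z₀) (𝓝[>] (0 : ℝ)) (𝓝 0))
    (hD : ∀ᶠ r in 𝓝[>] (0 : ℝ), ∀ z ∈ Metric.closedBall z₀ 1, F r z = 0 →
      D r ≤ ENNReal.ofReal r * (N + ENNReal.ofReal (K * ‖z - z₀‖))) :
    limsup (fun r => D r / ENNReal.ofReal r) (𝓝[>] (0 : ℝ)) ≤ N := by
  refine ENNReal.le_of_forall_pos_le_add fun ε hε _ => ?_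
  obtain ⟨ρ, hρ0, hρ1, hKρ⟩ : ∃ ρ > 0, ρ ≤ 1 ∧ K * ρ ≤ ε := by
    refine ⟨min 1 (ε / (K + 1)), by positivity, min_le_left _ _, ?_⟩
    calc K * min 1 (ε / (K + 1)) ≤ (K + 1) * (ε / (K + 1)) := by
          gcongr
          · linarith
          · exact min_le_right _ _
      _ = ε := by field_simp
  have hsub : Metric.closedBall z₀ ρ ⊆ Metric.closedBall z₀ 1 :=
    Metric.closedBall_subset_closedBall hρ1
  have hsmall : ∀ᶠ r in 𝓝[>] (0 : ℝ), ‖F r z₀‖ < ρ / 2 := by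
    have hnorm := hF0.norm
    rw [norm_zero] at hnorm
    exact hnorm.eventually (gt_mem_nhds (half_pos hρ0))
  refine limsup_le_of_le (by isBoundedDefault) ?_
  filter_upwards [hF (1 / 2) (by norm_num), hsmall, hD, self_mem_nhdsWithin] with r hF hsmall hD hr
  obtain ⟨z, hz, hz0⟩ := exists_zero_of_approx_id hρ0.le
    (fun z hz z' hz' => hF z (hsub hz) z' (hsub hz')) hsmall.le
  have hr' : ENNReal.ofReal r ≠ 0 := by simpa using hr
  rw [ENNReal.div_le_iff hr' ENNReal.ofReal_ne_top, mul_comm]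
  refine (hD z (hsub hz) hz0).trans ?_
  gcongr
  rw [← ENNReal.ofReal_coe_nnreal]
  refine ENNReal.ofReal_le_ofReal (le_trans ?_ hKρ)
  gcongr
  exact mem_closedBall_iff_norm.1 hz

end Newton

section Scaling

variable {d k : ℕ} {p : ℝ} {φ : Pp d p → EuclideanSpace ℝ (Fin k)}
  {D : Pp d p → X d → EuclideanSpace ℝ (Fin k)}

theorem RegularFunctional.eventually_strict_deriv (hp : 1 ≤ p) (h : RegularFunctional φ D)
    (μ : Pp d p) (R : ℝ) {ε : ℝ} (hε : 0 < ε) :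
    ∀ᶠ r in 𝓝[>] (0 : ℝ), ∀ U U' : BoundedMeasurable (X d) (X d), ‖U‖ ≤ R → ‖U'‖ ≤ R →
      ‖r⁻¹ • φ (push hp μ (r • U')) - r⁻¹ • φ (push hp μ (r • U))
        - ∫ x, fderiv ℝ (D μ) x ((U' - U) x) ∂μ.1‖ ≤ ε * ‖U' - U‖ := by
  obtain ⟨δ, hδ, hstrict⟩ := h.exists_strict_deriv hp μ hε
  have hsmall : ∀ᶠ r in 𝓝[>] (0 : ℝ), r < δ / (|R| + 1) :=
    nhdsWithin_le_nhds (gt_mem_nhds (by positivity))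
  filter_upwards [hsmall, self_mem_nhdsWithin] with r hrδ (hr : 0 < r) U U' hU hU'
  have hscale : ∀ W : BoundedMeasurable (X d) (X d), ‖W‖ ≤ R → ‖r • W‖ ≤ δ := fun W hW => by
    rw [norm_smul, Real.norm_of_nonneg hr.le]
    calc r * ‖W‖ ≤ δ / (|R| + 1) * (|R| + 1) := by
          gcongr
          exact hW.trans ((le_abs_self R).trans (by linarith))
      _ = δ := by field_simp
  have hbound := hstrict (r • U) (r • U') (hscale U hU) (hscale U' hU')
  have hint : ∫ x, fderiv ℝ (D μ) x ((r • U' - r • U) x) ∂μ.1 =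
      r • ∫ x, fderiv ℝ (D μ) x ((U' - U) x) ∂μ.1 := by
    rw [← integral_smul, ← smul_sub]
    exact integral_congr_ae (.of_forall fun x => map_smul _ r _)
  rw [hint, ← smul_sub, norm_smul, Real.norm_of_nonneg hr.le, mul_left_comm] at hbound
  rw [← inv_smul_smul₀ hr.ne' (∫ x, fderiv ℝ (D μ) x ((U' - U) x) ∂μ.1), ← smul_sub, ← smul_sub,
    norm_smul, norm_inv, Real.norm_of_nonneg hr.le, inv_mul_le_iff₀ hr]
  exact hbound

theorem RegularFunctional.tendsto_push (hp : 1 ≤ p) (h : RegularFunctional φ D)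
    (μ : Pp d p) (hμ : φ μ = 0) (U : BoundedMeasurable (X d) (X d)) :
    Tendsto (fun r : ℝ => r⁻¹ • φ (push hp μ (r • U))) (𝓝[>] 0)
      (𝓝 (∫ x, fderiv ℝ (D μ) x (U x) ∂μ.1)) := by
  rw [tendsto_iff_norm_sub_tendsto_zero, Metric.tendsto_nhds]
  intro ε hε
  filter_upwards [h.eventually_strict_deriv hp μ ‖U‖ (ε := ε / (‖U‖ + 1)) (by positivity)]
    with r hr
  have hbound := hr 0 U (norm_zero.trans_le (norm_nonneg U)) le_rfl
  simp only [smul_zero, push_zero, hμ, sub_zero] at hbound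
  rw [Real.dist_eq, sub_zero, abs_of_nonneg (norm_nonneg _)]
  refine hbound.trans_lt ?_
  rw [div_mul_eq_mul_div, div_lt_iff₀ (by positivity)]
  linarith

end Scaling

section Correction

variable {d k : ℕ} {p : ℝ} {φ : Pp d p → EuclideanSpace ℝ (Fin k)}
  {D : Pp d p → X d → EuclideanSpace ℝ (Fin k)} {Z : Type*} [NormedAddCommGroup Z]
  [NormedSpace ℝ Z] {T : EuclideanSpace ℝ (Fin k) × Z →L[ℝ] BoundedMeasurable (X d) (X d)}

theorem norm_add_map_le_of_mem_closedBall {E V : Type*} [NormedAddCommGroup E] [NormedSpace ℝ E]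
    [NormedAddCommGroup V] [NormedSpace ℝ V] (T : E →L[ℝ] V) (v : V) {z z₀ : E}
    (hz : z ∈ Metric.closedBall z₀ 1) : ‖v + T z‖ ≤ ‖v‖ + ‖T‖ * (‖z₀‖ + 1) := by
  refine (norm_add_le _ _).trans (add_le_add_right (T.le_opNorm_of_le ?_) _)
  linarith [norm_le_norm_add_norm_sub' z z₀, mem_closedBall_iff_norm.1 hz]

theorem RegularFunctional.eventually_approx_fst (hp : 1 ≤ p) (h : RegularFunctional φ D)
    (μ : Pp d p) (hT : ∀ z, ∫ x, fderiv ℝ (D μ) x (T z x) ∂μ.1 = z.1)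
    (Θ : BoundedMeasurable (X d) (X d)) (z₀ : EuclideanSpace ℝ (Fin k) × Z) {ε : ℝ} (hε : 0 < ε) :
    ∀ᶠ r in 𝓝[>] (0 : ℝ), ∀ z ∈ Metric.closedBall z₀ 1, ∀ z' ∈ Metric.closedBall z₀ 1,
      ‖r⁻¹ • φ (push hp μ (r • (Θ + T z)))
        - r⁻¹ • φ (push hp μ (r • (Θ + T z'))) - (z.1 - z'.1)‖ ≤ ε * ‖z - z'‖ := by
  filter_upwards [h.eventually_strict_deriv hp μ (‖Θ‖ + ‖T‖ * (‖z₀‖ + 1))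
    (ε := ε / (‖T‖ + 1)) (by positivity)] with r hr z hz z' hz'
  have hbound := hr _ _ (norm_add_map_le_of_mem_closedBall T Θ hz')
    (norm_add_map_le_of_mem_closedBall T Θ hz)
  rw [add_sub_add_left_eq_sub, ← map_sub, hT] at hbound
  refine hbound.trans ?_
  calc ε / (‖T‖ + 1) * ‖T (z - z')‖ ≤ ε / (‖T‖ + 1) * ((‖T‖ + 1) * ‖z - z'‖) := by
        gcongr
        exact T.le_of_opNorm_le (by linarith) _
    _ = ε * ‖z - z'‖ := by field_simp

theorem RegularFunctional.tendsto_push_correction (hp : 1 ≤ p) (h : RegularFunctional φ D)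
    (μ : Pp d p) (hμ : φ μ = 0) (hT : ∀ z, ∫ x, fderiv ℝ (D μ) x (T z x) ∂μ.1 = z.1)
    (Θ : BoundedMeasurable (X d) (X d)) {z₀ : EuclideanSpace ℝ (Fin k) × Z}
    (hz₀ : z₀.1 = -∫ x, fderiv ℝ (D μ) x (Θ x) ∂μ.1) :
    Tendsto (fun r : ℝ => r⁻¹ • φ (push hp μ (r • (Θ + T z₀)))) (𝓝[>] 0) (𝓝 0) := by
  have hadd : ∫ x, fderiv ℝ (D μ) x ((Θ + T z₀) x) ∂μ.1 = 0 := by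
    calc _ = ∫ x, (fderiv ℝ (D μ) x (Θ x) + fderiv ℝ (D μ) x (T z₀ x)) ∂μ.1 :=
          integral_congr_ae (.of_forall fun x => map_add _ _ _)
      _ = 0 := by
          rw [integral_add (h.integrable_fderiv_apply hp μ μ Θ)
            (h.integrable_fderiv_apply hp μ μ (T z₀)), hT, hz₀, add_neg_cancel]
  simpa only [hadd] using h.tendsto_push hp μ hμ (Θ + T z₀)

theorem RegularFunctional.limsup_distToSet_le [CompleteSpace Z] (hp : 1 ≤ p)
    (h : RegularFunctional φ D) (μ : Pp d p) (hμ : φ μ = 0) (kd : Kind) {P : Set (Pp d p)}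
    (hT : ∀ z, ∫ x, fderiv ℝ (D μ) x (T z x) ∂μ.1 = z.1)
    (Θ : BoundedMeasurable (X d) (X d)) {z₀ : EuclideanSpace ℝ (Fin k) × Z}
    (hz₀ : z₀.1 = -∫ x, fderiv ℝ (D μ) x (Θ x) ∂μ.1) {F : ℝ → EuclideanSpace ℝ (Fin k) × Z → Z}
    (hF : ∀ ε > (0 : ℝ), ∀ᶠ r in 𝓝[>] (0 : ℝ), ∀ z ∈ Metric.closedBall z₀ 1,
      ∀ z' ∈ Metric.closedBall z₀ 1, ‖F r z - F r z' - (z.2 - z'.2)‖ ≤ ε * ‖z - z'‖)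
    (hF0 : Tendsto (fun r => F r z₀) (𝓝[>] (0 : ℝ)) (𝓝 0))
    (hP : ∀ᶠ r in 𝓝[>] (0 : ℝ), ∀ z ∈ Metric.closedBall z₀ 1, F r z = 0 →
      push hp μ (r • (Θ + T z)) ∈ P ∧
      transportDist kd p (shift μ.1 (r • Θ)) (push hp μ (r • (Θ + T z))).1 ≤
        ENNReal.ofReal r * eLpNorm (T z) (ENNReal.ofReal p) μ.1) :
    limsup (fun r : ℝ => distToSet kd (shift μ.1 (r • Θ)) (φ ⁻¹' {0} ∩ P) / ENNReal.ofReal r)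
      (𝓝[>] 0) ≤ eLpNorm (T z₀) (ENNReal.ofReal p) μ.1 := by
  refine limsup_div_le_of_approx_id (z₀ := z₀) (K := ‖T‖)
    (F := fun r z => (r⁻¹ • φ (push hp μ (r • (Θ + T z))), F r z)) (norm_nonneg T) ?_ ?_ ?_
  · intro ε hε
    filter_upwards [h.eventually_approx_fst hp μ hT Θ z₀ hε, hF ε hε] with r hfst hsnd z hz z' hz'
    exact norm_prod_le_iff.2 ⟨hfst z hz z' hz', hsnd z hz z' hz'⟩
  · exact (h.tendsto_push_correction hp μ hμ hT Θ hz₀).prodMk_nhds hF0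
  · filter_upwards [hP, self_mem_nhdsWithin] with r hP (hr : 0 < r) z hz hz0
    obtain ⟨hφ, hsnd⟩ := Prod.mk_eq_zero.1 hz0
    obtain ⟨hmem, hdist⟩ := hP z hz hsnd
    refine (iInf₂_le _ ⟨(smul_eq_zero_iff_right (inv_ne_zero hr.ne')).1 hφ, hmem⟩).trans
      (hdist.trans ?_)
    gcongr
    calc eLpNorm (T z) (ENNReal.ofReal p) μ.1
        = eLpNorm (T z₀ + T (z - z₀)) (ENNReal.ofReal p) μ.1 := by
          rw [← map_add, add_sub_cancel]
      _ ≤ eLpNorm (T z₀) (ENNReal.ofReal p) μ.1 + eLpNorm (T (z - z₀)) (ENNReal.ofReal p) μ.1 :=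
          eLpNorm_add_le (T z₀).measurable.aestronglyMeasurable
            (T (z - z₀)).measurable.aestronglyMeasurable (ENNReal.one_le_ofReal.2 hp)
      _ ≤ _ := by
          gcongr
          exact ((T (z - z₀)).eLpNorm_le _ _).trans (ENNReal.ofReal_le_ofReal (T.le_opNorm _))

end Correction

section Jacobian

variable {d k : ℕ} {E : Type*} [NormedAddCommGroup E] [InnerProductSpace ℝ E]

theorem inner_gradient_apply [CompleteSpace E] {u : E → EuclideanSpace ℝ (Fin k)} {x : E}
    (hu : DifferentiableAt ℝ u x) (i : Fin k) (v : E) :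
    inner ℝ (gradient (fun y => u y i) x) v = fderiv ℝ u x v i := by
  have hcomp : HasFDerivAt (fun y => u y i)
      ((EuclideanSpace.proj i : EuclideanSpace ℝ (Fin k) →L[ℝ] ℝ) ∘L fderiv ℝ u x) x :=
    (EuclideanSpace.proj i : EuclideanSpace ℝ (Fin k) →L[ℝ] ℝ).hasFDerivAt.comp x hu.hasFDerivAt
  rw [gradient, InnerProductSpace.toDual_symm_apply, hcomp.fderiv]
  rfl

theorem inner_jac {u : X d → EuclideanSpace ℝ (Fin k)} {x : X d} (hu : DifferentiableAt ℝ u x)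
    (i : Fin k) (v : X d) : inner ℝ (jac u x i) v = fderiv ℝ u x v i :=
  inner_gradient_apply hu i v

theorem mulV_jac {u : X d → EuclideanSpace ℝ (Fin k)} {x : X d} (hu : DifferentiableAt ℝ u x)
    (v : X d) : mulV (jac u x) v = fderiv ℝ u x v := by
  ext i
  exact inner_jac hu i v

theorem jac_eq {u : X d → EuclideanSpace ℝ (Fin k)} {x : X d} (hu : DifferentiableAt ℝ u x)
    (i : Fin k) : jac u x i = (InnerProductSpace.toDual ℝ (X d)).symm
      ((EuclideanSpace.proj i : EuclideanSpace ℝ (Fin k) →L[ℝ] ℝ) ∘L fderiv ℝ u x) := by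
  refine ext_inner_right ℝ fun v => ?_
  rw [inner_jac hu, InnerProductSpace.toDual_symm_apply]
  rfl

theorem continuous_jac {u : X d → EuclideanSpace ℝ (Fin k)} (hu : ContDiff ℝ 1 u) (i : Fin k) :
    Continuous fun x => jac u x i := by
  simp only [jac_eq (hu.differentiable one_ne_zero _)]
  exact (LinearIsometryEquiv.continuous _).comp
    (continuous_const.clm_comp (hu.continuous_fderiv one_ne_zero))

theorem norm_jac_le {u : X d → EuclideanSpace ℝ (Fin k)} {x : X d} (hu : DifferentiableAt ℝ u x)
    (i : Fin k) : ‖jac u x i‖ ≤ ‖fderiv ℝ u x‖ := by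
  rw [jac_eq hu, LinearIsometryEquiv.norm_map]
  refine ContinuousLinearMap.opNorm_le_bound _ (norm_nonneg _) fun v => ?_
  exact (PiLp.norm_apply_le (fderiv ℝ u x v) i).trans (ContinuousLinearMap.le_opNorm _ _)

theorem inner_tmulV (A : Fin k → E) (c : EuclideanSpace ℝ (Fin k)) (v : E) :
    inner ℝ (tmulV A c) v = inner ℝ c (mulV A v) := by
  simp [tmulV, mulV, sum_inner, inner_smul_left, PiLp.inner_apply, mul_comm]

theorem mulT_mulVec (A B : Fin k → E) (c : EuclideanSpace ℝ (Fin k)) (i : Fin k) :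
    (mulT A B).mulVec c i = inner ℝ (A i) (tmulV B c) := by
  simp [Matrix.mulVec, dotProduct, mulT, tmulV, inner_sum, inner_smul_right, mul_comm]

theorem norm_le_frob {E : Type*} [NormedAddCommGroup E] (A : Fin k → E) (i : Fin k) :
    ‖A i‖ ≤ frob A :=
  Real.le_sqrt_of_sq_le <| Finset.single_le_sum (f := fun i => ‖A i‖ ^ 2)
    (fun i _ => by positivity) (Finset.mem_univ i)

theorem frob_le_sum {E : Type*} [NormedAddCommGroup E] (A : Fin k → E) : frob A ≤ ∑ i, ‖A i‖ :=
  Real.sqrt_le_iff.2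
    ⟨by positivity, Finset.sum_sq_le_sq_sum_of_nonneg fun i _ => norm_nonneg _⟩

theorem norm_mulT_self_div_le (q : ℝ) (A : Fin k → E) (i j : Fin k) :
    ‖mulT A A i j / frob A ^ (2 - q)‖ ≤ frob A ^ q := by
  have hfrob : 0 ≤ frob A := Real.sqrt_nonneg _
  have hle : ‖mulT A A i j‖ ≤ frob A ^ 2 :=
    calc ‖mulT A A i j‖ ≤ ‖A i‖ * ‖A j‖ := norm_inner_le_norm (A i) (A j)
      _ ≤ frob A * frob A := by gcongr <;> exact norm_le_frob A _
      _ = frob A ^ 2 := (sq _).symm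
  rw [norm_div, Real.norm_of_nonneg (Real.rpow_nonneg hfrob _)]
  rcases hfrob.eq_or_lt with hzero | hpos
  · have : ‖mulT A A i j‖ = 0 := le_antisymm (by simpa [← hzero] using hle) (norm_nonneg _)
    rw [this, zero_div]
    positivity
  · calc _ ≤ frob A ^ 2 / frob A ^ (2 - q) := by gcongr
      _ = frob A ^ q := by
          rw [← Real.rpow_natCast, ← Real.rpow_sub hpos]
          norm_num

theorem one_lt_conj {p : ℝ} (hp : 1 < p) : 1 < conj p := by
  rw [conj, lt_div_iff₀ (by linarith)]
  linarith

theorem one_le_ofReal_conj {p : ℝ} (hp : 1 < p) : 1 ≤ ENNReal.ofReal (conj p) :=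
  ENNReal.one_le_ofReal.2 (one_lt_conj hp).le

end Jacobian

section Duality

theorem exists_linear_rightInverse {V E : Type*} [AddCommGroup V] [Module ℝ V]
    [NormedAddCommGroup E] [InnerProductSpace ℝ E] [FiniteDimensional ℝ E] (L : V →ₗ[ℝ] E)
    (hL : ∀ lam, (∀ v, inner ℝ lam (L v) = 0) → lam = 0) :
    ∃ T : E →ₗ[ℝ] V, ∀ z, L (T z) = z := by
  have hrange : L.range = ⊤ := by
    rw [← Submodule.orthogonal_eq_bot_iff, Submodule.eq_bot_iff]
    intro lam hlam
    refine hL lam fun v => ?_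
    rw [real_inner_comm]
    exact hlam _ ⟨v, rfl⟩
  obtain ⟨T, hT⟩ := L.exists_rightInverse_of_surjective hrange
  exact ⟨T, LinearMap.congr_fun hT⟩

theorem norm_inv_one_add_norm_smul_le {E : Type*} [SeminormedAddCommGroup E] [NormedSpace ℝ E]
    (v : E) : ‖(1 + ‖v‖)⁻¹ • v‖ ≤ 1 := by
  rw [norm_smul, norm_inv, Real.norm_of_nonneg (by positivity), inv_mul_le_one₀ (by positivity)]
  linarith

theorem ae_eq_zero_of_forall_integral_inner_eq_zero {α E : Type*} [MeasurableSpace α]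
    [NormedAddCommGroup E] [InnerProductSpace ℝ E] [MeasurableSpace E] [BorelSpace E]
    [SecondCountableTopology E] {μ : Measure α} {w : α → E} (hw : Measurable w)
    (hwi : Integrable w μ) (h : ∀ U : BoundedMeasurable α E, ∫ x, inner ℝ (w x) (U x) ∂μ = 0) :
    w =ᵐ[μ] 0 := by
  -- test against the field `w / (1 + ‖w‖)`, which is bounded and points in the direction of `w`
  have hUm : Measurable fun x => (1 + ‖w x‖)⁻¹ • w x := by fun_prop
  have hUle : ∀ x, ‖(1 + ‖w x‖)⁻¹ • w x‖ ≤ 1 := fun x => norm_inv_one_add_norm_smul_le _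
  have hzero : ∫ x, inner ℝ (w x) ((1 + ‖w x‖)⁻¹ • w x) ∂μ = 0 := h (.ofBound _ hUm 1 hUle)
  have hinner : ∀ x, inner ℝ (w x) ((1 + ‖w x‖)⁻¹ • w x) = (1 + ‖w x‖)⁻¹ * ‖w x‖ ^ 2 := fun x => by
    rw [inner_smul_right, real_inner_self_eq_norm_sq]
  simp only [hinner] at hzero
  have hint : Integrable (fun x => (1 + ‖w x‖)⁻¹ * ‖w x‖ ^ 2) μ :=
    hwi.norm.mono' (by fun_prop) <| .of_forall fun x => by
      rw [← hinner]
      exact (norm_inner_le_norm _ _).trans (mul_le_of_le_one_right (norm_nonneg _) (hUle x))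
  filter_upwards [(integral_eq_zero_iff_of_nonneg (fun x => by positivity) hint).1 hzero] with x hx
  have hpos : (1 + ‖w x‖)⁻¹ ≠ 0 := by positivity
  simpa [hpos] using hx

end Duality

section Classical

variable {d k l : ℕ} {p : ℝ} {φ : Pp d p → EuclideanSpace ℝ (Fin k)}
  {D : Pp d p → X d → EuclideanSpace ℝ (Fin k)}

theorem RegularFunctional.differentiable (h : RegularFunctional φ D) (m : Pp d p) :
    Differentiable ℝ (D m) :=
  (h.contDiff m).differentiable one_ne_zero

theorem RegularFunctional.memLp_jac (hp : 1 < p) (h : RegularFunctional φ D) (m : Pp d p)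
    (i : Fin k) : MemLp (fun x => jac (D m) x i) (ENNReal.ofReal (conj p)) m.1 :=
  (h.memLp_fderiv hp m).mono (continuous_jac (h.contDiff m) i).aestronglyMeasurable
    (.of_forall fun x => norm_jac_le (h.differentiable m x) i)

theorem RegularFunctional.integrable_mulT_div (hp : 1 < p) (h : RegularFunctional φ D)
    (m : Pp d p) (i j : Fin k) :
    Integrable (fun x => mulT (jac (D m) x) (jac (D m) x) i j /
      frob (jac (D m) x) ^ (2 - conj p)) m.1 := by
  have hconj : 0 < conj p := zero_lt_one.trans (one_lt_conj hp)
  have hc := fun i => continuous_jac (h.contDiff m) i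
  have hsum : MemLp (fun x => ∑ i, ‖jac (D m) x i‖) (ENNReal.ofReal (conj p)) m.1 :=
    memLp_finsetSum _ fun i _ => (h.memLp_jac hp m i).norm
  have hfrob : Continuous fun x => frob (jac (D m) x) :=
    Continuous.sqrt (continuous_finsetSum _ fun i _ => (hc i).norm.pow 2)
  have hmulT : Continuous fun x => mulT (jac (D m) x) (jac (D m) x) i j := (hc i).inner (hc j)
  have hdom := hsum.integrable_norm_rpow'
  rw [ENNReal.toReal_ofReal hconj.le] at hdom
  refine hdom.mono' (hmulT.measurable.div (hfrob.measurable.pow_const _)).aestronglyMeasurable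
    (.of_forall fun x => (norm_mulT_self_div_le _ _ i j).trans ?_)
  refine Real.rpow_le_rpow (Real.sqrt_nonneg _) ((frob_le_sum _).trans ?_) hconj.le
  exact Real.le_norm_self _

theorem AssumptionW.eq_zero_of_tmulV_jac_ae_eq_zero (hp : 1 < p) (h : RegularFunctional φ D)
    {m : Pp d p} {ψ : X d → EuclideanSpace ℝ (Fin l)} (hA : AssumptionW p m.1 (D m) ψ)
    {lam : EuclideanSpace ℝ (Fin k)} (hlam : (fun x => tmulV (jac (D m) x) lam) =ᵐ[m.1] 0) :
    lam = 0 := by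
  obtain ⟨c, hc, hpos⟩ := hA.nondegenerate
  set G : Matrix (Fin k) (Fin k) ℝ := Matrix.of fun i j =>
    ∫ x, mulT (jac (D m) x) (jac (D m) x) i j / frob (jac (D m) x) ^ (2 - conj p) ∂m.1
  have hG : G.mulVec lam = 0 := by
    funext i
    simp only [G, Matrix.mulVec, dotProduct, Matrix.of_apply, Pi.zero_apply, ← integral_mul_const]
    rw [← integral_finsetSum _ fun j _ => (h.integrable_mulT_div hp m i j).mul_const _]
    refine integral_eq_zero_of_ae ?_
    filter_upwards [hlam] with x hx
    have hrow := mulT_mulVec (jac (D m) x) (jac (D m) x) lam i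
    rw [hx, Pi.zero_apply, inner_zero_right] at hrow
    simp only [div_mul_eq_mul_div, ← Finset.sum_div]
    exact div_eq_zero_iff.2 (.inl hrow)
  have hquad := hpos.dotProduct_mulVec_nonneg lam.ofLp
  have hsq : star lam.ofLp ⬝ᵥ lam.ofLp = ‖lam‖ ^ 2 := by
    rw [EuclideanSpace.norm_sq_eq]
    simp [dotProduct, sq]
  rw [Matrix.sub_mulVec, hG, Matrix.smul_mulVec, Matrix.one_mulVec, zero_sub, dotProduct_neg,
    dotProduct_smul, hsq, smul_eq_mul] at hquad
  have : ‖lam‖ ^ 2 = 0 := by nlinarith [sq_nonneg ‖lam‖]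
  simpa using this

theorem RegularFunctional.exists_rightInverse (hp : 1 < p) (h : RegularFunctional φ D) (m : Pp d p)
    (hN : ∀ lam, (fun x => tmulV (jac (D m) x) lam) =ᵐ[m.1] 0 → lam = 0) :
    ∃ T : EuclideanSpace ℝ (Fin k) →L[ℝ] BoundedMeasurable (X d) (X d),
      ∀ z, ∫ x, fderiv ℝ (D m) x (T z x) ∂m.1 = z := by
  suffices hinj : ∀ lam, (∀ U : BoundedMeasurable (X d) (X d),
      inner ℝ lam (∫ x, fderiv ℝ (D m) x (U x) ∂m.1) = 0) → lam = 0 by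
    obtain ⟨T, hT⟩ := exists_linear_rightInverse
      (BoundedMeasurable.integralL (h.integrable_fderiv hp.le m m)).toLinearMap hinj
    exact ⟨T.toContinuousLinearMap, hT⟩
  refine fun lam hlam => hN lam ?_
  have hmeas : Measurable fun x => tmulV (jac (D m) x) lam := Continuous.measurable <|
    continuous_finsetSum _ fun i _ => (continuous_jac (h.contDiff m) i).const_smul (lam i)
  have hi : Integrable (fun x => tmulV (jac (D m) x) lam) m.1 := integrable_finsetSum _ fun i _ =>
    ((h.memLp_jac hp m i).integrable (one_le_ofReal_conj hp)).smul (lam i)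
  refine ae_eq_zero_of_forall_integral_inner_eq_zero hmeas hi fun U => ?_
  simp only [inner_tmulV, mulV_jac (h.differentiable m _)]
  rw [integral_inner (h.integrable_fderiv_apply hp.le m m U)]
  exact hlam U

theorem perp_calE_zero : perp p (calE (0 : X d → EuclideanSpace ℝ (Fin l))) = Set.univ := by
  refine Set.eq_univ_of_forall fun m f hf => ?_
  obtain ⟨g, -, rfl⟩ := hf
  simp

theorem eLpNorm_shift_sub_shift {r : ℝ} (hr : 0 ≤ r) (Θ W : BoundedMeasurable (X d) (X d))
    (q : ℝ≥0∞) (μ : Measure (X d)) :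
    eLpNorm (fun x => (x + (r • Θ) x) - (x + (r • (Θ + W)) x)) q μ =
      ENNReal.ofReal r * eLpNorm W q μ := by
  have hsub : (fun x => (x + (r • Θ) x) - (x + (r • (Θ + W)) x)) = -(r • (W : X d → X d)) := by
    funext x
    change (x + r • Θ x) - (x + r • (Θ x + W x)) = -(r • W x)
    rw [smul_add]
    abel
  rw [hsub, eLpNorm_neg, eLpNorm_const_smul, Real.enorm_eq_ofReal hr]

theorem RegularFunctional.exists_limsup_distToSet_classical_le (hp : 1 < p)
    (h : RegularFunctional φ D) (μ : Pp d p) (hμ : φ μ = 0)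
    (hN : ∀ lam, (fun x => tmulV (jac (D μ) x) lam) =ᵐ[μ.1] 0 → lam = 0) :
    ∃ C : ℝ≥0, 0 < C ∧ ∀ Θ : BoundedMeasurable (X d) (X d),
      limsup (fun r : ℝ => distToSet .classical (shift μ.1 (r • Θ)) (φ ⁻¹' {0} ∩ .univ)
          / ENNReal.ofReal r) (𝓝[>] 0)
        ≤ C * ‖opL1 .classical μ.1 (D μ) Θ‖ₑ := by
  obtain ⟨T, hT⟩ := h.exists_rightInverse hp μ hN
  refine ⟨‖T‖₊ + 1, by positivity, fun Θ => ?_⟩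
  set a := opL1 .classical μ.1 (D μ) Θ
  have ha : a = ∫ x, fderiv ℝ (D μ) x (Θ x) ∂μ.1 :=
    integral_congr_ae (.of_forall fun x => mulV_jac (h.differentiable μ x) _)
  have hlim := h.limsup_distToSet_le (Z := PUnit.{1}) hp.le μ hμ .classical (P := .univ)
    (T := T ∘L .fst ℝ _ _) (fun z => hT z.1) Θ (z₀ := (-a, 0)) (by rw [ha]) (F := fun _ _ => 0)
    (fun ε hε => .of_forall fun _ z _ z' _ => by
      rw [Subsingleton.elim (_ - _ - _ : PUnit) 0, norm_zero]
      positivity)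
    tendsto_const_nhds
    (by
      filter_upwards [self_mem_nhdsWithin] with r (hr : 0 < r) z _ _
      refine ⟨trivial, ?_⟩
      rw [← eLpNorm_shift_sub_shift hr.le Θ]
      exact transportDist_classical_map_map_le (by linarith) μ.1
        (measurable_id.add (r • Θ).measurable)
        (measurable_id.add (r • (Θ + (T ∘L .fst ℝ _ _) z)).measurable))
  calc _ ≤ eLpNorm (T (-a)) (ENNReal.ofReal p) μ.1 := hlim
    _ ≤ ENNReal.ofReal (‖T‖ * ‖-a‖) :=
        ((T (-a)).eLpNorm_le _ _).trans (ENNReal.ofReal_le_ofReal (T.le_opNorm _))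
    _ = ‖T‖₊ * ‖a‖ₑ := by
        rw [norm_neg, ENNReal.ofReal_mul (norm_nonneg T), ofReal_norm, ofReal_norm, enorm_eq_nnnorm]
    _ ≤ (‖T‖₊ + 1 : ℝ≥0) * ‖a‖ₑ := by
        gcongr
        exact le_self_add

end Classical

section Disintegration

variable {d : ℕ} {F : Type*} [NormedAddCommGroup F] {m : Measure (X d)}

theorem integrable_map_prod {f : X d → F} (hf : Integrable f m) :
    Integrable (fun q : S d × S d => f (WithLp.toLp 2 q)) (m.map fun x => (x.fst, x.snd)) := by
  have hm : m = (m.map fun x : X d => (x.fst, x.snd)).map (WithLp.toLp 2) := by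
    rw [Measure.map_map (by fun_prop) (by fun_prop)]
    exact Measure.map_id.symm
  rw [hm] at hf
  exact (integrable_map_measure hf.1 (by fun_prop)).1 hf

variable [IsFiniteMeasure m]

/-- The conditional law of `X₂` given `X₁`. -/
noncomputable def condLaw (m : Measure (X d)) [IsFiniteMeasure m] :
    ProbabilityTheory.Kernel (S d) (S d) :=
  ProbabilityTheory.condDistrib (fun x : X d => x.snd) (fun x : X d => x.fst) m

instance (m : Measure (X d)) [IsFiniteMeasure m] :
    ProbabilityTheory.IsMarkovKernel (condLaw m) :=
  inferInstanceAs (ProbabilityTheory.IsMarkovKernel (ProbabilityTheory.condDistrib _ _ m))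

theorem ae_integrable_slice {f : X d → F} (hf : Integrable f m) :
    ∀ᵐ x ∂m, Integrable (fun z => f (WithLp.toLp 2 (x.fst, z))) (condLaw m x.fst) :=
  (integrable_map_prod hf).condDistrib_ae (X := fun x : X d => x.fst) (Y := fun x : X d => x.snd)
    (by fun_prop) (by fun_prop)

variable [NormedSpace ℝ F]

/-- The version `y ↦ ∫ f(y, z) κ(y, dz)` of `𝔼[f(X) | X₁ = y]`, with `κ` the conditional law. -/
noncomputable def kerE (m : Measure (X d)) [IsFiniteMeasure m] (f : X d → F) (y : S d) : F :=
  ∫ z, f (WithLp.toLp 2 (y, z)) ∂condLaw m y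

theorem norm_kerE_le {f : X d → F} {K : ℝ} (hK : ∀ x, ‖f x‖ ≤ K) (y : S d) :
    ‖kerE m f y‖ ≤ K := by
  refine (norm_integral_le_of_norm_le_const (.of_forall fun z => hK _)).trans ?_
  simp

theorem stronglyMeasurable_kerE {f : X d → F} (hf : StronglyMeasurable f) :
    StronglyMeasurable (kerE m f) :=
  StronglyMeasurable.integral_condDistrib (f := fun q : S d × S d => f (WithLp.toLp 2 q))
    (hf.comp_measurable (by fun_prop))

section Complete

variable [CompleteSpace F]

theorem condE1_ae_eq_kerE {f : X d → F} (hf : Integrable f m) :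
    condE1 m f =ᵐ[m] fun x => kerE m f x.fst :=
  ProbabilityTheory.condExp_prod_ae_eq_integral_condDistrib' (X := fun x : X d => x.fst)
    (Y := fun x : X d => x.snd) (by fun_prop) (by fun_prop) (integrable_map_prod hf)

theorem integral_kerE {f : X d → F} (hf : Integrable f m) :
    ∫ x, kerE m f x.fst ∂m = ∫ x, f x ∂m := by
  rw [← integral_congr_ae (condE1_ae_eq_kerE hf)]
  exact integral_condExp (Measurable.comap_le (by fun_prop))

theorem integrable_kerE {f : X d → F} (hf : Integrable f m) :
    Integrable (fun x => kerE m f x.fst) m :=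
  integrable_condExp.congr (condE1_ae_eq_kerE hf)

theorem memLp_kerE {f : X d → F} {q : ℝ≥0∞} (hq : 1 ≤ q) (hf : MemLp f q m) :
    MemLp (fun x => kerE m f x.fst) q m :=
  (hf.condExp hq).ae_eq (condE1_ae_eq_kerE (hf.integrable hq))

theorem integral_inner_kerE {E : Type*} [NormedAddCommGroup E] [InnerProductSpace ℝ E]
    [CompleteSpace E] {f : X d → E} (hf : Integrable f m) {a : S d → E}
    (ha : Integrable (fun x => inner ℝ (a x.fst) (f x)) m) :
    ∫ x, inner ℝ (a x.fst) (kerE m f x.fst) ∂m = ∫ x, inner ℝ (a x.fst) (f x) ∂m := by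
  rw [← integral_kerE ha]
  refine integral_congr_ae ?_
  filter_upwards [ae_integrable_slice hf] with x hx
  exact (integral_inner hx _).symm

end Complete

variable [MeasurableSpace F] [BorelSpace F] [SecondCountableTopology F]

theorem BoundedMeasurable.integrable (f : BoundedMeasurable (X d) F) : Integrable f m :=
  .of_bound f.measurable.aestronglyMeasurable ‖f‖ (.of_forall f.norm_apply_le)

theorem BoundedMeasurable.integrable_slice (f : BoundedMeasurable (X d) F) (y : S d) :
    Integrable (fun z => f (WithLp.toLp 2 (y, z))) (condLaw m y) :=
  .of_bound (f.measurable.comp (by fun_prop)).aestronglyMeasurable ‖f‖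
    (.of_forall fun _ => f.norm_apply_le _)

/-- Conditional expectation given `X₁`, as an operator on bounded measurable functions. -/
noncomputable def kerEL (m : Measure (X d)) [IsFiniteMeasure m] :
    BoundedMeasurable (X d) F →L[ℝ] BoundedMeasurable (S d) F :=
  LinearMap.mkContinuous
    { toFun f := .ofBound (kerE m f)
        (stronglyMeasurable_kerE f.measurable.stronglyMeasurable).measurable ‖f‖
        (norm_kerE_le f.norm_apply_le)
      map_add' f g := Subtype.ext <| lp.ext <| funext fun y =>
        integral_add (f.integrable_slice y) (g.integrable_slice y)
      map_smul' c f := Subtype.ext <| lp.ext <| funext fun y => integral_smul c _ } 1 fun f => by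
    rw [one_mul]
    exact BoundedMeasurable.norm_le (norm_nonneg f) (norm_kerE_le f.norm_apply_le)

theorem kerE_continuousLinearMap_comp [CompleteSpace F] {G : Type*} [NormedAddCommGroup G]
    [NormedSpace ℝ G] [CompleteSpace G] (L : F →L[ℝ] G) (f : BoundedMeasurable (X d) F) (y : S d) :
    kerE m (fun x => L (f x)) y = L (kerE m f y) :=
  L.integral_comp_comm (f.integrable_slice y)

end Disintegration

section Coercive

variable {E : Type*} [NormedAddCommGroup E] [InnerProductSpace ℝ E] {c : ℝ}

/-- The operators `Q` with `⟪Q v, v⟫ ≥ c |v|²` for all `v`. -/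
def coerciveOperators (E : Type*) [NormedAddCommGroup E] [InnerProductSpace ℝ E] (c : ℝ) :
    Set (E →L[ℝ] E) :=
  {Q | ∀ v, c * ‖v‖ ^ 2 ≤ inner ℝ (Q v) v}

theorem isClosed_coerciveOperators : IsClosed (coerciveOperators E c) := by
  rw [coerciveOperators, Set.ofPred_forall]
  exact isClosed_iInter fun v => isClosed_le continuous_const (by fun_prop)

theorem mul_norm_le_of_mem_coerciveOperators {Q : E →L[ℝ] E} (hQ : Q ∈ coerciveOperators E c)
    (v : E) : c * ‖v‖ ≤ ‖Q v‖ := by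
  rcases (norm_nonneg v).eq_or_lt with hv | hv
  · simp [← hv]
  · refine le_of_mul_le_mul_right ?_ hv
    linarith [hQ v, real_inner_le_norm (Q v) v, sq ‖v‖]

variable [FiniteDimensional ℝ E]

theorem isUnit_of_mem_coerciveOperators (hc : 0 < c) {Q : E →L[ℝ] E}
    (hQ : Q ∈ coerciveOperators E c) : IsUnit Q := by
  have hinj : Function.Injective Q.toLinearMap := (injective_iff_map_eq_zero _).2 fun v hv => by
    have hle := mul_norm_le_of_mem_coerciveOperators hQ v
    rw [show Q v = 0 from hv, norm_zero] at hle
    exact norm_le_zero_iff.1 (nonpos_of_mul_nonpos_right hle hc)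
  have := FiniteDimensional.complete ℝ E
  exact ContinuousLinearMap.isUnit_iff_bijective.2 ⟨hinj, LinearMap.injective_iff_surjective.1 hinj⟩

theorem apply_inverse_of_mem_coerciveOperators (hc : 0 < c) {Q : E →L[ℝ] E}
    (hQ : Q ∈ coerciveOperators E c) (v : E) : Q (Ring.inverse Q v) = v :=
  DFunLike.congr_fun (Ring.mul_inverse_cancel Q (isUnit_of_mem_coerciveOperators hc hQ)) v

theorem norm_inverse_le_of_mem_coerciveOperators (hc : 0 < c) {Q : E →L[ℝ] E}
    (hQ : Q ∈ coerciveOperators E c) : ‖Ring.inverse Q‖ ≤ c⁻¹ := by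
  refine ContinuousLinearMap.opNorm_le_bound _ (by positivity) fun v => ?_
  rw [le_inv_mul_iff₀ hc]
  simpa only [apply_inverse_of_mem_coerciveOperators hc hQ] using
    mul_norm_le_of_mem_coerciveOperators hQ (Ring.inverse Q v)

theorem continuousOn_inverse_coerciveOperators (hc : 0 < c) :
    ContinuousOn Ring.inverse (coerciveOperators E c) := fun Q hQ => by
  have := FiniteDimensional.complete ℝ E
  obtain ⟨u, rfl⟩ := isUnit_of_mem_coerciveOperators hc hQ
  exact (NormedRing.inverse_continuousAt u).continuousWithinAt

/-- The inverse, extended by `0` outside `coerciveOperators`. -/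
noncomputable def coerciveInverse (c : ℝ) : (E →L[ℝ] E) → E →L[ℝ] E :=
  (coerciveOperators E c).indicator Ring.inverse

theorem measurable_coerciveInverse (hc : 0 < c) : Measurable (coerciveInverse (E := E) c) := by
  classical
  rw [coerciveInverse, ← Set.piecewise_eq_indicator]
  exact (continuousOn_inverse_coerciveOperators hc).measurable_piecewise continuousOn_const
    isClosed_coerciveOperators.measurableSet

theorem apply_coerciveInverse (hc : 0 < c) {Q : E →L[ℝ] E} (hQ : Q ∈ coerciveOperators E c)
    (v : E) : Q (coerciveInverse c Q v) = v := by
  rw [coerciveInverse, Set.indicator_of_mem hQ]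
  exact apply_inverse_of_mem_coerciveOperators hc hQ v

omit [FiniteDimensional ℝ E] in
theorem coerciveInverse_of_notMem {Q : E →L[ℝ] E} (hQ : Q ∉ coerciveOperators E c) :
    coerciveInverse c Q = 0 :=
  Set.indicator_of_notMem hQ _

theorem norm_coerciveInverse_le (hc : 0 < c) (Q : E →L[ℝ] E) : ‖coerciveInverse c Q‖ ≤ c⁻¹ := by
  by_cases hQ : Q ∈ coerciveOperators E c
  · rw [coerciveInverse, Set.indicator_of_mem hQ]
    exact norm_inverse_le_of_mem_coerciveOperators hc hQ
  · rw [coerciveInverse_of_notMem hQ, norm_zero]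
    positivity

end Coercive

section Gram

variable {d l : ℕ}

/-- The projection `(x₁, x₂) ↦ (0, x₂)` of `𝕏`. -/
noncomputable def verticalProj (d : ℕ) : X d →L[ℝ] X d :=
  (WithLp.prodContinuousLinearEquiv 2 ℝ (S d) (S d)).symm.toContinuousLinearMap ∘L
    ContinuousLinearMap.inr ℝ (S d) (S d) ∘L WithLp.sndL 2 ℝ (S d) (S d)

theorem verticalProj_apply (x : X d) : verticalProj d x = WithLp.toLp 2 (0, x.snd) :=
  rfl

theorem inner_verticalProj_left (x y : X d) :
    inner ℝ (verticalProj d x) y = inner ℝ x.snd y.snd := by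
  simp [verticalProj_apply, WithLp.prod_inner_apply]

theorem inner_verticalProj_right (x y : X d) :
    inner ℝ x (verticalProj d y) = inner ℝ x.snd y.snd := by
  simp [verticalProj_apply, WithLp.prod_inner_apply]

variable (A : BoundedMeasurable (X d) (X d →L[ℝ] EuclideanSpace ℝ (Fin l)))

/-- The field of the operators `Π Aᵀ`, with `Π` the projection to the second block. -/
noncomputable def verticalAdjoint : BoundedMeasurable (X d) (EuclideanSpace ℝ (Fin l) →L[ℝ] X d) :=
  .ofBound (fun x => verticalProj d ∘L ContinuousLinearMap.adjoint (A x))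
    ((show Continuous fun B : X d →L[ℝ] EuclideanSpace ℝ (Fin l) =>
      verticalProj d ∘L ContinuousLinearMap.adjoint B by fun_prop).measurable.comp A.measurable)
    (‖verticalProj d‖ * ‖A‖) fun x => by
      refine (ContinuousLinearMap.opNorm_comp_le _ _).trans ?_
      rw [LinearIsometryEquiv.norm_map]
      exact mul_le_mul_of_nonneg_left (A.norm_apply_le x) (norm_nonneg _)

/-- The field of the operators `A Π Aᵀ`. For `A = ∂_x ψ` these are the matrices
`(∂_{x₂} ψ)(∂_{x₂} ψ)ᵀ`. -/
noncomputable def gramField :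
    BoundedMeasurable (X d) (EuclideanSpace ℝ (Fin l) →L[ℝ] EuclideanSpace ℝ (Fin l)) :=
  .ofBound (fun x => A x ∘L verticalAdjoint A x)
    ((show Continuous fun B : (X d →L[ℝ] EuclideanSpace ℝ (Fin l)) ×
        (EuclideanSpace ℝ (Fin l) →L[ℝ] X d) => B.1 ∘L B.2 by fun_prop).measurable.comp
      (A.measurable.prodMk (verticalAdjoint A).measurable))
    (‖A‖ * ‖verticalAdjoint A‖) fun x =>
      (ContinuousLinearMap.opNorm_comp_le _ _).trans <| mul_le_mul (A.norm_apply_le x)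
        ((verticalAdjoint A).norm_apply_le x) (norm_nonneg _) (norm_nonneg A)

variable (m : Measure (X d)) [IsFiniteMeasure m] (c : ℝ)

/-- The conditional Gram operator `𝔼[A Π Aᵀ | X₁ = y]`. -/
noncomputable def condGramOp :
    BoundedMeasurable (S d) (EuclideanSpace ℝ (Fin l) →L[ℝ] EuclideanSpace ℝ (Fin l)) :=
  kerEL m (gramField A)

/-- The points at which the conditional Gram operator is bounded below by `c`. -/
def goodPoints : Set (S d) := {y | condGramOp A m y ∈ coerciveOperators _ c}

theorem measurableSet_goodPoints : MeasurableSet (goodPoints A m c) :=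
  (condGramOp A m).measurable isClosed_coerciveOperators.measurableSet

variable {c}

/-- The inverse of the conditional Gram operator, set to `0` where that operator is not bounded
below by `c`. -/
noncomputable def condGramInv (hc : 0 < c) :
    BoundedMeasurable (S d) (EuclideanSpace ℝ (Fin l) →L[ℝ] EuclideanSpace ℝ (Fin l)) :=
  .ofBound (fun y => coerciveInverse c (condGramOp A m y))
    ((measurable_coerciveInverse hc).comp (condGramOp A m).measurable) c⁻¹ fun _ =>
      norm_coerciveInverse_le hc _

theorem condGramOp_condGramInv (hc : 0 < c) {y : S d} (hy : y ∈ goodPoints A m c)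
    (v : EuclideanSpace ℝ (Fin l)) : condGramOp A m y (condGramInv A m hc y v) = v :=
  apply_coerciveInverse hc hy v

/-- The operator `g ↦ Π Aᵀ (𝔼[A Π Aᵀ | X₁])⁻¹ g(X₁)`, whose values are vertical fields: the least
displacement of the second component that realises prescribed conditional derivatives. -/
noncomputable def vertical (hc : 0 < c) :
    BoundedMeasurable (S d) (EuclideanSpace ℝ (Fin l)) →L[ℝ] BoundedMeasurable (X d) (X d) :=
  BoundedMeasurable.applyL (verticalAdjoint A) ∘L
    BoundedMeasurable.compL (fun x => x.fst) (by fun_prop) ∘L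
      BoundedMeasurable.applyL (condGramInv A m hc)

theorem vertical_apply (hc : 0 < c) (g : BoundedMeasurable (S d) (EuclideanSpace ℝ (Fin l)))
    (x : X d) : vertical A m hc g x = verticalAdjoint A x (condGramInv A m hc x.fst (g x.fst)) :=
  rfl

theorem norm_vertical_apply_le (hc : 0 < c)
    (g : BoundedMeasurable (S d) (EuclideanSpace ℝ (Fin l))) (x : X d) :
    ‖vertical A m hc g x‖ ≤ ‖verticalAdjoint A‖ * c⁻¹ * ‖g x.fst‖ := by
  rw [vertical_apply, mul_assoc]
  exact (verticalAdjoint A x).le_of_opNorm_le_of_le ((verticalAdjoint A).norm_apply_le x)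
    ((condGramInv A m hc x.fst).le_of_opNorm_le (norm_coerciveInverse_le hc _) _)

/-- The operator `U ↦ 𝔼[A U | X₁]`. -/
noncomputable def condDeriv :
    BoundedMeasurable (X d) (X d) →L[ℝ] BoundedMeasurable (S d) (EuclideanSpace ℝ (Fin l)) :=
  kerEL m ∘L BoundedMeasurable.applyL A

theorem condDeriv_apply (U : BoundedMeasurable (X d) (X d)) (y : S d) :
    condDeriv A m U y = kerE m (fun x => A x (U x)) y :=
  rfl

theorem kerE_apply_verticalAdjoint (g : S d → EuclideanSpace ℝ (Fin l)) (y : S d) :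
    kerE m (fun x => A x (verticalAdjoint A x (g x.fst))) y = condGramOp A m y (g y) :=
  (ContinuousLinearMap.integral_apply ((gramField A).integrable_slice y) (g y)).symm

theorem condDeriv_vertical_of_mem (hc : 0 < c)
    (g : BoundedMeasurable (S d) (EuclideanSpace ℝ (Fin l))) {y : S d}
    (hy : y ∈ goodPoints A m c) : condDeriv A m (vertical A m hc g) y = g y := by
  rw [condDeriv_apply]
  simp only [vertical_apply]
  rw [kerE_apply_verticalAdjoint A m fun y => condGramInv A m hc y (g y)]
  exact condGramOp_condGramInv A m hc hy _

/-- The operator that makes a field satisfy `𝔼[A U | X₁] = 0` by a change of its second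
component. -/
noncomputable def corrected (hc : 0 < c) :
    BoundedMeasurable (X d) (X d) →L[ℝ] BoundedMeasurable (X d) (X d) :=
  .id ℝ _ - vertical A m hc ∘L condDeriv A m

theorem corrected_apply (hc : 0 < c) (U : BoundedMeasurable (X d) (X d)) :
    corrected A m hc U = U - vertical A m hc (condDeriv A m U) :=
  rfl

theorem condDeriv_corrected_of_mem (hc : 0 < c) (U : BoundedMeasurable (X d) (X d)) {y : S d}
    (hy : y ∈ goodPoints A m c) : condDeriv A m (corrected A m hc U) y = 0 := by
  rw [corrected_apply, map_sub]
  exact sub_eq_zero.2 (condDeriv_vertical_of_mem A m hc _ hy).symm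

end Gram

section

variable {d l : ℕ} {p : ℝ} {ψ : X d → EuclideanSpace ℝ (Fin l)}

theorem adjoint_fderiv_apply {x : X d} (hψ : DifferentiableAt ℝ ψ x)
    (v : EuclideanSpace ℝ (Fin l)) :
    ContinuousLinearMap.adjoint (fderiv ℝ ψ x) v = tmulV (jac ψ x) v := by
  refine ext_inner_right ℝ fun y => ?_
  rw [ContinuousLinearMap.adjoint_inner_left, inner_tmulV, mulV_jac hψ]

theorem gramField_apply_single {A : BoundedMeasurable (X d) (X d →L[ℝ] EuclideanSpace ℝ (Fin l))}
    {x : X d} (hψ : DifferentiableAt ℝ ψ x) (hA : A x = fderiv ℝ ψ x) (i j : Fin l) :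
    gramField A x (EuclideanSpace.single j 1) i = mulT (jac2 ψ x) (jac2 ψ x) i j :=
  calc gramField A x (EuclideanSpace.single j 1) i
      = fderiv ℝ ψ x (verticalProj d
          (ContinuousLinearMap.adjoint (fderiv ℝ ψ x) (EuclideanSpace.single j 1))) i := by
        rw [← hA]
        rfl
    _ = inner ℝ (jac ψ x i) (verticalProj d (jac ψ x j)) := by
        rw [← inner_jac hψ, adjoint_fderiv_apply hψ]
        simp [tmulV]
    _ = _ := inner_verticalProj_right _ _

variable {m : Measure (X d)} [IsFiniteMeasure m]

theorem condGram_ae_eq {A : BoundedMeasurable (X d) (X d →L[ℝ] EuclideanSpace ℝ (Fin l))}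
    (hψ : Differentiable ℝ ψ) (hA : ∀ x, A x = fderiv ℝ ψ x) :
    ∀ᵐ x ∂m, (condGram m ψ x).toEuclideanLin = (condGramOp A m x.fst).toLinearMap := by
  have hentry (i j : Fin l) : ∀ᵐ x ∂m, condGram m ψ x i j =
      condGramOp A m x.fst (EuclideanSpace.single j 1) i := by
    let L : (EuclideanSpace ℝ (Fin l) →L[ℝ] EuclideanSpace ℝ (Fin l)) →L[ℝ] ℝ :=
      EuclideanSpace.proj i ∘L ContinuousLinearMap.apply ℝ _ (EuclideanSpace.single j 1)
    have hL : (fun x => mulT (jac2 ψ x) (jac2 ψ x) i j) = fun x => L (gramField A x) :=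
      funext fun x => (gramField_apply_single (hψ x) (hA x) i j).symm
    have hint : Integrable (fun x => L (gramField A x)) m :=
      L.integrable_comp (gramField A).integrable
    rw [← hL] at hint
    filter_upwards [condE1_ae_eq_kerE hint] with x hx
    rw [condGram, Matrix.of_apply, hx, hL, kerE_continuousLinearMap_comp]
    rfl
  filter_upwards [ae_all_iff.2 fun i => ae_all_iff.2 (hentry i)] with x hx
  refine (EuclideanSpace.basisFun (Fin l) ℝ).toBasis.ext fun j => ?_
  ext i
  simpa using hx i j

theorem ae_fst_mem_goodPoints {A : BoundedMeasurable (X d) (X d →L[ℝ] EuclideanSpace ℝ (Fin l))}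
    (hψ : Differentiable ℝ ψ) (hA : ∀ x, A x = fderiv ℝ ψ x) {c : ℝ}
    (hgram : ∀ᵐ x ∂m, (condGram m ψ x - c • (1 : Matrix (Fin l) (Fin l) ℝ)).PosSemidef) :
    ∀ᵐ x ∂m, x.fst ∈ goodPoints A m c := by
  filter_upwards [hgram, condGram_ae_eq hψ hA] with x hpos heq v
  have h := (Matrix.isPositive_toEuclideanLin_iff.2 hpos).re_inner_nonneg_left v
  rw [map_sub, heq] at h
  simpa [inner_sub_left, inner_smul_left] using h

end

section AdaptedFields

variable {d k : ℕ}

/-- The displacement fields `U = (θ(x₁), U₂(x₁, x₂))` with `θ` Lipschitz. For small `r` the map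
`x₁ ↦ x₁ + r θ(x₁)` is then invertible, so that `X + r U` is bi-causally coupled to `X`. -/
def adaptedFields (d : ℕ) : Submodule ℝ (BoundedMeasurable (X d) (X d)) where
  carrier := {U | ∃ (K : ℝ≥0) (θ : S d → S d), LipschitzWith K θ ∧ ∀ x, (U x).fst = θ x.fst}
  add_mem' := by
    rintro U V ⟨K, θ, hθ, hU⟩ ⟨K', θ', hθ', hV⟩
    exact ⟨_, _, hθ.add hθ', fun x => congrArg₂ (· + ·) (hU x) (hV x)⟩
  zero_mem' := ⟨0, 0, .const 0, fun _ => rfl⟩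
  smul_mem' := by
    rintro c U ⟨K, θ, hθ, hU⟩
    exact ⟨_, _, (lipschitzWith_smul c).comp hθ, fun x => congrArg (c • ·) (hU x)⟩

theorem adaptedFields_exists_lipschitzWith
    (W : EuclideanSpace ℝ (Fin k) →ₗ[ℝ] adaptedFields d) :
    ∃ K : ℝ≥0, ∀ z, ∃ θ : S d → S d, LipschitzWith (K * ‖z‖₊) θ ∧
      ∀ x, ((W z).1 x).fst = θ x.fst := by
  choose K θ hθ hW using fun i => (W (EuclideanSpace.single i 1)).2
  refine ⟨∑ i, K i, fun z => ⟨fun y => ∑ i, z i • θ i y, ?_, fun x => ?_⟩⟩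
  · refine LipschitzWith.of_dist_le_mul fun y y' => ?_
    rw [dist_eq_norm, ← Finset.sum_sub_distrib]
    calc ‖∑ i, (z i • θ i y - z i • θ i y')‖
        ≤ ∑ i, ‖z‖ * (K i * dist y y') := norm_sum_le_of_le _ fun i _ => by
          rw [← smul_sub, norm_smul, ← dist_eq_norm]
          gcongr
          exacts [PiLp.norm_apply_le z i, (hθ i).dist_le_mul y y']
      _ = _ := by
          push_cast
          rw [Finset.sum_mul, Finset.sum_mul]
          exact Finset.sum_congr rfl fun i _ => by ring
  · have hz : z = ∑ i, z i • EuclideanSpace.single i (1 : ℝ) := by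
      simpa using ((EuclideanSpace.basisFun (Fin k) ℝ).sum_repr z).symm
    let L : adaptedFields d →ₗ[ℝ] S d :=
      { toFun U := (U.1 x).fst, map_add' _ _ := rfl, map_smul' _ _ := rfl }
    calc ((W z).1 x).fst = (L ∘ₗ W) (∑ i, z i • EuclideanSpace.single i 1) := by
          rw [← hz]
          rfl
      _ = ∑ i, z i • L (W (EuclideanSpace.single i 1)) := by
          rw [map_sum]
          exact Finset.sum_congr rfl fun i _ => map_smul _ _ _
      _ = _ := Finset.sum_congr rfl fun i _ => congrArg (z i • ·) (hW i x)

theorem mem_adaptedFields_of_fst_eq_zero {U : BoundedMeasurable (X d) (X d)}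
    (h : ∀ x, (U x).fst = 0) : U ∈ adaptedFields d :=
  ⟨0, 0, .const 0, h⟩

end AdaptedFields

section Projection

variable {d : ℕ} {m : Measure (X d)}

theorem integrable_fst {v : X d → X d} (hv : Integrable v m) :
    Integrable (fun x => (v x).fst) m :=
  (WithLp.fstL 2 ℝ (S d) (S d)).integrable_comp hv

theorem integrable_snd {v : X d → X d} (hv : Integrable v m) :
    Integrable (fun x => (v x).snd) m :=
  (WithLp.sndL 2 ℝ (S d) (S d)).integrable_comp hv

theorem snd_ae_eq_zero_of_forall_adaptedFields {v : X d → X d} (hv : Measurable v)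
    (hvi : Integrable v m) (h : ∀ U ∈ adaptedFields d, ∫ x, inner ℝ (v x) (U x) ∂m = 0) :
    (fun x => (v x).snd) =ᵐ[m] 0 := by
  have hzero : (fun x => verticalProj d (v x)) =ᵐ[m] 0 := by
    refine ae_eq_zero_of_forall_integral_inner_eq_zero
      ((verticalProj d).continuous.measurable.comp hv) ((verticalProj d).integrable_comp hvi)
      fun U => ?_
    have hU := h (BoundedMeasurable.applyL
      (.ofBound (fun _ => verticalProj d) measurable_const ‖verticalProj d‖ fun _ => le_rfl) U)
      (mem_adaptedFields_of_fst_eq_zero fun _ => rfl)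
    rw [← hU]
    refine integral_congr_ae (.of_forall fun x => ?_)
    exact (inner_verticalProj_left _ _).trans (inner_verticalProj_right _ _).symm
  filter_upwards [hzero] with x hx
  exact congrArg (fun y : X d => y.snd) hx

theorem ae_eq_zero_of_integral_inner_eq_zero {E E' : Type*} [NormedAddCommGroup E]
    [NormedSpace ℝ E] [FiniteDimensional ℝ E] [MeasurableSpace E] [BorelSpace E]
    [NormedAddCommGroup E'] [InnerProductSpace ℝ E'] [CompleteSpace E']
    {m : Measure E} {w : E → E'} (hw : Integrable w m)
    (h : ∀ (g : E → ℝ) (e : E'), ContDiff ℝ 1 g → HasCompactSupport g →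
      ∫ x, inner ℝ (g x • e) (w x) ∂m = 0) : w =ᵐ[m] 0 := by
  refine ae_eq_zero_of_integral_contDiff_smul_eq_zero hw.locallyIntegrable fun g hg hgc => ?_
  have hg1 : ContDiff ℝ 1 g := hg.of_le (by exact_mod_cast le_top)
  obtain ⟨K, hK⟩ := hgc.exists_bound_of_continuous hg1.continuous
  have hi : Integrable (fun x => g x • w x) m :=
    hw.bdd_smul K hg1.continuous.aestronglyMeasurable (.of_forall hK)
  refine ext_inner_left ℝ fun e => ?_
  rw [← integral_inner hi, inner_zero_right, ← h g e hg1 hgc]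
  refine integral_congr_ae (.of_forall fun x => ?_)
  simp only [inner_smul_left, inner_smul_right, conj_trivial]

/-- The field `(x₁, x₂) ↦ (θ(x₁), 0)`. -/
noncomputable def horizontal (θ : BoundedMeasurable (S d) (S d)) : BoundedMeasurable (X d) (X d) :=
  .ofBound (fun x => WithLp.toLp 2 (θ x.fst, 0))
    ((WithLp.measurable_toLp 2 _).comp
      ((θ.measurable.comp (by fun_prop)).prodMk measurable_const))
    ‖θ‖ fun x => by simpa using θ.norm_apply_le x.fst

variable [IsFiniteMeasure m]

/-- The orthogonal projection `v ↦ (𝔼[v₁ | X₁], v₂)` to the adapted fields. -/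
noncomputable def adaptedProj (m : Measure (X d)) [IsFiniteMeasure m] (v : X d → X d) (x : X d) :
    X d :=
  WithLp.toLp 2 (kerE m (fun x => (v x).fst) x.fst, (v x).snd)

theorem integrable_adaptedProj {v : X d → X d} (hv : Integrable v m) :
    Integrable (adaptedProj m v) m :=
  (WithLp.prodContinuousLinearEquiv 2 ℝ (S d) (S d)).symm.toContinuousLinearMap.integrable_comp
    ((integrable_kerE (integrable_fst hv)).prodMk (integrable_snd hv))

theorem adaptedProj_sub_ae_eq {v w : X d → X d} (hv : Integrable v m) (hw : Integrable w m) :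
    adaptedProj m (v - w) =ᵐ[m] adaptedProj m v - adaptedProj m w := by
  filter_upwards [ae_integrable_slice (integrable_fst hv), ae_integrable_slice (integrable_fst hw)]
    with x hvx hwx
  exact congrArg (fun y => WithLp.toLp 2 (y, (v x).snd - (w x).snd)) (integral_sub hvx hwx)

theorem kerE_inner_adaptedProj {v : X d → X d} (hv : Integrable v m)
    {Θ : BoundedMeasurable (X d) (X d)} (hΘ : Θ ∈ adaptedFields d) :
    ∀ᵐ x ∂m, kerE m (fun x => inner ℝ (adaptedProj m v x) (Θ x)) x.fst =
      kerE m (fun x => inner ℝ (v x) (Θ x)) x.fst := by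
  obtain ⟨-, θ, -, hθ⟩ := hΘ
  have hsnd : Integrable (fun x => inner ℝ (v x).snd (Θ x).snd) m := by
    simpa only [inner_verticalProj_left] using
      BoundedMeasurable.integrable_inner ((verticalProj d).integrable_comp hv) Θ
  filter_upwards [ae_integrable_slice (integrable_fst hv), ae_integrable_slice hsnd]
    with x hfst_x hsnd_x
  set y := x.fst
  have hsplit (w : X d) (z : S d) : inner ℝ w (Θ (WithLp.toLp 2 (y, z))) =
      inner ℝ (θ y) w.fst + inner ℝ w.snd (Θ (WithLp.toLp 2 (y, z))).snd :=
    (WithLp.prod_inner_apply _ _).trans (congrArg (· + _)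
      ((congrArg (inner ℝ w.fst) (hθ _)).trans (real_inner_comm _ _)))
  simp only [kerE, hsplit]
  refine (integral_add (f := fun _ => inner ℝ (θ y) (kerE m (fun x => (v x).fst) y))
    (integrable_const _) hsnd_x).trans
    (.trans ?_ (integral_add (hfst_x.const_inner (θ y)) hsnd_x).symm)
  congr 1
  rw [integral_const, probReal_univ, one_smul]
  exact (integral_inner hfst_x (θ y)).symm

theorem kerE_fst_ae_eq_zero_of_forall_adaptedFields {v : X d → X d} (hv : Measurable v)
    (hvi : Integrable v m) (h : ∀ U ∈ adaptedFields d, ∫ x, inner ℝ (v x) (U x) ∂m = 0) :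
    (fun x => kerE m (fun x => (v x).fst) x.fst) =ᵐ[m] 0 := by
  have hfst := integrable_fst hvi
  have hmeas : StronglyMeasurable (kerE m fun x => (v x).fst) :=
    stronglyMeasurable_kerE ((by fun_prop : Measurable fun x => (v x).fst).stronglyMeasurable)
  have hint : Integrable (kerE m fun x => (v x).fst) (m.map fun x => x.fst) :=
    (integrable_map_measure hmeas.aestronglyMeasurable (by fun_prop)).2 (integrable_kerE hfst)
  refine ae_of_ae_map (f := fun x : X d => x.fst) (by fun_prop)
    (ae_eq_zero_of_integral_inner_eq_zero hint fun g e hg hgc => ?_)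
  obtain ⟨K, hK⟩ := hg.lipschitzWith_of_hasCompactSupport hgc one_ne_zero
  obtain ⟨B, hB⟩ := hgc.exists_bound_of_continuous hg.continuous
  let θ : BoundedMeasurable (S d) (S d) :=
    .ofBound (fun y => g y • e) (hg.continuous.measurable.smul_const e) (B * ‖e‖) fun y => by
      rw [norm_smul]
      exact mul_le_mul_of_nonneg_right (hB y) (norm_nonneg e)
  have hθ : LipschitzWith (‖e‖₊ * K) θ := .of_dist_le_mul fun y y' => by
    change ‖g y • e - g y' • e‖ ≤ _
    rw [← sub_smul, norm_smul, mul_comm, NNReal.coe_mul, mul_assoc]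
    exact mul_le_mul_of_nonneg_left (hK.norm_sub_le y y') (norm_nonneg e)
  have hinner (x : X d) : inner ℝ (v x) (horizontal θ x) = inner ℝ (θ x.fst) (v x).fst := by
    rw [WithLp.prod_inner_apply, real_inner_comm]
    exact (congrArg _ (inner_zero_right _)).trans (add_zero _)
  have hzero := h (horizontal θ) ⟨_, θ, hθ, fun _ => rfl⟩
  have hθi := BoundedMeasurable.integrable_inner hvi (horizontal θ)
  simp only [hinner] at hzero hθi
  rw [integral_map (by fun_prop)
    (θ.measurable.aestronglyMeasurable.inner hmeas.aestronglyMeasurable)]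
  exact (integral_inner_kerE hfst hθi).trans hzero

theorem adaptedProj_ae_eq_zero {v : X d → X d} (hv : Measurable v)
    (hvi : Integrable v m) (h : ∀ U ∈ adaptedFields d, ∫ x, inner ℝ (v x) (U x) ∂m = 0) :
    adaptedProj m v =ᵐ[m] 0 := by
  filter_upwards [snd_ae_eq_zero_of_forall_adaptedFields hv hvi h,
    kerE_fst_ae_eq_zero_of_forall_adaptedFields hv hvi h] with x hsnd hfst
  exact congrArg₂ (fun y z => WithLp.toLp 2 (y, z)) hfst hsnd

end Projection

section AdaptedGradient

variable {d n : ℕ} {m : Measure (X d)} [IsFiniteMeasure m]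

theorem condE1_mulV_adaptedProj {v : Fin n → X d → X d} (hv : ∀ i, Integrable (v i) m)
    {Θ : BoundedMeasurable (X d) (X d)} (hΘ : Θ ∈ adaptedFields d) :
    condE1 m (fun x => mulV (fun i => adaptedProj m (v i) x) (Θ x)) =ᵐ[m]
      fun x => kerE m (fun x => mulV (fun i => v i x) (Θ x)) x.fst := by
  have hproj := fun i => BoundedMeasurable.integrable_inner (integrable_adaptedProj (hv i)) Θ
  have hinner := fun i => BoundedMeasurable.integrable_inner (hv i) Θ
  refine (condE1_ae_eq_kerE (.of_eval_piLp hproj)).trans ?_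
  filter_upwards [ae_all_iff.2 fun i => kerE_inner_adaptedProj (hv i) hΘ,
    ae_all_iff.2 fun i => ae_integrable_slice (hproj i),
    ae_all_iff.2 fun i => ae_integrable_slice (hinner i)] with x hx hproj_x hinner_x
  ext i
  exact (eval_integral_piLp hproj_x i).trans ((hx i).trans
    (eval_integral_piLp (f := fun z => mulV (fun i => v i (WithLp.toLp 2 (x.fst, z)))
      (Θ (WithLp.toLp 2 (x.fst, z)))) hinner_x i).symm)

variable {u : X d → EuclideanSpace ℝ (Fin n)}

theorem grad_adapted_ae_eq (hui : ∀ i, Integrable (fun x => jac u x i) m) :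
    ∀ᵐ x ∂m, grad .adapted m u x = fun i => adaptedProj m (fun x => jac u x i) x := by
  filter_upwards [ae_all_iff.2 fun i => condE1_ae_eq_kerE (integrable_fst (hui i))] with x hx
  exact funext fun i => congrArg (fun y => WithLp.toLp 2 (y, (jac u x i).snd)) (hx i)

theorem condE1_mulV_grad_adapted (hu : Differentiable ℝ u)
    (hui : ∀ i, Integrable (fun x => jac u x i) m) {Θ : BoundedMeasurable (X d) (X d)}
    (hΘ : Θ ∈ adaptedFields d) : condE1 m (fun x => mulV (grad .adapted m u x) (Θ x)) =ᵐ[m]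
      fun x => kerE m (fun x => fderiv ℝ u x (Θ x)) x.fst := by
  have hgrad : (fun x => mulV (grad .adapted m u x) (Θ x)) =ᵐ[m]
      fun x => mulV (fun i => adaptedProj m (fun x => jac u x i) x) (Θ x) := by
    filter_upwards [grad_adapted_ae_eq hui] with x hx
    rw [hx]
  simp only [← mulV_jac (hu _)]
  exact (condExp_congr_ae hgrad).trans (condE1_mulV_adaptedProj hui hΘ)

theorem integral_mulV_grad_adapted (hu : Differentiable ℝ u)
    (hui : ∀ i, Integrable (fun x => jac u x i) m) {Θ : BoundedMeasurable (X d) (X d)}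
    (hΘ : Θ ∈ adaptedFields d) :
    ∫ x, mulV (grad .adapted m u x) (Θ x) ∂m = ∫ x, fderiv ℝ u x (Θ x) ∂m := by
  have hint : Integrable (fun x => fderiv ℝ u x (Θ x)) m := by
    simp only [← mulV_jac (hu _)]
    exact .of_eval_piLp fun i => BoundedMeasurable.integrable_inner (hui i) Θ
  rw [← integral_kerE hint, ← integral_congr_ae (condE1_mulV_grad_adapted hu hui hΘ)]
  exact (integral_condExp (Measurable.comap_le (by fun_prop))).symm

theorem fst_tmulV (A : Fin n → X d) (c : EuclideanSpace ℝ (Fin n)) :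
    (tmulV A c).fst = ∑ i, c i • (A i).fst :=
  map_sum (WithLp.fstL 2 ℝ (S d) (S d)) _ _

theorem snd_tmulV (A : Fin n → X d) (c : EuclideanSpace ℝ (Fin n)) :
    (tmulV A c).snd = ∑ i, c i • (A i).snd :=
  map_sum (WithLp.sndL 2 ℝ (S d) (S d)) _ _

theorem tmulV_grad_adapted_ae_eq (hui : ∀ i, Integrable (fun x => jac u x i) m)
    (h : S d → EuclideanSpace ℝ (Fin n)) : (fun x => tmulV (grad .adapted m u x) (h x.fst)) =ᵐ[m]
      adaptedProj m fun x => tmulV (jac u x) (h x.fst) := by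
  filter_upwards [grad_adapted_ae_eq hui,
    ae_all_iff.2 fun i => ae_integrable_slice (integrable_fst (hui i))] with x hx hslice
  rw [hx]
  refine WithLp.ofLp_injective 2 (Prod.ext ?_ ?_)
  · calc (tmulV (fun i => adaptedProj m (fun x => jac u x i) x) (h x.fst)).fst
        = ∑ i, h x.fst i • kerE m (fun x => (jac u x i).fst) x.fst := fst_tmulV _ _
      _ = ∫ z, ∑ i, h x.fst i • (jac u (WithLp.toLp 2 (x.fst, z)) i).fst ∂condLaw m x.fst := by
          rw [integral_finsetSum _ fun i _ => (hslice i).fun_smul (h x.fst i)]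
          exact Finset.sum_congr rfl fun i _ => (integral_smul _ _).symm
      _ = _ := integral_congr_ae (.of_forall fun z => (fst_tmulV _ _).symm)
  · exact (snd_tmulV _ _).trans (snd_tmulV (jac u x) (h x.fst)).symm

end AdaptedGradient

section Adjoint

variable {α E F : Type*} [MeasurableSpace α]
  [NormedAddCommGroup E] [InnerProductSpace ℝ E] [FiniteDimensional ℝ E]
  [NormedAddCommGroup F] [InnerProductSpace ℝ F] [FiniteDimensional ℝ F]

namespace BoundedMeasurable

theorem memLp_adjoint_apply (B : BoundedMeasurable α (E →L[ℝ] F)) {μ : Measure α} {q : ℝ≥0∞}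
    {f : α → F} (hf : MemLp f q μ) :
    MemLp (fun a => ContinuousLinearMap.adjoint (B a) (f a)) q μ :=
  hf.of_le_mul (c := ‖B‖)
    (isBoundedBilinearMap_apply.continuous.comp_aestronglyMeasurable
      ((ContinuousLinearMap.adjoint.continuous.measurable.comp
        B.measurable).aestronglyMeasurable.prodMk hf.1))
    (.of_forall fun a => ContinuousLinearMap.le_of_opNorm_le _
      ((LinearIsometryEquiv.norm_map _ _).trans_le (B.norm_apply_le a)) _)

variable [MeasurableSpace E] [BorelSpace E] [MeasurableSpace F] [BorelSpace F]

theorem measurable_adjoint_apply (B : BoundedMeasurable α (E →L[ℝ] F)) {f : α → F}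
    (hf : Measurable f) : Measurable fun a => ContinuousLinearMap.adjoint (B a) (f a) :=
  measurable_apply (ContinuousLinearMap.adjoint.continuous.measurable.comp B.measurable) hf

end BoundedMeasurable

end Adjoint

section Multiplier

variable {d l : ℕ} (A : BoundedMeasurable (X d) (X d →L[ℝ] EuclideanSpace ℝ (Fin l)))
  (m : Measure (X d)) [IsFiniteMeasure m] {c : ℝ} (hc : 0 < c) {w : X d → X d}

/-- The Lagrange multiplier of the constraint `𝔼[A U | X₁] = 0`: the adjoint of `vertical`, applied
to the field `w`. -/
noncomputable def multiplier (w : X d → X d) (y : S d) : EuclideanSpace ℝ (Fin l) :=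
  ContinuousLinearMap.adjoint (condGramInv A m hc y)
    (kerE m (fun x => ContinuousLinearMap.adjoint (verticalAdjoint A x) (w x)) y)

theorem measurable_multiplier (hw : Measurable w) : Measurable (multiplier A m hc w) :=
  (condGramInv A m hc).measurable_adjoint_apply (stronglyMeasurable_kerE
    ((verticalAdjoint A).measurable_adjoint_apply hw).stronglyMeasurable).measurable

variable {m}

theorem memLp_multiplier {q : ℝ≥0∞} (hq : 1 ≤ q) (hw : MemLp w q m) :
    MemLp (fun x => multiplier A m hc w x.fst) q m :=
  (BoundedMeasurable.compL (fun x : X d => x.fst) (by fun_prop)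
    (condGramInv A m hc)).memLp_adjoint_apply
      (memLp_kerE hq ((verticalAdjoint A).memLp_adjoint_apply hw))

theorem integral_inner_vertical (hw : Integrable w m)
    (g : BoundedMeasurable (S d) (EuclideanSpace ℝ (Fin l))) :
    ∫ x, inner ℝ (w x) (vertical A m hc g x) ∂m =
      ∫ x, inner ℝ (multiplier A m hc w x.fst) (g x.fst) ∂m := by
  set a := BoundedMeasurable.applyL (condGramInv A m hc) g
  have hadj := memLp_one_iff_integrable.1
    ((verticalAdjoint A).memLp_adjoint_apply (memLp_one_iff_integrable.2 hw))
  have hint : Integrable (fun x => inner ℝ (a x.fst)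
      (ContinuousLinearMap.adjoint (verticalAdjoint A x) (w x))) m :=
    (BoundedMeasurable.integrable_inner hadj (BoundedMeasurable.compL (fun x : X d => x.fst)
      (by fun_prop) a)).congr (.of_forall fun x => real_inner_comm _ _)
  calc ∫ x, inner ℝ (w x) (vertical A m hc g x) ∂m
      = ∫ x, inner ℝ (a x.fst) (ContinuousLinearMap.adjoint (verticalAdjoint A x) (w x)) ∂m :=
        integral_congr_ae (.of_forall fun x => (real_inner_comm _ _).trans
          (ContinuousLinearMap.adjoint_inner_right (verticalAdjoint A x) (a x.fst) (w x)).symm)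
    _ = ∫ x, inner ℝ (a x.fst) (kerE m
          (fun x => ContinuousLinearMap.adjoint (verticalAdjoint A x) (w x)) x.fst) ∂m :=
        (integral_inner_kerE hadj hint).symm
    _ = _ := integral_congr_ae (.of_forall fun x => (real_inner_comm _ _).trans
          (ContinuousLinearMap.adjoint_inner_left (condGramInv A m hc x.fst) _ _).symm)

theorem integral_inner_corrected (hw : Integrable w m) (U : BoundedMeasurable (X d) (X d)) :
    ∫ x, inner ℝ (w x) (corrected A m hc U x) ∂m =
      ∫ x, inner ℝ (w x - ContinuousLinearMap.adjoint (A x) (multiplier A m hc w x.fst))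
        (U x) ∂m := by
  have hmult := memLp_multiplier A hc le_rfl (memLp_one_iff_integrable.2 hw)
  have hAU := BoundedMeasurable.integrable_inner (memLp_one_iff_integrable.1 hmult)
    (BoundedMeasurable.applyL A U)
  have hadj := memLp_one_iff_integrable.1 (A.memLp_adjoint_apply hmult)
  calc ∫ x, inner ℝ (w x) (corrected A m hc U x) ∂m
      = ∫ x, (inner ℝ (w x) (U x) - inner ℝ (w x) (vertical A m hc (condDeriv A m U) x)) ∂m :=
        integral_congr_ae (.of_forall fun x => inner_sub_right _ _ _)
    _ = ∫ x, inner ℝ (w x) (U x) ∂m -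
          ∫ x, inner ℝ (multiplier A m hc w x.fst) (condDeriv A m U x.fst) ∂m := by
        rw [integral_sub (BoundedMeasurable.integrable_inner hw U)
          (BoundedMeasurable.integrable_inner hw _), integral_inner_vertical A hc hw]
    _ = ∫ x, inner ℝ (w x) (U x) ∂m - ∫ x, inner ℝ
          (ContinuousLinearMap.adjoint (A x) (multiplier A m hc w x.fst)) (U x) ∂m := by
        refine congrArg (_ - ·) ((integral_inner_kerE (BoundedMeasurable.applyL A U).integrable
          hAU).trans (integral_congr_ae (.of_forall fun x => ?_)))
        exact (ContinuousLinearMap.adjoint_inner_left (A x) _ _).symm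
    _ = _ := by
        rw [← integral_sub (BoundedMeasurable.integrable_inner hw U)
          (BoundedMeasurable.integrable_inner hadj U)]
        exact integral_congr_ae (.of_forall fun x => (inner_sub_left _ _ _).symm)

theorem adaptedProj_sub_adjoint_multiplier_ae_eq_zero (hwm : Measurable w) (hw : Integrable w m)
    (h : ∀ U ∈ adaptedFields d, ∫ x, inner ℝ (w x) (corrected A m hc U x) ∂m = 0) :
    adaptedProj m (fun x => w x - ContinuousLinearMap.adjoint (A x) (multiplier A m hc w x.fst))
      =ᵐ[m] 0 := by
  have hmeas : Measurable fun x =>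
      ContinuousLinearMap.adjoint (A x) (multiplier A m hc w x.fst) :=
    A.measurable_adjoint_apply ((measurable_multiplier A m hc hwm).comp (by fun_prop))
  have hint := memLp_one_iff_integrable.1 <| A.memLp_adjoint_apply <|
    memLp_multiplier A hc le_rfl (memLp_one_iff_integrable.2 hw)
  exact adaptedProj_ae_eq_zero (hwm.sub hmeas) (hw.sub hint) fun U hU =>
    (integral_inner_corrected A hc hw U).symm.trans (h U hU)

theorem fst_corrected (U : BoundedMeasurable (X d) (X d)) (x : X d) :
    (corrected A m hc U x).fst = (U x).fst :=
  sub_zero (U x).fst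

end Multiplier

section AdaptedRightInverse

variable {d k l : ℕ} {p : ℝ}

theorem enorm_integral_apply_le {α E F : Type*} [MeasurableSpace α] [NormedAddCommGroup E]
    [NormedSpace ℝ E] [NormedAddCommGroup F] [NormedSpace ℝ F] (hp : 1 < p) {μ : Measure α}
    {A : α → E →L[ℝ] F} {f : α → E} (hA : AEStronglyMeasurable A μ)
    (hf : AEStronglyMeasurable f μ) :
    ‖∫ a, A a (f a) ∂μ‖ₑ ≤
      eLpNorm A (ENNReal.ofReal (conj p)) μ * eLpNorm f (ENNReal.ofReal p) μ := by
  have : ENNReal.HolderTriple (ENNReal.ofReal (conj p)) (ENNReal.ofReal p) 1 :=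
    (Real.HolderConjugate.conjExponent hp).symm.ennrealOfReal
  calc ‖∫ a, A a (f a) ∂μ‖ₑ ≤ eLpNorm (fun a => A a (f a)) 1 μ :=
        (enorm_integral_le_lintegral_enorm _).trans eLpNorm_one_eq_lintegral_enorm.ge
    _ ≤ (1 : ℝ≥0) * eLpNorm A (ENNReal.ofReal (conj p)) μ * eLpNorm f (ENNReal.ofReal p) μ :=
        eLpNorm_le_eLpNorm_mul_eLpNorm_of_nnnorm hA hf (fun B v => B v) 1
          (.of_forall fun a => by simpa only [one_mul] using (A a).le_opNNNorm (f a))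
    _ = _ := by rw [ENNReal.coe_one, one_mul]

variable {A : BoundedMeasurable (X d) (X d →L[ℝ] EuclideanSpace ℝ (Fin l))}
  {ψ : X d → EuclideanSpace ℝ (Fin l)} {c : ℝ}

theorem eLpNorm_vertical_le (m : Measure (X d)) [IsFiniteMeasure m] (hc : 0 < c) (q : ℝ≥0∞)
    (g : BoundedMeasurable (S d) (EuclideanSpace ℝ (Fin l))) :
    eLpNorm (vertical A m hc g) q m ≤
      ENNReal.ofReal (‖verticalAdjoint A‖ * c⁻¹) * eLpNorm (fun x => g x.fst) q m :=
  eLpNorm_le_mul_eLpNorm_of_ae_le_mul (.of_forall (norm_vertical_apply_le A m hc g)) q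

theorem integrable_jac {m : Measure (X d)} [IsFiniteMeasure m] (hψ : ContDiff ℝ 1 ψ)
    (hA : ∀ x, A x = fderiv ℝ ψ x) (i : Fin l) : Integrable (fun x => jac ψ x i) m :=
  .of_bound (continuous_jac hψ i).aestronglyMeasurable ‖A‖ <| .of_forall fun x =>
    (norm_jac_le (hψ.differentiable one_ne_zero x) i).trans (hA x ▸ A.norm_apply_le x)

theorem tmulV_neg {E : Type*} [NormedAddCommGroup E] [InnerProductSpace ℝ E] (B : Fin l → E)
    (v : EuclideanSpace ℝ (Fin l)) : tmulV B (-v) = -tmulV B v := by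
  simp [tmulV]

variable {φ : Pp d p → EuclideanSpace ℝ (Fin k)} {D : Pp d p → X d → EuclideanSpace ℝ (Fin k)}
  {μ : Pp d p}

theorem RegularFunctional.eq_zero_of_inner_integral_corrected (hp : 1 < p)
    (h : RegularFunctional φ D) (hψ : ContDiff ℝ 1 ψ) (hA : ∀ x, A x = fderiv ℝ ψ x) (hc : 0 < c)
    (hN : ∀ lam (g : S d → EuclideanSpace ℝ (Fin l)),
      MemLp g (ENNReal.ofReal (conj p)) (μ.1.map fun x => x.fst) →
      (fun x => tmulV (grad .adapted μ.1 (D μ) x) lam +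
        tmulV (grad .adapted μ.1 ψ x) (g x.fst)) =ᵐ[μ.1] 0 → lam = 0)
    {lam : EuclideanSpace ℝ (Fin k)} (hlam : ∀ U ∈ adaptedFields d,
      inner ℝ lam (∫ x, fderiv ℝ (D μ) x (corrected A μ.1 hc U x) ∂μ.1) = 0) : lam = 0 := by
  have hq := one_le_ofReal_conj hp
  set w : X d → X d := fun x => tmulV (jac (D μ) x) lam
  have hwm : Measurable w := Continuous.measurable <| continuous_finsetSum _ fun i _ =>
    (continuous_jac (h.contDiff μ) i).const_smul (lam i)
  have hwq : MemLp w (ENNReal.ofReal (conj p)) μ.1 :=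
    memLp_finsetSum _ fun i _ => (h.memLp_jac hp μ i).const_smul (lam i)
  have hw := hwq.integrable hq
  set g := multiplier A μ.1 hc w
  have hgq := memLp_multiplier A hc hq hwq
  have hadj (x : X d) : ContinuousLinearMap.adjoint (A x) (g x.fst) =
      tmulV (jac ψ x) (g x.fst) := by
    rw [hA, adjoint_fderiv_apply (hψ.differentiable one_ne_zero x)]
  have hv : Integrable (fun x => tmulV (jac ψ x) (g x.fst)) μ.1 := by
    simp only [← hadj]
    exact (A.memLp_adjoint_apply hgq).integrable hq
  have hproj : adaptedProj μ.1 (w - fun x => tmulV (jac ψ x) (g x.fst)) =ᵐ[μ.1] 0 := by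
    simp only [← hadj]
    refine adaptedProj_sub_adjoint_multiplier_ae_eq_zero A hc hwm hw fun U hU => ?_
    rw [← hlam U hU, ← integral_inner (h.integrable_fderiv_apply hp.le μ μ _)]
    simp only [w, inner_tmulV, mulV_jac (h.differentiable μ _)]
  refine hN lam (-g) ?_ ?_
  · exact ((memLp_map_measure_iff
      (measurable_multiplier A μ.1 hc hwm).aestronglyMeasurable (by fun_prop)).2 hgq).neg
  filter_upwards [hproj, adaptedProj_sub_ae_eq hw hv,
    tmulV_grad_adapted_ae_eq (fun i => (h.memLp_jac hp μ i).integrable hq) fun _ => lam,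
    tmulV_grad_adapted_ae_eq (integrable_jac hψ hA) g] with x hzero hsub hD hψx
  rw [Pi.neg_apply, tmulV_neg, hD, hψx, ← sub_eq_add_neg]
  exact hsub.symm.trans hzero

theorem RegularFunctional.exists_adapted_rightInverse_fst (hp : 1 < p)
    (h : RegularFunctional φ D) (hψ : ContDiff ℝ 1 ψ) (hA : ∀ x, A x = fderiv ℝ ψ x) (hc : 0 < c)
    (hN : ∀ lam (g : S d → EuclideanSpace ℝ (Fin l)),
      MemLp g (ENNReal.ofReal (conj p)) (μ.1.map fun x => x.fst) →
      (fun x => tmulV (grad .adapted μ.1 (D μ) x) lam +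
        tmulV (grad .adapted μ.1 ψ x) (g x.fst)) =ᵐ[μ.1] 0 → lam = 0) :
    ∃ (W : EuclideanSpace ℝ (Fin k) →L[ℝ] BoundedMeasurable (X d) (X d)) (K : ℝ≥0), ∀ z,
      ∫ x, fderiv ℝ (D μ) x (W z x) ∂μ.1 = z ∧
      (∀ y ∈ goodPoints A μ.1 c, condDeriv A μ.1 (W z) y = 0) ∧
      ∃ θ : S d → S d, LipschitzWith (K * ‖z‖₊) θ ∧ ∀ x, (W z x).fst = θ x.fst := by
  obtain ⟨V, hV⟩ := exists_linear_rightInverse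
    ((BoundedMeasurable.integralL (h.integrable_fderiv hp.le μ μ) ∘L
      corrected A μ.1 hc).toLinearMap ∘ₗ (adaptedFields d).subtype) fun lam hlam =>
    h.eq_zero_of_inner_integral_corrected hp hψ hA hc hN fun U hU => hlam ⟨U, hU⟩
  obtain ⟨K, hK⟩ := adaptedFields_exists_lipschitzWith V
  refine ⟨corrected A μ.1 hc ∘L ((adaptedFields d).subtype ∘ₗ V).toContinuousLinearMap, K,
    fun z => ⟨hV z, fun y hy => condDeriv_corrected_of_mem A μ.1 hc _ hy, ?_⟩⟩
  obtain ⟨θ, hθ, hfst⟩ := hK z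
  exact ⟨θ, hθ, fun x => (fst_corrected A hc _ x).trans (hfst x)⟩

/-- The right inverse `z ↦ W (z₁ - B V z₂) + V z₂` of `U ↦ (B U, 𝔼[A U | X₁])`, where `V` is
`vertical` and `W` is a right inverse of `B` with values in the fields with `𝔼[A U | X₁] = 0`. -/
noncomputable def adaptedRightInverse
    (A : BoundedMeasurable (X d) (X d →L[ℝ] EuclideanSpace ℝ (Fin l)))
    (m : Measure (X d)) [IsFiniteMeasure m] (hc : 0 < c)
    (B : BoundedMeasurable (X d) (X d) →L[ℝ] EuclideanSpace ℝ (Fin k))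
    (W : EuclideanSpace ℝ (Fin k) →L[ℝ] BoundedMeasurable (X d) (X d)) :
    EuclideanSpace ℝ (Fin k) × BoundedMeasurable (S d) (EuclideanSpace ℝ (Fin l)) →L[ℝ]
      BoundedMeasurable (X d) (X d) :=
  W ∘L (.fst ℝ _ _ - B ∘L vertical A m hc ∘L .snd ℝ _ _) + vertical A m hc ∘L .snd ℝ _ _

variable {m : Measure (X d)} [IsFiniteMeasure m]
  {B : BoundedMeasurable (X d) (X d) →L[ℝ] EuclideanSpace ℝ (Fin k)}
  {W : EuclideanSpace ℝ (Fin k) →L[ℝ] BoundedMeasurable (X d) (X d)}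

theorem adaptedRightInverse_apply (hc : 0 < c) (z) : adaptedRightInverse A m hc B W z =
    W (z.1 - B (vertical A m hc z.2)) + vertical A m hc z.2 :=
  rfl

theorem map_adaptedRightInverse (hc : 0 < c) (hW : ∀ a, B (W a) = a) (z) :
    B (adaptedRightInverse A m hc B W z) = z.1 := by
  rw [adaptedRightInverse_apply, map_add, hW, sub_add_cancel]

theorem condDeriv_adaptedRightInverse_of_mem (hc : 0 < c) {y : S d} (hy : y ∈ goodPoints A m c)
    (hW : ∀ a, condDeriv A m (W a) y = 0) (z) :
    condDeriv A m (adaptedRightInverse A m hc B W z) y = z.2 y := by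
  rw [adaptedRightInverse_apply, map_add]
  exact (congrArg₂ (· + ·) (hW _) (condDeriv_vertical_of_mem A m hc z.2 hy)).trans (zero_add _)

theorem exists_lipschitzWith_fst_adaptedRightInverse (hc : 0 < c) {K : ℝ≥0}
    (hW : ∀ a, ∃ θ : S d → S d, LipschitzWith (K * ‖a‖₊) θ ∧ ∀ x, (W a x).fst = θ x.fst) :
    ∃ K : ℝ≥0, ∀ z, ∃ θ : S d → S d, LipschitzWith (K * ‖z‖₊) θ ∧
      ∀ x, (adaptedRightInverse A m hc B W z x).fst = θ x.fst := by
  set R := ContinuousLinearMap.fst ℝ (EuclideanSpace ℝ (Fin k))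
    (BoundedMeasurable (S d) (EuclideanSpace ℝ (Fin l))) - B ∘L vertical A m hc ∘L .snd ℝ _ _
  refine ⟨K * ‖R‖₊, fun z => ?_⟩
  obtain ⟨θ, hθ, hfst⟩ := hW (R z)
  refine ⟨θ, hθ.weaken ?_, fun x => (add_zero _).trans (hfst x)⟩
  rw [mul_assoc]
  exact mul_le_mul_right (R.le_opNNNorm z) K

theorem eLpNorm_adaptedRightInverse_le [IsProbabilityMeasure m] (hp : 1 ≤ p) (hc : 0 < c) {b : ℝ≥0}
    (hB : ∀ U, ‖B U‖ₑ ≤ b * eLpNorm U (ENNReal.ofReal p) m) :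
    ∃ C : ℝ≥0, ∀ z, eLpNorm (adaptedRightInverse A m hc B W z) (ENNReal.ofReal p) m ≤
      C * (‖z.1‖ₑ + eLpNorm (fun x => z.2 x.fst) (ENNReal.ofReal p) m) := by
  set M : ℝ≥0 := ‖verticalAdjoint A‖₊ * Real.toNNReal c⁻¹
  refine ⟨‖W‖₊ * (1 + b * M) + M, fun z => ?_⟩
  set N := eLpNorm (fun x => z.2 x.fst) (ENNReal.ofReal p) m
  have hV : eLpNorm (vertical A m hc z.2) (ENNReal.ofReal p) m ≤ M * N := by
    refine (eLpNorm_vertical_le m hc _ z.2).trans_eq (congrArg (· * N) ?_)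
    rw [ENNReal.ofReal_mul (norm_nonneg _), ofReal_norm, ENNReal.coe_mul]
    rfl
  have hWa (a) : eLpNorm (W a) (ENNReal.ofReal p) m ≤ ‖W‖₊ * ‖a‖ₑ := by
    refine ((W a).eLpNorm_le _ _).trans ?_
    rw [ofReal_norm]
    exact ENNReal.coe_le_coe.2 (W.le_opNNNorm a)
  calc eLpNorm (adaptedRightInverse A m hc B W z) (ENNReal.ofReal p) m
      ≤ eLpNorm (W (z.1 - B (vertical A m hc z.2))) (ENNReal.ofReal p) m +
          eLpNorm (vertical A m hc z.2) (ENNReal.ofReal p) m :=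
        eLpNorm_add_le (W _).measurable.aestronglyMeasurable
          (vertical A m hc z.2).measurable.aestronglyMeasurable (ENNReal.one_le_ofReal.2 hp)
    _ ≤ ‖W‖₊ * (‖z.1‖ₑ + b * (M * N)) + M * N := by
        gcongr
        refine (hWa _).trans ?_
        gcongr
        exact enorm_sub_le.trans (add_le_add_right ((hB _).trans (by gcongr)) _)
    _ ≤ ‖W‖₊ * (‖z.1‖ₑ + b * (M * N)) + M * N + (‖W‖₊ * N + ‖W‖₊ * (b * M) * ‖z.1‖ₑ + M * ‖z.1‖ₑ) :=
        le_self_add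
    _ = _ := by
        push_cast
        ring

end AdaptedRightInverse

section DiffQuot

variable {d l : ℕ} {ψ : X d → EuclideanSpace ℝ (Fin l)} {K B : ℝ≥0}

theorem norm_sub_sub_fderiv_le (hψ : Differentiable ℝ ψ) (hB : LipschitzWith B (fderiv ℝ ψ))
    {ρ : ℝ} (x : X d) {u v : X d} (hu : ‖u‖ ≤ ρ) (hv : ‖v‖ ≤ ρ) :
    ‖ψ (x + u) - ψ (x + v) - fderiv ℝ ψ x (u - v)‖ ≤ B * ρ * ‖u - v‖ := by
  rw [← add_sub_add_left_eq_sub u v x]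
  refine (convex_closedBall x ρ).norm_image_sub_le_of_norm_fderiv_le' (𝕜 := ℝ)
    (fun z _ => hψ z) (fun z hz => ?_) (by simpa using hv) (by simpa using hu)
  refine (hB.norm_sub_le z x).trans ?_
  gcongr
  exact mem_closedBall_iff_norm.1 hz

theorem norm_inv_smul_sub_le (hψ : LipschitzWith K ψ) (r : ℝ) (x u : X d) :
    ‖r⁻¹ • (ψ (x + r • u) - ψ x)‖ ≤ K * ‖u‖ := by
  rcases eq_or_ne r 0 with rfl | hr
  · rw [inv_zero, zero_smul, norm_zero]
    positivity
  rw [norm_smul, norm_inv, inv_mul_le_iff₀ (norm_pos_iff.2 hr)]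
  refine (hψ.norm_sub_le _ _).trans_eq ?_
  rw [add_sub_cancel_left, norm_smul, mul_left_comm]

/-- The difference quotient `(ψ(x + r U(x)) - ψ(x)) / r` of a Lipschitz map along a bounded field;
it is `0` for `r = 0`. -/
noncomputable def diffQuot (hψ : LipschitzWith K ψ) (r : ℝ) (U : BoundedMeasurable (X d) (X d)) :
    BoundedMeasurable (X d) (EuclideanSpace ℝ (Fin l)) :=
  .ofBound (fun x => r⁻¹ • (ψ (x + r • U x) - ψ x))
    (((hψ.continuous.measurable.comp (measurable_id.add (U.measurable.const_smul r))).sub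
      hψ.continuous.measurable).const_smul r⁻¹) (K * ‖U‖) fun x =>
        (norm_inv_smul_sub_le hψ r x (U x)).trans (by gcongr; exact U.norm_apply_le x)

theorem diffQuot_apply (hψ : LipschitzWith K ψ) (r : ℝ) (U : BoundedMeasurable (X d) (X d))
    (x : X d) : diffQuot hψ r U x = r⁻¹ • (ψ (x + r • U x) - ψ x) :=
  rfl

theorem diffQuot_zero (hψ : LipschitzWith K ψ) (r : ℝ) : diffQuot hψ r 0 = 0 := by
  refine Subtype.ext <| lp.ext <| funext fun x => ?_
  refine (diffQuot_apply hψ r 0 x).trans ?_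
  change r⁻¹ • (ψ (x + r • (0 : X d)) - ψ x) = 0
  rw [smul_zero, add_zero, sub_self, smul_zero]

theorem norm_diffQuot_sub_le (hψ : LipschitzWith K ψ) (hd : Differentiable ℝ ψ)
    (hB : LipschitzWith B (fderiv ℝ ψ))
    {A : BoundedMeasurable (X d) (X d →L[ℝ] EuclideanSpace ℝ (Fin l))}
    (hA : ∀ x, A x = fderiv ℝ ψ x) {r R : ℝ} (hr : 0 < r) {U V : BoundedMeasurable (X d) (X d)}
    (hU : ‖U‖ ≤ R) (hV : ‖V‖ ≤ R) :
    ‖diffQuot hψ r U - diffQuot hψ r V - BoundedMeasurable.applyL A (U - V)‖ ≤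
      B * (r * R) * ‖U - V‖ := by
  have hR : 0 ≤ R := (norm_nonneg U).trans hU
  have hscale {W : BoundedMeasurable (X d) (X d)} (hW : ‖W‖ ≤ R) (x : X d) :
      ‖r • W x‖ ≤ r * R := by
    rw [norm_smul, Real.norm_of_nonneg hr.le]
    gcongr
    exact (W.norm_apply_le x).trans hW
  refine BoundedMeasurable.norm_le (by positivity) fun x => ?_
  have hpt : (diffQuot hψ r U - diffQuot hψ r V - BoundedMeasurable.applyL A (U - V)) x =
      r⁻¹ • (ψ (x + r • U x) - ψ (x + r • V x) - fderiv ℝ ψ x (r • U x - r • V x)) := by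
    change r⁻¹ • (ψ (x + r • U x) - ψ x) - r⁻¹ • (ψ (x + r • V x) - ψ x) - A x (U x - V x) = _
    rw [hA, ← smul_sub r, map_smul, smul_sub r⁻¹ _ (r • _), inv_smul_smul₀ hr.ne', ← smul_sub,
      sub_sub_sub_cancel_right]
  rw [hpt, norm_smul, norm_inv, Real.norm_of_nonneg hr.le, inv_mul_le_iff₀ hr]
  refine (norm_sub_sub_fderiv_le hd hB x (hscale hU x) (hscale hV x)).trans ?_
  rw [← smul_sub, norm_smul, Real.norm_of_nonneg hr.le, mul_left_comm]
  gcongr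
  exact (U - V).norm_apply_le x

end DiffQuot

section Residual

variable {d k l : ℕ} {ψ : X d → EuclideanSpace ℝ (Fin l)} {K B : ℝ≥0}
  {m : Measure (X d)} [IsFiniteMeasure m]
  {A : BoundedMeasurable (X d) (X d →L[ℝ] EuclideanSpace ℝ (Fin l))}

theorem norm_kerEL_apply_le (f : BoundedMeasurable (X d) (EuclideanSpace ℝ (Fin l))) :
    ‖kerEL m f‖ ≤ ‖f‖ :=
  BoundedMeasurable.norm_le (norm_nonneg f) (norm_kerE_le f.norm_apply_le)

theorem norm_kerEL_diffQuot_sub_le (hψ : LipschitzWith K ψ) (hd : Differentiable ℝ ψ)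
    (hB : LipschitzWith B (fderiv ℝ ψ)) (hA : ∀ x, A x = fderiv ℝ ψ x) {r R : ℝ} (hr : 0 < r)
    {U V : BoundedMeasurable (X d) (X d)} (hU : ‖U‖ ≤ R) (hV : ‖V‖ ≤ R) :
    ‖kerEL m (diffQuot hψ r U) - kerEL m (diffQuot hψ r V) - condDeriv A m (U - V)‖ ≤
      B * (r * R) * ‖U - V‖ := by
  rw [condDeriv, ContinuousLinearMap.comp_apply, ← map_sub, ← map_sub]
  exact (norm_kerEL_apply_le _).trans (norm_diffQuot_sub_le hψ hd hB hA hr hU hV)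

/-- Restriction of bounded functions to a measurable set, extended by `0`. -/
noncomputable def restrictL {G : Set (S d)} (hG : MeasurableSet G) :
    BoundedMeasurable (S d) (EuclideanSpace ℝ (Fin l)) →L[ℝ]
      BoundedMeasurable (S d) (EuclideanSpace ℝ (Fin l)) :=
  LinearMap.mkContinuous
    { toFun g := .ofBound (G.indicator g) (g.measurable.indicator hG) ‖g‖ fun y =>
        (norm_indicator_le_norm_self _ _).trans (g.norm_apply_le y)
      map_add' g g' := Subtype.ext <| lp.ext <| Set.indicator_add G g g'
      map_smul' a g := Subtype.ext <| lp.ext <| Set.indicator_const_smul G a g } 1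
    fun g => BoundedMeasurable.norm_le (by positivity) fun y =>
      ((norm_indicator_le_norm_self _ _).trans (g.norm_apply_le y)).trans_eq (one_mul _).symm

theorem restrictL_apply {G : Set (S d)} (hG : MeasurableSet G)
    (g : BoundedMeasurable (S d) (EuclideanSpace ℝ (Fin l))) (y : S d) :
    restrictL hG g y = G.indicator g y :=
  rfl

theorem restrictL_congr {G : Set (S d)} (hG : MeasurableSet G)
    {g g' : BoundedMeasurable (S d) (EuclideanSpace ℝ (Fin l))} (h : ∀ y ∈ G, g y = g' y) :
    restrictL hG g = restrictL hG g' :=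
  Subtype.ext <| lp.ext <| Set.indicator_congr h

theorem norm_restrictL_apply_le {G : Set (S d)} (hG : MeasurableSet G)
    (g : BoundedMeasurable (S d) (EuclideanSpace ℝ (Fin l))) : ‖restrictL hG g‖ ≤ ‖g‖ :=
  BoundedMeasurable.norm_le (norm_nonneg g) fun y =>
    (norm_indicator_le_norm_self _ _).trans (g.norm_apply_le y)

theorem eventually_mul_lt (c : ℝ) {ε : ℝ} (hε : 0 < ε) : ∀ᶠ r in 𝓝[>] (0 : ℝ), r * c < ε :=
  (Tendsto.mono_left (Continuous.tendsto' (by fun_prop) 0 0 (zero_mul c))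
    nhdsWithin_le_nhds).eventually_lt_const hε

/-- The rescaled constraint `𝔼[ψ(X + r (Θ + T z)) | X₁] / r` on `G`, and `z₂` off `G`: its
linearisation in `z` is `z₂` if `𝔼[A (T z) | X₁] = z₂` on `G`. -/
noncomputable def residual (hψ : LipschitzWith K ψ) (m : Measure (X d)) [IsFiniteMeasure m]
    {G : Set (S d)} (hG : MeasurableSet G) (Θ : BoundedMeasurable (X d) (X d))
    (T : EuclideanSpace ℝ (Fin k) × BoundedMeasurable (S d) (EuclideanSpace ℝ (Fin l)) →L[ℝ]
      BoundedMeasurable (X d) (X d)) (r : ℝ)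
    (z : EuclideanSpace ℝ (Fin k) × BoundedMeasurable (S d) (EuclideanSpace ℝ (Fin l))) :
    BoundedMeasurable (S d) (EuclideanSpace ℝ (Fin l)) :=
  z.2 + restrictL hG (kerEL m (diffQuot hψ r (Θ + T z)) - z.2)

variable {G : Set (S d)} {hG : MeasurableSet G} {Θ : BoundedMeasurable (X d) (X d)}
  {T : EuclideanSpace ℝ (Fin k) × BoundedMeasurable (S d) (EuclideanSpace ℝ (Fin l)) →L[ℝ]
    BoundedMeasurable (X d) (X d)}

theorem kerE_diffQuot_eq_zero_of_residual_eq_zero {hψ : LipschitzWith K ψ} {r : ℝ}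
    {z : EuclideanSpace ℝ (Fin k) × BoundedMeasurable (S d) (EuclideanSpace ℝ (Fin l))}
    (h : residual hψ m hG Θ T r z = 0) {y : S d} (hy : y ∈ G) :
    kerE m (diffQuot hψ r (Θ + T z)) y = 0 := by
  have hzero : z.2 y + G.indicator
      (kerEL m (diffQuot hψ r (Θ + T z)) - z.2 : BoundedMeasurable _ _) y = 0 :=
    congrArg (fun g : BoundedMeasurable (S d) (EuclideanSpace ℝ (Fin l)) => g y) h
  rw [Set.indicator_of_mem hy] at hzero
  exact (add_sub_cancel (z.2 y) _).symm.trans hzero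

theorem eventually_norm_residual_sub_le (hψ : LipschitzWith K ψ) (hd : Differentiable ℝ ψ)
    (hB : LipschitzWith B (fderiv ℝ ψ)) (hA : ∀ x, A x = fderiv ℝ ψ x)
    (hT : ∀ z, ∀ y ∈ G, condDeriv A m (T z) y = z.2 y)
    (z₀ : EuclideanSpace ℝ (Fin k) × BoundedMeasurable (S d) (EuclideanSpace ℝ (Fin l)))
    {ε : ℝ} (hε : 0 < ε) : ∀ᶠ r in 𝓝[>] (0 : ℝ), ∀ z ∈ Metric.closedBall z₀ 1,
      ∀ z' ∈ Metric.closedBall z₀ 1,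
      ‖residual hψ m hG Θ T r z - residual hψ m hG Θ T r z' - (z.2 - z'.2)‖ ≤ ε * ‖z - z'‖ := by
  set R := ‖Θ‖ + ‖T‖ * (‖z₀‖ + 1)
  filter_upwards [self_mem_nhdsWithin, eventually_mul_lt (B * R * ‖T‖) hε]
    with r (hr : 0 < r) hrε z hz z' hz'
  have hsub : residual hψ m hG Θ T r z - residual hψ m hG Θ T r z' - (z.2 - z'.2) =
      restrictL hG (kerEL m (diffQuot hψ r (Θ + T z)) - kerEL m (diffQuot hψ r (Θ + T z')) -
        condDeriv A m (Θ + T z - (Θ + T z'))) := by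
    rw [add_sub_add_left_eq_sub, ← map_sub T, map_sub _ (_ - _) (condDeriv A m _),
      restrictL_congr hG (hT (z - z')), residual, residual]
    simp only [map_sub, Prod.snd_sub]
    abel
  rw [hsub]
  calc _ ≤ B * (r * R) * ‖Θ + T z - (Θ + T z')‖ := (norm_restrictL_apply_le hG _).trans <|
        norm_kerEL_diffQuot_sub_le hψ hd hB hA hr (norm_add_map_le_of_mem_closedBall T Θ hz)
          (norm_add_map_le_of_mem_closedBall T Θ hz')
    _ ≤ B * (r * R) * (‖T‖ * ‖z - z'‖) := by
        rw [add_sub_add_left_eq_sub, ← map_sub T]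
        gcongr
        exact T.le_opNorm _
    _ = r * (B * R * ‖T‖) * ‖z - z'‖ := by ring
    _ ≤ ε * ‖z - z'‖ := by gcongr

theorem tendsto_residual (hψ : LipschitzWith K ψ) (hd : Differentiable ℝ ψ)
    (hB : LipschitzWith B (fderiv ℝ ψ)) (hA : ∀ x, A x = fderiv ℝ ψ x)
    (hT : ∀ z, ∀ y ∈ G, condDeriv A m (T z) y = z.2 y)
    {z₀ : EuclideanSpace ℝ (Fin k) × BoundedMeasurable (S d) (EuclideanSpace ℝ (Fin l))}
    (hz₀ : z₀.2 = -restrictL hG (condDeriv A m Θ)) :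
    Tendsto (fun r => residual hψ m hG Θ T r z₀) (𝓝[>] 0) (𝓝 0) := by
  set U := Θ + T z₀
  have hidem : restrictL hG z₀.2 = z₀.2 := by
    rw [hz₀, map_neg, restrictL_congr hG fun y hy => Set.indicator_of_mem hy _]
  have hzero : restrictL hG (condDeriv A m U) = 0 := by
    rw [map_add, map_add, restrictL_congr hG (hT z₀), hidem, hz₀, add_neg_cancel]
  have hres (r : ℝ) : residual hψ m hG Θ T r z₀ = restrictL hG
      (kerEL m (diffQuot hψ r U) - kerEL m (diffQuot hψ r 0) - condDeriv A m (U - 0)) := by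
    rw [diffQuot_zero, map_zero, sub_zero, sub_zero, map_sub, hzero, residual, map_sub, hidem]
    abel
  have hlim : Tendsto (fun r : ℝ => B * (r * ‖U‖) * ‖U - 0‖) (𝓝[>] 0) (𝓝 0) := by
    refine Tendsto.mono_left (Continuous.tendsto' (by fun_prop) _ _ ?_) nhdsWithin_le_nhds
    rw [zero_mul, mul_zero, zero_mul]
  refine squeeze_zero_norm' ?_ hlim
  filter_upwards [self_mem_nhdsWithin] with r (hr : 0 < r)
  rw [hres]
  exact (norm_restrictL_apply_le hG _).trans <| norm_kerEL_diffQuot_sub_le hψ hd hB hA hr le_rfl <|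
    norm_zero.trans_le (norm_nonneg U)

end Residual

section Bicausal

variable {d : ℕ} {p : ℝ}

theorem exists_measurable_leftInverse_id_add {E : Type*} [NormedAddCommGroup E] [CompleteSpace E]
    [MeasurableSpace E] [BorelSpace E] {K : ℝ≥0} {q : E → E} (hq : LipschitzWith K q)
    (hK : K < 1) : ∃ g : E → E, Measurable g ∧ ∀ y, g (y + q y) = y := by
  have hanti := AntilipschitzWith.id.add_lipschitzWith hq (by rwa [inv_one])
  have hemb := (hanti.isClosedEmbedding
    (LipschitzWith.id.add hq).uniformContinuous).measurableEmbedding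
  obtain ⟨g, hg, hgq⟩ := hemb.exists_measurable_extend measurable_id fun y => ⟨y⟩
  exact ⟨g, hg, congrFun hgq⟩

theorem transportDist_adapted_shift_shift_le (hp : 0 < p) (m : Measure (X d)) [IsFiniteMeasure m]
    {U V : BoundedMeasurable (X d) (X d)} {θ τ : S d → S d} {K L : ℝ≥0} (hθ : LipschitzWith K θ)
    (hτ : LipschitzWith L τ) (hK : K < 1) (hL : L < 1) (hU : ∀ x, (U x).fst = θ x.fst)
    (hV : ∀ x, (V x).fst = τ x.fst) : transportDist .adapted p (shift m U) (shift m V) ≤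
      eLpNorm (fun x => x + U x - (x + V x)) (ENNReal.ofReal p) m := by
  obtain ⟨g, hg, hgθ⟩ := exists_measurable_leftInverse_id_add hθ hK
  obtain ⟨g', hg', hgτ⟩ := exists_measurable_leftInverse_id_add hτ hL
  have hθm := hθ.continuous.measurable
  have hτm := hτ.continuous.measurable
  refine transportDist_adapted_map_map_le hp (measurable_id.add U.measurable)
    (measurable_id.add V.measurable) (q := fun y => g y + τ (g y))
    (q' := fun y => g' y + θ (g' y)) (by fun_prop) (by fun_prop) (fun x => ?_) fun x => ?_
  · change x.fst + (V x).fst = g (x.fst + (U x).fst) + τ (g (x.fst + (U x).fst))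
    rw [hU, hV, hgθ]
  · change x.fst + (U x).fst = g' (x.fst + (V x).fst) + θ (g' (x.fst + (V x).fst))
    rw [hU, hV, hgτ]

theorem transportDist_adapted_shift_smul_le (hp : 0 < p) (m : Measure (X d)) [IsFiniteMeasure m]
    {Θ W : BoundedMeasurable (X d) (X d)} {θ τ : S d → S d} {K L : ℝ≥0} (hθ : LipschitzWith K θ)
    (hτ : LipschitzWith L τ) (hΘ : ∀ x, (Θ x).fst = θ x.fst) (hW : ∀ x, (W x).fst = τ x.fst)
    {r : ℝ} (hr : 0 ≤ r) (hrKL : r * (K + L) < 1) :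
    transportDist .adapted p (shift m (r • Θ)) (shift m (r • (Θ + W))) ≤
      ENNReal.ofReal r * eLpNorm W (ENNReal.ofReal p) m := by
  have hsum : ‖r‖₊ * (K + L) < 1 := by
    rw [← NNReal.coe_lt_coe]
    simpa [abs_of_nonneg hr] using hrKL
  rw [← eLpNorm_shift_sub_shift hr Θ]
  refine transportDist_adapted_shift_shift_le (U := r • Θ) (V := r • (Θ + W)) hp m
    ((lipschitzWith_smul r).comp hθ)
    ((lipschitzWith_smul r).comp (hθ.add hτ)) ((mul_le_mul_right le_self_add _).trans_lt hsum) hsum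
    (fun x => ?_) fun x => ?_
  · change r • (Θ x).fst = r • θ x.fst
    rw [hΘ]
  · change r • ((Θ x).fst + (W x).fst) = r • (θ x.fst + τ x.fst)
    rw [hΘ, hW]

end Bicausal

section Constraint

variable {d l : ℕ} {p : ℝ} {ψ : X d → EuclideanSpace ℝ (Fin l)} {K : ℝ≥0}

theorem Pp.integrable_of_lipschitzWith (hp : 1 ≤ p) (μ : Pp d p) (hψ : LipschitzWith K ψ) :
    Integrable ψ μ.1 := by
  have hid : Integrable id μ.1 := (μ.memLp_id (by linarith)).integrable (by simpa using hp)
  refine ((integrable_const ‖ψ 0‖).add (hid.norm.const_mul K)).mono'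
    hψ.continuous.aestronglyMeasurable (.of_forall fun x => ?_)
  calc ‖ψ x‖ ≤ ‖ψ 0‖ + ‖ψ x - ψ 0‖ := norm_le_norm_add_norm_sub' _ _
    _ ≤ ‖ψ 0‖ + K * ‖x‖ := by
      gcongr
      simpa only [sub_zero] using hψ.norm_sub_le x 0

theorem integral_inner_comp_fst_eq_zero {m : Measure (X d)} [IsFiniteMeasure m]
    {f : X d → EuclideanSpace ℝ (Fin l)} (hf : Integrable f m)
    (hf0 : (fun x => kerE m f x.fst) =ᵐ[m] 0)
    (a : BoundedMeasurable (S d) (EuclideanSpace ℝ (Fin l))) :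
    Integrable (fun x => inner ℝ (a x.fst) (f x)) m ∧
      ∫ x, inner ℝ (a x.fst) (f x) ∂m = 0 := by
  have hint : Integrable (fun x => inner ℝ (a x.fst) (f x)) m :=
    (BoundedMeasurable.integrable_inner hf (BoundedMeasurable.compL _ (by fun_prop) a)).congr
      (.of_forall fun x => real_inner_comm _ _)
  refine ⟨hint, ?_⟩
  rw [← integral_inner_kerE hf hint]
  refine integral_eq_zero_of_ae ?_
  filter_upwards [hf0] with x hx
  rw [hx, Pi.zero_apply, inner_zero_right, Pi.zero_apply]

theorem push_mem_perp_calE (hp : 1 ≤ p) (μ : Pp d p) (hψ : LipschitzWith K ψ)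
    (hψ0 : condE1 μ.1 ψ =ᵐ[μ.1] 0) {r : ℝ} (hr : r ≠ 0) {U : BoundedMeasurable (X d) (X d)}
    (hU : U ∈ adaptedFields d)
    (h : (fun x => kerE μ.1 (diffQuot hψ r U) x.fst) =ᵐ[μ.1] 0) :
    push hp μ (r • U) ∈ perp p (calE ψ) := by
  rintro f ⟨g, ⟨hg, B, hB⟩, rfl⟩
  obtain ⟨L, θ, hθ, hUθ⟩ := hU
  have hψi := μ.integrable_of_lipschitzWith hp hψ
  have hθm := hθ.continuous.measurable
  have hgm := hg.continuous.measurable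
  let a : BoundedMeasurable (S d) (EuclideanSpace ℝ (Fin l)) :=
    .ofBound (fun y => g (y + r • θ y)) (by fun_prop) B fun y => (hB _).1
  have hsplit (x : X d) : inner ℝ (g (x + r • U x).fst) (ψ (x + r • U x)) =
      r * inner ℝ (a x.fst) (diffQuot hψ r U x) + inner ℝ (a x.fst) (ψ x) := by
    rw [← real_inner_smul_right, ← inner_add_right, diffQuot_apply, smul_inv_smul₀ hr,
      sub_add_cancel]
    exact congrArg (fun y => inner ℝ (g (x.fst + r • y)) _) (hUθ x)
  obtain ⟨hDi, hD0⟩ := integral_inner_comp_fst_eq_zero (diffQuot hψ r U).integrable h a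
  obtain ⟨hψi', hψ0'⟩ := integral_inner_comp_fst_eq_zero hψi
    ((condE1_ae_eq_kerE hψi).symm.trans hψ0) a
  have hshift : Measurable fun x => x + (r • U) x := measurable_id.add (r • U).measurable
  calc ∫ x, inner ℝ (g x.fst) (ψ x) ∂(push hp μ (r • U)).1
      = ∫ x, inner ℝ (g (x + r • U x).fst) (ψ (x + r • U x)) ∂μ.1 :=
        integral_map hshift.aemeasurable (Measurable.aestronglyMeasurable
          ((hgm.comp (by fun_prop)).inner hψ.continuous.measurable))
    _ = r * ∫ x, inner ℝ (a x.fst) (diffQuot hψ r U x) ∂μ.1 +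
          ∫ x, inner ℝ (a x.fst) (ψ x) ∂μ.1 := by
        rw [← integral_const_mul, ← integral_add (hDi.const_mul r) hψi']
        exact integral_congr_ae (.of_forall hsplit)
    _ = 0 := by rw [hD0, hψ0', mul_zero, add_zero]

end Constraint

section Adapted

variable {d k l : ℕ} {p : ℝ} {φ : Pp d p → EuclideanSpace ℝ (Fin k)}
  {D : Pp d p → X d → EuclideanSpace ℝ (Fin k)} {ψ : X d → EuclideanSpace ℝ (Fin l)} {K : ℝ≥0}

theorem eventually_push_mem_perp_calE_and_transportDist_le (hp : 1 ≤ p) (μ : Pp d p)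
    (hψ : LipschitzWith K ψ) (hψ0 : condE1 μ.1 ψ =ᵐ[μ.1] 0) {G : Set (S d)}
    {hG : MeasurableSet G} (hGae : ∀ᵐ x ∂μ.1, x.fst ∈ G) {Θ : BoundedMeasurable (X d) (X d)}
    (hΘ : Θ ∈ adaptedFields d)
    {T : EuclideanSpace ℝ (Fin k) × BoundedMeasurable (S d) (EuclideanSpace ℝ (Fin l)) →L[ℝ]
      BoundedMeasurable (X d) (X d)} {L : ℝ≥0}
    (hT : ∀ z, ∃ τ : S d → S d, LipschitzWith (L * ‖z‖₊) τ ∧ ∀ x, (T z x).fst = τ x.fst)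
    (z₀ : EuclideanSpace ℝ (Fin k) × BoundedMeasurable (S d) (EuclideanSpace ℝ (Fin l))) :
    ∀ᶠ r in 𝓝[>] (0 : ℝ), ∀ z ∈ Metric.closedBall z₀ 1, residual hψ μ.1 hG Θ T r z = 0 →
      push hp μ (r • (Θ + T z)) ∈ perp p (calE ψ) ∧
      transportDist .adapted p (shift μ.1 (r • Θ)) (push hp μ (r • (Θ + T z))).1 ≤
        ENNReal.ofReal r * eLpNorm (T z) (ENNReal.ofReal p) μ.1 := by
  obtain ⟨K', θ, hθ, hΘθ⟩ := id hΘ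
  filter_upwards [self_mem_nhdsWithin, eventually_mul_lt (K' + L * (‖z₀‖ + 1)) one_pos]
    with r (hr : 0 < r) hrL z hz hres
  obtain ⟨τ, hτ, hTτ⟩ := hT z
  constructor
  · refine push_mem_perp_calE hp μ hψ hψ0 hr.ne' (add_mem hΘ ⟨_, τ, hτ, hTτ⟩) ?_
    filter_upwards [hGae] with x hx using kerE_diffQuot_eq_zero_of_residual_eq_zero hres hx
  · refine transportDist_adapted_shift_smul_le (by linarith) μ.1 hθ hτ hΘθ hTτ hr.le
      (lt_of_le_of_lt ?_ hrL)
    push_cast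
    gcongr
    exact norm_le_norm_add_const_of_dist_le hz

theorem RegularFunctional.limsup_distToSet_adapted_le (hp : 1 ≤ p) (h : RegularFunctional φ D)
    (μ : Pp d p) (hμ : φ μ = 0) (hψ : LipschitzWith K ψ) (hd : Differentiable ℝ ψ) {K' : ℝ≥0}
    (hψ' : LipschitzWith K' (fderiv ℝ ψ)) (hψ0 : condE1 μ.1 ψ =ᵐ[μ.1] 0)
    {A : BoundedMeasurable (X d) (X d →L[ℝ] EuclideanSpace ℝ (Fin l))}
    (hA : ∀ x, A x = fderiv ℝ ψ x) {G : Set (S d)} (hG : MeasurableSet G)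
    (hGae : ∀ᵐ x ∂μ.1, x.fst ∈ G)
    {T : EuclideanSpace ℝ (Fin k) × BoundedMeasurable (S d) (EuclideanSpace ℝ (Fin l)) →L[ℝ]
      BoundedMeasurable (X d) (X d)}
    (hT₁ : ∀ z, ∫ x, fderiv ℝ (D μ) x (T z x) ∂μ.1 = z.1)
    (hT₂ : ∀ z, ∀ y ∈ G, condDeriv A μ.1 (T z) y = z.2 y) {L : ℝ≥0}
    (hT : ∀ z, ∃ τ : S d → S d, LipschitzWith (L * ‖z‖₊) τ ∧ ∀ x, (T z x).fst = τ x.fst)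
    {Θ : BoundedMeasurable (X d) (X d)} (hΘ : Θ ∈ adaptedFields d) :
    limsup (fun r : ℝ => distToSet .adapted (shift μ.1 (r • Θ)) (φ ⁻¹' {0} ∩ perp p (calE ψ))
        / ENNReal.ofReal r) (𝓝[>] 0) ≤
      eLpNorm (T (-∫ x, fderiv ℝ (D μ) x (Θ x) ∂μ.1, -restrictL hG (condDeriv A μ.1 Θ)))
        (ENNReal.ofReal p) μ.1 :=
  h.limsup_distToSet_le hp μ hμ .adapted hT₁ Θ rfl (F := residual hψ μ.1 hG Θ T)
    (fun _ hε => eventually_norm_residual_sub_le hψ hd hψ' hA hT₂ _ hε)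
    (tendsto_residual hψ hd hψ' hA hT₂ rfl)
    (eventually_push_mem_perp_calE_and_transportDist_le hp μ hψ hψ0 hGae hΘ hT _)

end Adapted

section Qualification

variable {d k l : ℕ}

/-- The form of the assumption for `𝕎_p^ad` under which the estimate holds. The quantitative bound
(iv) is weakened to injectivity in `λ`. -/
structure AdaptedQualification (p : ℝ) (μ : Measure (X d))
    (Dμ : X d → EuclideanSpace ℝ (Fin k)) (ψ : X d → EuclideanSpace ℝ (Fin l)) : Prop where
  contDiff : ContDiff ℝ 1 ψ
  lipschitz : ∃ K, LipschitzWith K ψ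
  lipschitz_fderiv : ∃ K, LipschitzWith K (fderiv ℝ ψ)
  condE1_ae_eq_zero : condE1 μ ψ =ᵐ[μ] 0
  gram : ∃ c > (0 : ℝ), ∀ᵐ x ∂μ,
    (condGram μ ψ x - c • (1 : Matrix (Fin l) (Fin l) ℝ)).PosSemidef
  eq_zero : ∀ lam (g : S d → EuclideanSpace ℝ (Fin l)),
    MemLp g (ENNReal.ofReal (conj p)) (μ.map fun x => x.fst) →
    (fun x => tmulV (grad .adapted μ Dμ x) lam +
      tmulV (grad .adapted μ ψ x) (g x.fst)) =ᵐ[μ] 0 → lam = 0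

variable {p : ℝ} {φ : Pp d p → EuclideanSpace ℝ (Fin k)}
  {D : Pp d p → X d → EuclideanSpace ℝ (Fin k)} {ψ : X d → EuclideanSpace ℝ (Fin l)}

theorem eLpNorm_restrictL_condDeriv {m : Measure (X d)} [IsFiniteMeasure m]
    {A : BoundedMeasurable (X d) (X d →L[ℝ] EuclideanSpace ℝ (Fin l))} (hψ : ContDiff ℝ 1 ψ)
    (hA : ∀ x, A x = fderiv ℝ ψ x) {G : Set (S d)} (hG : MeasurableSet G)
    (hGae : ∀ᵐ x ∂m, x.fst ∈ G) {Θ : BoundedMeasurable (X d) (X d)} (hΘ : Θ ∈ adaptedFields d)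
    (q : ℝ≥0∞) : eLpNorm (fun x => restrictL hG (condDeriv A m Θ) x.fst) q m =
      eLpNorm (opL2 .adapted m ψ Θ) q m := by
  refine eLpNorm_congr_ae ?_
  filter_upwards [hGae, condE1_mulV_grad_adapted (hψ.differentiable one_ne_zero)
    (integrable_jac hψ hA) hΘ] with x hx hop
  rw [restrictL_apply, Set.indicator_of_mem hx, condDeriv_apply]
  simp only [hA]
  exact hop.symm

theorem RegularFunctional.exists_limsup_distToSet_adapted_le (hp : 1 < p)
    (h : RegularFunctional φ D) (μ : Pp d p) (hμ : φ μ = 0)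
    (hQ : AdaptedQualification p μ.1 (D μ) ψ) :
    ∃ C : ℝ≥0, 0 < C ∧ ∀ Θ ∈ adaptedFields d,
      limsup (fun r : ℝ => distToSet .adapted (shift μ.1 (r • Θ)) (φ ⁻¹' {0} ∩ perp p (calE ψ))
          / ENNReal.ofReal r) (𝓝[>] 0)
        ≤ C * opNorm .adapted p μ.1 (D μ) ψ Θ := by
  obtain ⟨K, hK⟩ := hQ.lipschitz
  obtain ⟨K', hK'⟩ := hQ.lipschitz_fderiv
  obtain ⟨c, hc, hgram⟩ := hQ.gram
  have hd := hQ.contDiff.differentiable one_ne_zero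
  let A : BoundedMeasurable (X d) (X d →L[ℝ] EuclideanSpace ℝ (Fin l)) :=
    .ofBound (fderiv ℝ ψ) hK'.continuous.measurable K fun x => norm_fderiv_le_of_lipschitz ℝ hK
  have hA (x : X d) : A x = fderiv ℝ ψ x := rfl
  obtain ⟨W, L, hW⟩ := h.exists_adapted_rightInverse_fst hp hQ.contDiff hA hc hQ.eq_zero
  have hDq := h.memLp_fderiv hp μ
  let B := BoundedMeasurable.integralL (h.integrable_fderiv hp.le μ μ)
  obtain ⟨M, hM⟩ := exists_lipschitzWith_fst_adaptedRightInverse (A := A) (m := μ.1) (B := B) hc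
    fun z => (hW z).2.2
  obtain ⟨C, hC⟩ := eLpNorm_adaptedRightInverse_le (A := A) (W := W) hp.le hc (B := B)
    (b := (eLpNorm (fderiv ℝ (D μ)) (ENNReal.ofReal (conj p)) μ.1).toNNReal) fun U => by
      rw [ENNReal.coe_toNNReal hDq.2.ne]
      exact enorm_integral_apply_le hp hDq.1 U.measurable.aestronglyMeasurable
  refine ⟨C + 1, by positivity, fun Θ hΘ => ?_⟩
  have hG := measurableSet_goodPoints A μ.1 c
  have hGae := ae_fst_mem_goodPoints hd hA hgram
  have hlim := h.limsup_distToSet_adapted_le hp.le μ hμ hK hd hK' hQ.condE1_ae_eq_zero hA hG hGae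
    (map_adaptedRightInverse (B := B) hc fun z => (hW z).1)
    (fun z y hy => condDeriv_adaptedRightInverse_of_mem hc hy (fun a => (hW a).2.1 y hy) z) hM hΘ
  refine hlim.trans ((hC _).trans ?_)
  have hop1 : opL1 .adapted μ.1 (D μ) Θ = ∫ x, fderiv ℝ (D μ) x (Θ x) ∂μ.1 :=
    integral_mulV_grad_adapted (h.differentiable μ)
      (fun i => (h.memLp_jac hp μ i).integrable (one_le_ofReal_conj hp)) hΘ
  have hneg : eLpNorm (fun x => (-restrictL hG (condDeriv A μ.1 Θ)) x.fst) (ENNReal.ofReal p) μ.1 =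
      eLpNorm (opL2 .adapted μ.1 ψ Θ) (ENNReal.ofReal p) μ.1 :=
    (eLpNorm_neg _ _ _).trans (eLpNorm_restrictL_condDeriv hQ.contDiff hA hG hGae hΘ _)
  rw [opNorm, hop1, ← hneg, enorm_neg]
  gcongr
  exact le_self_add

end Qualification

section General

variable {d k l : ℕ} {p : ℝ} {φ : Pp d p → EuclideanSpace ℝ (Fin k)}
  {D : Pp d p → X d → EuclideanSpace ℝ (Fin k)} {ψ : X d → EuclideanSpace ℝ (Fin l)}

/-- The weakened form of `AssumptionA` under which the estimate holds. -/
def ConstraintQualification (kd : Kind) (p : ℝ) (μ : Measure (X d))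
    (Dμ : X d → EuclideanSpace ℝ (Fin k)) (ψ : X d → EuclideanSpace ℝ (Fin l)) : Prop :=
  match kd with
  | .classical => ψ = 0 ∧ ∀ lam, (fun x => tmulV (jac Dμ x) lam) =ᵐ[μ] 0 → lam = 0
  | .adapted => AdaptedQualification p μ Dμ ψ

/-- The displacement fields for which the estimate holds: all bounded measurable ones, respectively
those in `adaptedFields d`. -/
noncomputable def admissibleFields (d : ℕ) : Kind → Submodule ℝ (BoundedMeasurable (X d) (X d))
  | .classical => ⊤
  | .adapted => adaptedFields d

theorem AssumptionWad.adaptedQualification {μ : Measure (X d)}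
    {Dμ : X d → EuclideanSpace ℝ (Fin k)} (hA : AssumptionWad p μ Dμ ψ) :
    AdaptedQualification p μ Dμ ψ where
  contDiff := hA.psi_contDiff.of_le one_le_two
  lipschitz := by
    obtain ⟨K, hK⟩ := hA.psi_bounded
    exact ⟨K.toNNReal, lipschitzWith_of_nnnorm_fderiv_le
      (hA.psi_contDiff.differentiable two_ne_zero) fun x => NNReal.le_toNNReal_of_coe_le (hK x).1⟩
  lipschitz_fderiv := by
    obtain ⟨K, hK⟩ := hA.psi_bounded
    exact ⟨K.toNNReal, lipschitzWith_of_nnnorm_fderiv_le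
      ((hA.psi_contDiff.fderiv_right (m := 1) (by norm_num)).differentiable one_ne_zero)
      fun x => NNReal.le_toNNReal_of_coe_le (hK x).2⟩
  condE1_ae_eq_zero := hA.psi_cond
  gram := hA.gram
  eq_zero lam g hg hzero := by
    obtain ⟨c, hc, hbound⟩ := hA.nonredundant
    have hle := hbound lam g hg
    rw [eLpNorm_congr_ae hzero, eLpNorm_zero, nonpos_iff_eq_zero, mul_eq_zero, add_eq_zero] at hle
    exact enorm_eq_zero.1 (hle.resolve_left (ENNReal.ofReal_pos.2 hc).ne').1

theorem AssumptionA.constraintQualification (hp : 1 < p) (h : RegularFunctional φ D) {m : Pp d p}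
    {kd : Kind} (hA : AssumptionA kd p m.1 (D m) ψ) :
    ConstraintQualification kd p m.1 (D m) ψ := by
  cases kd with
  | classical =>
    exact ⟨AssumptionW.psi_zero hA, fun _ => AssumptionW.eq_zero_of_tmulV_jac_ae_eq_zero hp h hA⟩
  | adapted => exact AssumptionWad.adaptedQualification hA

theorem norm_le_norm_fst_add_norm_snd (x : X d) : ‖x‖ ≤ ‖x.fst‖ + ‖x.snd‖ := by
  refine abs_le_of_sq_le_sq' ?_ (by positivity) |>.2
  rw [WithLp.prod_norm_sq_eq_of_L2]
  nlinarith [mul_nonneg (norm_nonneg x.fst) (norm_nonneg x.snd)]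

theorem IsTestField.exists_mem_admissibleFields {kd : Kind} {Θ : X d → X d}
    (hΘ : IsTestField kd Θ) : ∃ U ∈ admissibleFields d kd, (U : X d → X d) = Θ := by
  cases kd with
  | classical =>
    obtain ⟨hcont, hsupp⟩ := hΘ
    obtain ⟨C, hC⟩ := hsupp.exists_bound_of_continuous hcont.continuous
    exact ⟨.ofBound Θ hcont.continuous.measurable C hC, Submodule.mem_top, rfl⟩
  | adapted =>
    obtain ⟨Θ₁, Θ₂, hcont₁, hsupp₁, hcont₂, hsupp₂, hΘ⟩ := hΘ
    obtain ⟨C₁, hC₁⟩ := hsupp₁.exists_bound_of_continuous hcont₁.continuous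
    obtain ⟨C₂, hC₂⟩ := hsupp₂.exists_bound_of_continuous hcont₂.continuous
    obtain ⟨K, hK⟩ := hcont₁.lipschitzWith_of_hasCompactSupport hsupp₁ one_ne_zero
    obtain rfl := funext hΘ
    have hcont : Continuous fun x : X d => (WithLp.toLp 2 (Θ₁ x.fst, Θ₂ x) : X d) :=
      (WithLp.prod_continuous_toLp 2 (S d) (S d)).comp
        ((hcont₁.continuous.comp (by fun_prop)).prodMk hcont₂.continuous)
    refine ⟨.ofBound _ hcont.measurable (C₁ + C₂) fun x => ?_, ⟨K, Θ₁, hK, fun _ => rfl⟩, rfl⟩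
    exact (norm_le_norm_fst_add_norm_snd _).trans (add_le_add (hC₁ x.fst) (hC₂ x))

end General

end ConstrainedDRO

theorem mainTheorem5_general {d k l : ℕ} (kd : Kind) (p : ℝ) (hp : 1 < p) (μ : Pp d p)
    (φ : Pp d p → EuclideanSpace ℝ (Fin k))
    (δφ : Pp d p → X d → EuclideanSpace ℝ (Fin k))
    (ψ : X d → EuclideanSpace ℝ (Fin l))
    (hφ : RegularFunctional φ δφ) (hφμ : φ μ = 0)
    (hA : ConstraintQualification kd p μ.1 (δφ μ) ψ) :
    ∃ C : ℝ≥0, 0 < C ∧ ∀ Θ ∈ admissibleFields d kd,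
      limsup (fun r : ℝ =>
          distToSet kd (shift μ.1 (r • Θ)) (φ ⁻¹' {0} ∩ perp p (calE ψ))
            / ENNReal.ofReal r) (𝓝[>] 0)
        ≤ C * opNorm kd p μ.1 (δφ μ) ψ Θ := by
  cases kd with
  | classical =>
    obtain ⟨rfl, hN⟩ := hA
    obtain ⟨C, hC, hle⟩ := hφ.exists_limsup_distToSet_classical_le hp μ hφμ hN
    refine ⟨C, hC, fun Θ _ => ?_⟩
    rw [perp_calE_zero]
    exact (hle Θ).trans (mul_le_mul_right le_self_add _)
  | adapted => exact hφ.exists_limsup_distToSet_adapted_le hp μ hφμ hA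

theorem mainTheorem5 {d k l : ℕ} (hd : 1 ≤ d) (kd : Kind) (p : ℝ) (hp : 1 < p)
    (μ : Pp d p)
    (φ : Pp d p → EuclideanSpace ℝ (Fin k))
    (δφ : Pp d p → X d → EuclideanSpace ℝ (Fin k))
    (ψ : X d → EuclideanSpace ℝ (Fin l))
    (hφ : RegularFunctional φ δφ) (hφμ : φ μ = 0)
    (hA : AssumptionA kd p μ.1 (δφ μ) ψ) :
    ∃ C : ℝ≥0, 0 < C ∧ ∀ Θ : X d → X d, IsTestField kd Θ →
      limsup (fun r : ℝ =>
          distToSet kd (shift μ.1 fun x => r • Θ x) (φ ⁻¹' {0} ∩ perp p (calE ψ))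
            / ENNReal.ofReal r) (𝓝[>] 0)
        ≤ C * opNorm kd p μ.1 (δφ μ) ψ Θ := by
  obtain ⟨C, hC, hle⟩ :=
    mainTheorem5_general kd p hp μ φ δφ ψ hφ hφμ (hA.constraintQualification hp hφ)
  refine ⟨C, hC, fun Θ hΘ => ?_⟩
  obtain ⟨U, hU, rfl⟩ := hΘ.exists_mem_admissibleFields
  exact hle U hU
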